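/- Let $r\ge 2$ be a natural number and let $k$ be an integer. An integer $n$ is called $r$-free if $p^r\nmid n$ for all primes $p$ (in particular $0$ is not $r$-free). For real $H\ge 1$ let $R(H,r,k)$ be the number of triples of integers $(x,y,z)$ with $1\le x,y,z\le H$ such that $x^2+y^2+z^2+k$ is $r$-free. For a positive integer $q$ let $$\lambda(q;k)=\#\{(x,y,z)\in\mathbb Z^3:\ 1\le x,y,z\le q,\ x^2+y^2+z^2+k\equiv 0 \pmod q\}.$$ Then the product $\prod_p\left(1-\frac{\lambda(p^r;k)}{p^{3r}}\right)$ over all primes $p$ converges unconditionally, and for every $\varepsilon>0$ the following hold for all real $H\ge 1$, with implied constants depending only on $r$, $k$ and $\varepsilon$. (i) If $k\ne 0$, then $$R(H,r,k)=\prod_p\left(1-\frac{\lambda(p^r;k)}{p^{3r}}\right)H^3+O\left(H^{2}+H^{\frac32+\frac{3}{2r}+\varepsilon}\right).$$ (ii) If $k=0$, then $$R(H,r,0)=\prod_p\left(1-\frac{\lambda(p^r;0)}{p^{3r}}\right)H^3+O\left(H^{2+\varepsilon}+H^{\frac{9r}{5r-2}+\varepsilon}\right).$$ -/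

import Mathlib

namespace RFreeValues

/-- An integer `n` is `r`-free if `p ^ r ∤ n` for all primes `p` (so `0` is not `r`-free). -/
def IsRFree (r : ℕ) (n : ℤ) : Prop :=
  ∀ p : ℕ, p.Prime → ¬ ((p : ℤ) ^ r ∣ n)

/-- The number of triples of positive integers `x, y, z ≤ H` (`H` real) for which
`x ^ 2 + y ^ 2 + z ^ 2 + k` is `r`-free. -/
noncomputable def R (H : ℝ) (r : ℕ) (k : ℤ) : ℕ :=
  open Classical in
  ((Finset.Icc 1 ⌊H⌋₊ ×ˢ Finset.Icc 1 ⌊H⌋₊ ×ˢ Finset.Icc 1 ⌊H⌋₊).filter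
    fun t : ℕ × ℕ × ℕ =>
      IsRFree r ((t.1 : ℤ) ^ 2 + (t.2.1 : ℤ) ^ 2 + (t.2.2 : ℤ) ^ 2 + k)).card

/-- The number of triples `1 ≤ x, y, z ≤ q` with `x ^ 2 + y ^ 2 + z ^ 2 + k ≡ 0 (mod q)`. -/
def lam (q : ℕ) (k : ℤ) : ℕ :=
  ((Finset.Icc 1 q ×ˢ Finset.Icc 1 q ×ˢ Finset.Icc 1 q).filter
    fun t : ℕ × ℕ × ℕ =>
      (t.1 : ℤ) ^ 2 + (t.2.1 : ℤ) ^ 2 + (t.2.2 : ℤ) ^ 2 + k ≡ 0 [ZMOD (q : ℤ)]).card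

/-- The factor `1 - λ(p ^ r; k) / p ^ (3 r)` of the Euler product at the prime `p`. -/
noncomputable def eulerFactor (r : ℕ) (k : ℤ) (p : Nat.Primes) : ℝ :=
  1 - (lam ((p : ℕ) ^ r) k : ℝ) / ((p : ℕ) : ℝ) ^ (3 * r)

end RFreeValues

/-! For n ≠ 0 the sum of μ(d) over d ^ r ∣ n detects r-freeness, so R is a Möbius sum, over d, of
the number of triples in a box whose value is a nonzero multiple of d ^ r. The sum over d is cut at
D = H^(3/(2r)).

For d ≤ D put q = d ^ r and expand the count in a finite Fourier series modulo q. The zero frequency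
gives N³ λ(q)/q³; the other frequencies carry the complete sums `expSum`. These are bounded by K q j
√g, with j a common divisor of the frequencies and j² g ∣ u² + v² + w². The loss j √g is repaid on
average, since such frequencies are rare (`sum_freqWeight_triple_le`). The resulting error is (N +
q)²/q up to d^η (`exists_divCount_error_le`), and summed over d ≤ D it is about H² + H D + D^(r+1).

For d > D, fixing x and the cofactor of q leaves a representation as a sum of two squares, so the
divisor bound gives N^(3+η)/q (`exists_nonzeroCount_le`) and a tail of about H³ D^(1-r). The choice
of D makes D^(r+1) and H³ D^(1-r) both equal to H^(3/2 + 3/(2r)).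

The bound for `expSum` modulo p ^ s comes from evaluating a Salié sum: after completing squares, the
sum over reduced fractions becomes a count of square roots of -ν(u² + v² + w²)
(`norm_sum_quadGauss_cube`, `card_roots_le`). This needs k = ν e² with p ∤ ν, which holds when p ∤ k
(e = 1) and also when k = 0 (e = 0). Hence one estimate, `R_asymptotic`, serves both parts of the
theorem; its exponent 3/2 + 3/(2r) never exceeds 9r/(5r - 2) for r ≥ 2. -/

namespace RFreeValues

open Finset

/-! ### Quadratic Gauss sums over a finite commutative ring. -/

section QuadraticGaussSum

variable {S : Type*} [CommRing S] [Fintype S] (ψ : AddChar S ℂ)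

/-- The quadratic Gauss sum `∑ ψ (a x ^ 2)` over a finite commutative ring. -/
noncomputable def quadGauss (a : S) : ℂ := ∑ x : S, ψ (a * x ^ 2)

variable {ψ}

theorem quadGauss_mul_sq (a : S) (c : Sˣ) : quadGauss ψ (a * (c : S) ^ 2) = quadGauss ψ a := by
  unfold quadGauss
  refine Fintype.sum_equiv (Units.mulLeft c) _ _ fun x => ?_
  simp only [Units.mulLeft_apply]
  congr 1
  ring

/-- Completing the square. -/
theorem sum_quadratic_phase (a t : Sˣ) (ht : (t : S) = 2) (u : S) :
    ∑ x : S, ψ ((a : S) * x ^ 2 + u * x) =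
      ψ (-(u ^ 2 * ((t ^ 2 * a)⁻¹ : Sˣ))) * quadGauss ψ (a : S) := by
  unfold quadGauss
  rw [mul_sum]
  refine Fintype.sum_equiv (Equiv.addRight (u * ((t * a)⁻¹ : Sˣ))) _ _ fun x => ?_
  rw [← AddChar.map_add_eq_mul]
  congr 1
  simp only [Equiv.coe_addRight]
  have h1 : (t : S) * (t⁻¹ : Sˣ) = 1 := Units.mul_inv t
  have h2 : (a : S) * (a⁻¹ : Sˣ) = 1 := Units.mul_inv a
  simp only [mul_inv, ← inv_pow, Units.val_mul, Units.val_pow_eq_pow_val]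
  generalize ((t⁻¹ : Sˣ) : S) = t' at *
  generalize ((a⁻¹ : Sˣ) : S) = a' at *
  generalize (a : S) = a at *
  rw [ht] at h1
  linear_combination (-u * x) * h1 + (-2 * t' * u * x - t' ^ 2 * a' * u ^ 2) * h2

/-- Putting x = y + h in the product with the conjugate leaves, for each h, a complete sum over y of
ψ(2ahy). By primitivity only h = 0 survives, because 2a is a unit. -/
theorem norm_quadGauss_sq [DecidableEq S] (hψ : ψ.IsPrimitive) (a t : Sˣ) (ht : (t : S) = 2) :
    ‖quadGauss ψ (a : S)‖ ^ 2 = Fintype.card S := by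
  have key : quadGauss ψ (a : S) * (starRingEnd ℂ) (quadGauss ψ (a : S)) = Fintype.card S := by
    unfold quadGauss
    rw [map_sum, mul_sum]
    have h1 : ∀ y : S, (∑ x : S, ψ ((a : S) * x ^ 2)) * (starRingEnd ℂ) (ψ ((a : S) * y ^ 2)) =
        ∑ h : S, ψ ((a : S) * h ^ 2) * ψ (y * (2 * a * h)) := by
      intro y
      rw [sum_mul]
      refine Fintype.sum_equiv (Equiv.subRight y) _ _ fun x => ?_
      rw [← AddChar.map_neg_eq_conj, ← AddChar.map_add_eq_mul, ← AddChar.map_add_eq_mul]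
      congr 1
      simp only [Equiv.subRight_apply]
      ring
    rw [sum_congr rfl fun y _ => h1 y, sum_comm]
    have h2 : ∀ h : S, ∑ y : S, ψ ((a : S) * h ^ 2) * ψ (y * (2 * a * h)) =
        if h = 0 then (Fintype.card S : ℂ) else 0 := by
      intro h
      rw [← mul_sum, AddChar.sum_mulShift _ hψ]
      have : (2 * (a : S) * h = 0) ↔ h = 0 := by
        rw [← ht, ← Units.val_mul, Units.mul_right_eq_zero]
      by_cases hh : h = 0
      · simp [hh]
      · rw [if_neg (this.not.mpr hh), if_neg hh]; simp
    rw [sum_congr rfl fun h _ => h2 h]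
    simp
  have := congrArg Complex.re key
  rw [Complex.mul_conj] at this
  rw [← Complex.normSq_eq_norm_sq]
  exact_mod_cast this

/-- Multiplication by c + di on pairs carries x² + y² to b(x² + y²), and it is invertible because
its norm b is a unit. The squared Gauss sum is a sum over pairs, so it does not see b. -/
theorem quadGauss_sq_eq (h : ∀ b : Sˣ, ∃ c d : S, (b : S) = c ^ 2 + d ^ 2) (b : Sˣ) :
    quadGauss ψ (b : S) ^ 2 = quadGauss ψ 1 ^ 2 := by
  obtain ⟨c, d, hcd⟩ := h b
  have expand : ∀ a : S, quadGauss ψ a ^ 2 = ∑ x : S × S, ψ (a * (x.1 ^ 2 + x.2 ^ 2)) := by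
    intro a
    unfold quadGauss
    rw [sq, sum_mul_sum, Fintype.sum_prod_type]
    refine sum_congr rfl fun x _ => sum_congr rfl fun y _ => ?_
    rw [← AddChar.map_add_eq_mul]
    congr 1
    ring
  rw [expand, expand]
  have hb : (b : S) * (b⁻¹ : Sˣ) = 1 := Units.mul_inv b
  let e : S × S ≃ S × S :=
    { toFun := fun x => (c * x.1 - d * x.2, d * x.1 + c * x.2)
      invFun := fun x => ((b⁻¹ : Sˣ) * (c * x.1 + d * x.2), (b⁻¹ : Sˣ) * (c * x.2 - d * x.1))
      left_inv := by
        rintro ⟨x, y⟩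
        refine Prod.ext ?_ ?_
        · simp only
          linear_combination (x * (b⁻¹ : Sˣ)) * (-hcd) + x * hb
        · simp only
          linear_combination (y * (b⁻¹ : Sˣ)) * (-hcd) + y * hb
      right_inv := by
        rintro ⟨x, y⟩
        refine Prod.ext ?_ ?_
        · simp only
          linear_combination (x * (b⁻¹ : Sˣ)) * (-hcd) + x * hb
        · simp only
          linear_combination (y * (b⁻¹ : Sˣ)) * (-hcd) + y * hb }
  refine Fintype.sum_equiv e _ _ fun x => ?_
  congr 1
  simp only [e, Equiv.coe_fn_mk]
  rw [hcd]
  ring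

/-- The ratio G(a)/G(1) behaves like a quadratic character: G depends only on the class modulo
squares, and the squares have index at most 2. If ab is a square then G(a) = G(b), and
`quadGauss_sq_eq` finishes. -/
theorem quadGauss_mul (h : ∀ b : Sˣ, ∃ c d : S, (b : S) = c ^ 2 + d ^ 2)
    (h' : ∀ a b : Sˣ, IsSquare a ∨ IsSquare b ∨ IsSquare (a * b)) (a b : Sˣ) :
    quadGauss ψ ((a * b : Sˣ) : S) * quadGauss ψ 1 =
      quadGauss ψ (a : S) * quadGauss ψ (b : S) := by
  have sqr : ∀ c : Sˣ, quadGauss ψ ((c * c : Sˣ) : S) = quadGauss ψ 1 := by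
    intro c
    rw [← quadGauss_mul_sq (ψ := ψ) 1 c]
    congr 1
    push_cast
    ring
  rcases h' a b with ⟨c, rfl⟩ | ⟨c, rfl⟩ | ⟨c, hc⟩
  · rw [sqr, mul_comm (quadGauss ψ 1)]
    congr 1
    rw [← quadGauss_mul_sq (ψ := ψ) b c]
    congr 1
    push_cast
    ring
  · rw [sqr]
    congr 1
    rw [← quadGauss_mul_sq (ψ := ψ) a c]
    congr 1
    push_cast
    ring
  · rw [hc, sqr]
    have hb : quadGauss ψ (b : S) = quadGauss ψ (a : S) := by
      rw [← quadGauss_mul_sq (ψ := ψ) (a : S) (c * a⁻¹)]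
      congr 1
      rw [← Units.val_pow_eq_pow_val, ← Units.val_mul]
      congr 1
      rw [mul_pow, sq c, ← hc, sq]
      calc b = (a * a⁻¹) * (a * a⁻¹) * b := by simp
        _ = _ := by ac_rfl
    rw [hb, ← sq, ← sq, quadGauss_sq_eq h]

/-- The transformation of a twisted Kloosterman sum into a sum over solutions of a quadratic
congruence. -/
theorem norm_sum_quadGauss_cube [DecidableEq S] (hψ : ψ.IsPrimitive)
    (h : ∀ b : Sˣ, ∃ c d : S, (b : S) = c ^ 2 + d ^ 2)
    (h' : ∀ a b : Sˣ, IsSquare a ∨ IsSquare b ∨ IsSquare (a * b))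
    (t ν : Sˣ) (ht : (t : S) = 2) (v n : S) :
    ‖∑ a : Sˣ, ψ ((a : S) * (ν * v ^ 2)) * ψ (-(n * ((t ^ 2 * a)⁻¹ : Sˣ))) *
        quadGauss ψ (a : S) ^ 3‖ =
      Fintype.card S * ‖∑ x : S, ψ (v * x) * ∑ b : Sˣ, ψ ((b : S) * (x ^ 2 + ν * n))‖ := by
  have hn1 : ‖quadGauss ψ (1 : S)‖ ^ 2 = Fintype.card S := by
    simpa using norm_quadGauss_sq hψ 1 t ht
  have hgν : ‖quadGauss ψ ((-ν : Sˣ) : S)‖ = ‖quadGauss ψ (1 : S)‖ := by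
    have := norm_quadGauss_sq hψ (-ν) t ht
    rw [← hn1] at this
    exact (pow_left_inj₀ (norm_nonneg _) (norm_nonneg _) two_ne_zero).mp this
  -- Under a = -1/(4bν) the cube of the Gauss sum becomes G(1)² G(-bν) = G(1) G(-ν) G(b). The
  -- product G(b) ψ(-v²/(4b)) is a completed square, which is opened up again as a sum over x; the
  -- unit b then enters the phase linearly.
  have step : ∀ b : Sˣ, ψ ((((-(t ^ 2 * b * ν)⁻¹ : Sˣ)) : S) * (ν * v ^ 2)) *
      ψ (-(n * ((t ^ 2 * (-(t ^ 2 * b * ν)⁻¹))⁻¹ : Sˣ))) *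
        quadGauss ψ ((-(t ^ 2 * b * ν)⁻¹ : Sˣ) : S) ^ 3 =
      quadGauss ψ (1 : S) * quadGauss ψ ((-ν : Sˣ) : S) *
        ∑ x : S, ψ (v * x) * ψ ((b : S) * (x ^ 2 + ν * n)) := by
    intro b
    have e1 : quadGauss ψ ((-(t ^ 2 * b * ν)⁻¹ : Sˣ) : S) = quadGauss ψ ((b * (-ν) : Sˣ) : S) := by
      rw [← quadGauss_mul_sq (ψ := ψ) ((-(t ^ 2 * b * ν)⁻¹ : Sˣ) : S) (t * b * ν)]
      congr 1
      rw [← Units.val_pow_eq_pow_val, ← Units.val_mul]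
      congr 1
      rw [mul_neg, neg_mul]
      congr 1
      calc (t ^ 2 * b * ν)⁻¹ * (t * b * ν) ^ 2
          = (t ^ 2 * b * ν)⁻¹ * (t ^ 2 * b * ν) * (b * ν) := by
            simp only [sq]
            ac_rfl
        _ = b * ν := by rw [inv_mul_cancel, one_mul]
    have e2 : (((-(t ^ 2 * b * ν)⁻¹ : Sˣ)) : S) * (ν * v ^ 2) =
        -(v ^ 2 * ((t ^ 2 * b)⁻¹ : Sˣ)) := by
      have hν : (ν : S) * (ν⁻¹ : Sˣ) = 1 := Units.mul_inv ν
      simp only [mul_inv, Units.val_mul, Units.val_neg]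
      linear_combination (-v ^ 2 * ((t ^ 2)⁻¹ : Sˣ) * (b⁻¹ : Sˣ)) * hν
    have e3 : -(n * ((t ^ 2 * (-(t ^ 2 * b * ν)⁻¹))⁻¹ : Sˣ)) = (b : S) * (ν * n) := by
      have : ((t ^ 2 * (-(t ^ 2 * b * ν)⁻¹))⁻¹ : Sˣ) = -(b * ν) := by
        rw [inv_eq_iff_eq_inv, mul_neg, mul_assoc (t ^ 2) b, mul_inv, mul_inv_cancel_left, inv_neg]
      rw [this]
      push_cast
      ring
    have e4 : quadGauss ψ ((b * (-ν) : Sˣ) : S) ^ 3 =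
        quadGauss ψ (1 : S) * quadGauss ψ ((-ν : Sˣ) : S) * quadGauss ψ (b : S) := by
      rw [pow_succ, quadGauss_sq_eq h, sq, mul_assoc, mul_comm (quadGauss ψ 1) (quadGauss ψ _),
        quadGauss_mul h h']
      ring
    rw [e1, e2, e3, e4]
    have e5 := sum_quadratic_phase (ψ := ψ) b t ht v
    have e6 : ∑ x : S, ψ (v * x) * ψ ((b : S) * (x ^ 2 + ν * n)) =
        ψ ((b : S) * (ν * n)) * ∑ x : S, ψ ((b : S) * x ^ 2 + v * x) := by
      rw [mul_sum]
      refine sum_congr rfl fun x _ => ?_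
      rw [← AddChar.map_add_eq_mul, ← AddChar.map_add_eq_mul]
      congr 1
      ring
    rw [e6, e5]
    ring
  have inv2 : Function.Bijective fun b : Sˣ => (-(t ^ 2 * b * ν)⁻¹ : Sˣ) := by
    refine ⟨fun b c hbc => ?_, fun c => ⟨-((t ^ 2)⁻¹ * c⁻¹ * ν⁻¹), ?_⟩⟩
    · simpa using hbc
    · simp only [mul_neg, neg_mul, inv_neg, neg_neg]
      rw [inv_eq_iff_eq_inv]
      rw [← mul_assoc, ← mul_assoc, mul_inv_cancel, one_mul, inv_mul_cancel_right]
  rw [← Function.Bijective.sum_comp inv2 (fun a : Sˣ => ψ ((a : S) * (ν * v ^ 2)) *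
    ψ (-(n * ((t ^ 2 * a)⁻¹ : Sˣ))) * quadGauss ψ (a : S) ^ 3)]
  rw [sum_congr rfl fun b _ => step b, ← mul_sum, norm_mul, norm_mul, hgν, ← sq, hn1, sum_comm]
  simp only [mul_sum]

end QuadraticGaussSum

/-! ### Squares and sums of two squares among the units modulo an odd prime power. -/

section PrimePower

variable {p s : ℕ} [hp : Fact p.Prime]

theorem prime_dvd_of_castHom_eq_zero (hs : s ≠ 0) {x : ZMod (p ^ s)}
    (hx : ZMod.castHom (dvd_pow_self p hs) (ZMod p) x = 0) : (p : ZMod (p ^ s)) ∣ x := by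
  have : NeZero (p ^ s) := ⟨(pow_pos hp.out.pos s).ne'⟩
  rw [ZMod.castHom_apply, ZMod.cast_eq_val, ZMod.natCast_eq_zero_iff] at hx
  obtain ⟨c, hc⟩ := hx
  refine ⟨c, ?_⟩
  rw [← ZMod.natCast_zmod_val x, hc]
  push_cast
  rfl

theorem isUnit_of_castHom_ne_zero (hs : s ≠ 0) {x : ZMod (p ^ s)}
    (hx : ZMod.castHom (dvd_pow_self p hs) (ZMod p) x ≠ 0) : IsUnit x := by
  have : NeZero (p ^ s) := ⟨(pow_pos hp.out.pos s).ne'⟩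
  rw [ZMod.castHom_apply, ZMod.cast_eq_val, Ne, ZMod.natCast_eq_zero_iff] at hx
  rw [← ZMod.natCast_zmod_val x, ZMod.isUnit_iff_coprime]
  exact (((Nat.Prime.coprime_iff_not_dvd hp.out).mpr hx).symm).pow_right s

theorem castHom_unit_ne_zero (hs : s ≠ 0) (x : (ZMod (p ^ s))ˣ) :
    ZMod.castHom (dvd_pow_self p hs) (ZMod p) (x : ZMod (p ^ s)) ≠ 0 :=
  (x.isUnit.map _).ne_zero

/-- Dividing by the square of a lifted root leaves a unit y ≡ 1 modulo p. Then y ^ p ^ (s - 1) = 1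
with odd exponent 2m + 1, so y is the square of y ^ (m + 1). -/
theorem isSquare_of_isSquare_castHom (hp2 : p ≠ 2) (hs : s ≠ 0) (x : (ZMod (p ^ s))ˣ)
    (hx : IsSquare (ZMod.castHom (dvd_pow_self p hs) (ZMod p) (x : ZMod (p ^ s)))) :
    IsSquare x := by
  obtain ⟨c, hc⟩ := hx
  obtain ⟨d, rfl⟩ := ZMod.castHom_surjective (dvd_pow_self p hs) c
  have hd : IsUnit d := by
    refine isUnit_of_castHom_ne_zero hs fun h => castHom_unit_ne_zero hs x ?_
    rw [hc, h, mul_zero]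
  obtain ⟨e, rfl⟩ := hd
  set y : (ZMod (p ^ s))ˣ := x * (e * e)⁻¹ with hy
  have hy1 : (p : ZMod (p ^ s)) ∣ (y : ZMod (p ^ s)) - 1 := by
    apply prime_dvd_of_castHom_eq_zero hs
    have : (y : ZMod (p ^ s)) * (e * e) = x := by
      rw [hy, ← Units.val_mul, ← Units.val_mul, inv_mul_cancel_right]
    have h2 := congrArg (ZMod.castHom (dvd_pow_self p hs) (ZMod p)) this
    rw [map_mul, map_mul, hc] at h2
    have h3 := castHom_unit_ne_zero hs e
    rw [map_sub, map_one, sub_eq_zero]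
    exact mul_right_cancel₀ (mul_ne_zero h3 h3) (h2.trans (one_mul _).symm)
  have hypow : y ^ p ^ (s - 1) = 1 := by
    have := dvd_sub_pow_of_dvd_sub hy1 (s - 1)
    rw [Nat.sub_add_cancel (Nat.one_le_iff_ne_zero.mpr hs)] at this
    have h0 : ((p : ZMod (p ^ s)) ^ s) = 0 := by
      rw [← Nat.cast_pow, ZMod.natCast_self]
    rw [h0, zero_dvd_iff, one_pow, sub_eq_zero] at this
    rw [← Units.val_inj, Units.val_pow_eq_pow_val, Units.val_one]
    exact this
  have hodd : Odd (p ^ (s - 1)) := (hp.out.odd_of_ne_two hp2).pow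
  obtain ⟨m, hm⟩ := hodd
  have hx' : x = (y ^ (m + 1) * e) * (y ^ (m + 1) * e) := by
    have h1 : y ^ (m + 1) * y ^ (m + 1) = y := by
      rw [← pow_add, show m + 1 + (m + 1) = 2 * m + 1 + 1 by ring, ← hm, pow_succ, hypow, one_mul]
    calc x = y * (e * e) := by rw [hy, inv_mul_cancel_right]
      _ = (y ^ (m + 1) * y ^ (m + 1)) * (e * e) := by rw [h1]
      _ = _ := by ac_rfl
  exact ⟨_, hx'⟩

/-- Modulo p there is a representation with at least one nonzero square. Lifting the other term
arbitrarily, the difference is a unit that is a square modulo p, hence a square. -/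
theorem unit_eq_sq_add_sq (hp2 : p ≠ 2) (hs : s ≠ 0) (b : (ZMod (p ^ s))ˣ) :
    ∃ c d : ZMod (p ^ s), (b : ZMod (p ^ s)) = c ^ 2 + d ^ 2 := by
  set φ := ZMod.castHom (dvd_pow_self p hs) (ZMod p) with hφ
  have key : ∀ c d : ZMod p, c ≠ 0 → c ^ 2 + d ^ 2 = φ b →
      ∃ c d : ZMod (p ^ s), (b : ZMod (p ^ s)) = c ^ 2 + d ^ 2 := by
    intro c d hc h
    obtain ⟨d', rfl⟩ := ZMod.castHom_surjective (dvd_pow_self p hs) d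
    have h1 : φ ((b : ZMod (p ^ s)) - d' ^ 2) = c ^ 2 := by
      rw [map_sub, map_pow, ← h, hφ]
      ring
    obtain ⟨e, he⟩ : IsUnit ((b : ZMod (p ^ s)) - d' ^ 2) := by
      apply isUnit_of_castHom_ne_zero hs
      rw [← hφ, h1]
      exact pow_ne_zero 2 hc
    have : IsSquare e := by
      apply isSquare_of_isSquare_castHom hp2 hs
      rw [he, ← hφ, h1]
      exact ⟨c, sq c⟩
    obtain ⟨f, rfl⟩ := this
    refine ⟨f, d', ?_⟩
    rw [← sub_eq_iff_eq_add, ← he]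
    push_cast
    ring
  obtain ⟨c, d, h⟩ := ZMod.sq_add_sq p (φ b)
  by_cases hc : c = 0
  · by_cases hd : d = 0
    · exact absurd (by rw [← h, hc, hd]; ring) (castHom_unit_ne_zero hs b)
    · exact key d c hd (by rw [← h]; ring)
  · exact key c d hc h

theorem isSquare_trichotomy (hp2 : p ≠ 2) (hs : s ≠ 0) (a b : (ZMod (p ^ s))ˣ) :
    IsSquare a ∨ IsSquare b ∨ IsSquare (a * b) := by
  set φ := ZMod.castHom (dvd_pow_self p hs) (ZMod p) with hφ
  have ha := castHom_unit_ne_zero hs a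
  have hb := castHom_unit_ne_zero hs b
  have lift := fun x => isSquare_of_isSquare_castHom (p := p) hp2 hs x
  rcases ZMod.pow_div_two_eq_neg_one_or_one p ha with h1 | h1
  · exact Or.inl (lift a ((ZMod.euler_criterion p ha).mpr h1))
  rcases ZMod.pow_div_two_eq_neg_one_or_one p hb with h2 | h2
  · exact Or.inr (Or.inl (lift b ((ZMod.euler_criterion p hb).mpr h2)))
  refine Or.inr (Or.inr (lift _ ?_))
  rw [Units.val_mul, map_mul, ZMod.euler_criterion p (mul_ne_zero ha hb), mul_pow, h1, h2]
  ring

end PrimePower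

/-! ### Counting square roots modulo an odd prime power. -/

section Roots

theorem card_filter_dvd_sub_le (n M : ℕ) (c : ℤ) :
    #((range (n * M)).filter fun x : ℕ => (n : ℤ) ∣ (x : ℤ) - c) ≤ M := by
  conv_rhs => rw [← card_range M]
  refine card_le_card_of_injOn (· / n) ?_ ?_
  · intro x hx
    simp only [coe_filter, mem_range, Set.mem_ofPred_eq] at hx
    simp only [coe_range, Set.mem_Iio]
    exact Nat.div_lt_of_lt_mul hx.1
  · intro x hx y hy hxy
    simp only [coe_filter, mem_range, Set.mem_ofPred_eq] at hx hy hxy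
    have h1 : (n : ℤ) ∣ (y : ℤ) - x := by
      have := dvd_sub hy.2 hx.2
      simpa using this
    have h2 : x ≡ y [MOD n] := (Nat.modEq_iff_dvd).mpr h1
    rw [← Nat.div_add_mod x n, ← Nat.div_add_mod y n, hxy, h2]

theorem pow_dvd_of_pow_dvd_mul {p : ℕ} (hp : p.Prime) {A B : ℤ} {m l : ℕ} (hl : l ≤ m)
    (h : (p : ℤ) ^ m ∣ A * B) (hA : ¬ (p : ℤ) ^ (m - l) ∣ A) : (p : ℤ) ^ (l + 1) ∣ B := by
  have hpZ : Prime (p : ℤ) := Nat.prime_iff_prime_int.mp hp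
  have hA0 : A ≠ 0 := by
    rintro rfl
    exact hA (dvd_zero _)
  obtain ⟨α, A', hA', rfl⟩ := WfDvdMonoid.max_power_factor hA0 hpZ.irreducible
  have hα : α < m - l := by
    by_contra hcon
    exact hA (Dvd.dvd.mul_right (pow_dvd_pow _ (not_lt.mp hcon)) _)
  have hm : (p : ℤ) ^ m = p ^ α * p ^ (m - α) := by rw [← pow_add]; congr 1; omega
  rw [hm, mul_assoc, mul_dvd_mul_iff_left (pow_ne_zero _ hpZ.ne_zero)] at h
  have hB := hpZ.pow_dvd_of_dvd_mul_left (m - α) hA' h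
  exact (pow_dvd_pow _ (by omega)).trans hB

/-- The number of square roots of `y` modulo `p ^ m`, counted modulo `p ^ s`. -/
theorem card_roots_le {p : ℕ} (hp : p.Prime) (hp2 : p ≠ 2) {m s : ℕ} (hms : m ≤ s) (y : ℤ) :
    ∃ l, 2 * l ≤ m ∧ (p : ℤ) ^ (2 * l) ∣ y ∧
      #((range (p ^ s)).filter fun x : ℕ => (p : ℤ) ^ m ∣ (x : ℤ) ^ 2 - y) ≤ 2 * p ^ (s - m + l) := by
  have hpZ : Prime (p : ℤ) := Nat.prime_iff_prime_int.mp hp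
  have count : ∀ e ≤ s, ∀ c : ℤ,
      #((range (p ^ s)).filter fun x : ℕ => (p : ℤ) ^ e ∣ (x : ℤ) - c) ≤ p ^ (s - e) := by
    intro e he c
    have := card_filter_dvd_sub_le (p ^ e) (p ^ (s - e)) c
    rw [← pow_add, Nat.add_sub_cancel' he] at this
    exact_mod_cast this
  by_cases hy : (p : ℤ) ^ m ∣ y
  · refine ⟨m / 2, Nat.mul_div_le m 2, (pow_dvd_pow _ (Nat.mul_div_le m 2)).trans hy, ?_⟩
    refine (card_le_card (t := ((range (p ^ s)).filter fun x : ℕ => (p : ℤ) ^ (m - m / 2) ∣ (x : ℤ) - 0))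
      ?_).trans ((count _ (by omega) 0).trans ?_)
    · intro x hx
      simp only [mem_filter, sub_zero] at hx ⊢
      refine ⟨hx.1, ?_⟩
      have h1 : (p : ℤ) ^ m ∣ x * x := by
        have := dvd_add hx.2 hy
        rwa [sub_add_cancel, sq] at this
      by_contra hcon
      have h2 := pow_dvd_of_pow_dvd_mul hp (Nat.div_le_self m 2) h1 hcon
      exact hcon ((pow_dvd_pow _ (by omega)).trans h2)
    · rw [show s - (m - m / 2) = s - m + m / 2 by omega]
      omega
  by_cases hex : ∃ x₀ : ℤ, (p : ℤ) ^ m ∣ x₀ ^ 2 - y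
  swap
  · refine ⟨0, by omega, by simp, ?_⟩
    rw [filter_false_of_mem]
    · simp
    · intro x _ h
      exact hex ⟨x, h⟩
  obtain ⟨x₀, hx₀⟩ := hex
  have hx₀0 : x₀ ≠ 0 := by
    rintro rfl
    rw [zero_pow two_ne_zero, zero_sub, dvd_neg] at hx₀
    exact hy hx₀
  obtain ⟨l, z, hz, hx₀z⟩ := WfDvdMonoid.max_power_factor hx₀0 hpZ.irreducible
  have hsq : (p : ℤ) ^ (2 * l) ∣ x₀ ^ 2 := by
    rw [hx₀z, mul_pow, ← pow_mul, mul_comm l 2]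
    exact dvd_mul_right _ _
  have hlm : 2 * l < m := by
    by_contra hcon
    have h1 := (pow_dvd_pow (p : ℤ) (not_lt.mp hcon)).trans hsq
    have h2 := dvd_sub h1 hx₀
    rw [sub_sub_cancel] at h2
    exact hy h2
  refine ⟨l, hlm.le, ?_, ?_⟩
  · have h2 := dvd_sub hsq ((pow_dvd_pow (p : ℤ) hlm.le).trans hx₀)
    rwa [sub_sub_cancel] at h2
  have hx₀l : ¬ (p : ℤ) ^ (l + 1) ∣ x₀ := by
    rw [hx₀z, pow_succ, mul_dvd_mul_iff_left (pow_ne_zero _ hpZ.ne_zero)]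
    exact hz
  -- If p ^ (m - l) divided neither x - x₀ nor x + x₀, then p ^ (l + 1) would divide both, hence
  -- 2x₀, against the exact valuation l of x₀. So all roots lie in two classes modulo p ^ (m - l).
  have hsub : ((range (p ^ s)).filter fun x : ℕ => (p : ℤ) ^ m ∣ (x : ℤ) ^ 2 - y) ⊆
      ((range (p ^ s)).filter fun x : ℕ => (p : ℤ) ^ (m - l) ∣ (x : ℤ) - x₀) ∪
      ((range (p ^ s)).filter fun x : ℕ => (p : ℤ) ^ (m - l) ∣ (x : ℤ) - (-x₀)) := by
    intro x hx
    simp only [mem_filter, mem_union] at hx ⊢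
    by_contra hcon
    push Not at hcon
    have hA := hcon.1 hx.1
    have hB := hcon.2 hx.1
    have h1 : (p : ℤ) ^ m ∣ ((x : ℤ) - x₀) * ((x : ℤ) - (-x₀)) := by
      rw [show ((x : ℤ) - x₀) * ((x : ℤ) - (-x₀)) = (x ^ 2 - y) - (x₀ ^ 2 - y) by ring]
      exact dvd_sub hx.2 hx₀
    have h2 := pow_dvd_of_pow_dvd_mul hp (by omega) h1 hA
    rw [mul_comm] at h1
    have h3 := pow_dvd_of_pow_dvd_mul hp (by omega) h1 hB
    have h4 := dvd_sub h2 h3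
    rw [show ((x : ℤ) - (-x₀)) - (x - x₀) = 2 * x₀ by ring] at h4
    apply hx₀l
    refine hpZ.pow_dvd_of_dvd_mul_left _ ?_ h4
    intro h5
    have : p ∣ 2 := by exact_mod_cast h5
    exact hp2 ((Nat.prime_dvd_prime_iff_eq hp Nat.prime_two).mp this)
  refine (card_le_card hsub).trans ((card_union_le _ _).trans ?_)
  have h1 := count (m - l) (by omega) x₀
  have h2 := count (m - l) (by omega) (-x₀)
  rw [show s - (m - l) = s - m + l by omega] at h1 h2
  omega

end Roots

/-! ### Exponential sums over the quadric modulo q. -/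

section ExpSum

/-- The exponential sum `∑ e((u x + v y + w z) / q)` over the solutions of
`x ^ 2 + y ^ 2 + z ^ 2 + k ≡ 0 (mod q)`. -/
noncomputable def expSum (q : ℕ) [NeZero q] (k u v w : ZMod q) : ℂ :=
  ∑ x : ZMod q, ∑ y : ZMod q, ∑ z : ZMod q,
    if x ^ 2 + y ^ 2 + z ^ 2 + k = 0 then
      ZMod.stdAddChar (u * x + v * y + w * z) else 0

/-- A bound for `expSum` in terms of common divisors of the frequencies and of the sum of their
squares. -/
def ExpSumBound (q : ℕ) [NeZero q] (k : ℤ) (K : ℝ) : Prop :=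
  ∀ u v w : ℤ, ∃ j g : ℕ, j * g ∣ q ∧ (j : ℤ) ∣ u ∧ (j : ℤ) ∣ v ∧ (j : ℤ) ∣ w ∧
    (j : ℤ) ^ 2 * g ∣ u ^ 2 + v ^ 2 + w ^ 2 ∧ ‖expSum q k u v w‖ ≤ K * q * j * √g

theorem stdAddChar_mul_of_eq {N a b : ℕ} [NeZero N] [NeZero b] (h : N = a * b) (m : ℤ) :
    (ZMod.stdAddChar ((a * m : ℤ) : ZMod N) : ℂ) = ZMod.stdAddChar (m : ZMod b) := by
  rw [ZMod.stdAddChar_coe, ZMod.stdAddChar_coe]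
  have ha : (a : ℂ) ≠ 0 := by
    have : N ≠ 0 := NeZero.ne N
    rw [h] at this
    exact_mod_cast left_ne_zero_of_mul this
  have hb : (b : ℂ) ≠ 0 := by exact_mod_cast NeZero.ne b
  congr 1
  rw [h]
  push_cast
  field_simp

theorem norm_expSum_le (q : ℕ) [NeZero q] (k u v w : ZMod q) : ‖expSum q k u v w‖ ≤ (q : ℝ) ^ 3 := by
  unfold expSum
  have h1 : ∀ x y z : ZMod q, ‖if x ^ 2 + y ^ 2 + z ^ 2 + k = 0 then
      (ZMod.stdAddChar (u * x + v * y + w * z) : ℂ) else 0‖ ≤ 1 := by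
    intro x y z
    split_ifs
    · rw [AddChar.norm_apply]
    · simp
  have hc : ((univ : Finset (ZMod q)).card : ℝ) = q := by rw [card_univ, ZMod.card]
  have h2 : ∀ x y : ZMod q, ‖∑ z : ZMod q, if x ^ 2 + y ^ 2 + z ^ 2 + k = 0 then
      (ZMod.stdAddChar (u * x + v * y + w * z) : ℂ) else 0‖ ≤ q := by
    intro x y
    refine (norm_sum_le_of_le _ fun z _ => h1 x y z).trans ?_
    rw [sum_const, nsmul_eq_mul, hc, mul_one]
  have h3 : ∀ x : ZMod q, ‖∑ y : ZMod q, ∑ z : ZMod q,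
      if x ^ 2 + y ^ 2 + z ^ 2 + k = 0 then
      (ZMod.stdAddChar (u * x + v * y + w * z) : ℂ) else 0‖ ≤ q * q := by
    intro x
    refine (norm_sum_le_of_le _ fun y _ => h2 x y).trans ?_
    rw [sum_const, nsmul_eq_mul, hc]
  refine (norm_sum_le_of_le _ fun x _ => h3 x).trans ?_
  rw [sum_const, nsmul_eq_mul, hc]
  exact le_of_eq (by ring)

/-- Meant for the finitely many bad primes, where the factor q² is absorbed into a constant. -/
theorem expSumBound_trivial (q : ℕ) [NeZero q] (k : ℤ) : ExpSumBound q k ((q : ℝ) ^ 2) := by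
  intro u v w
  refine ⟨1, 1, by simp, by simp, by simp, by simp, by simp, ?_⟩
  refine (norm_expSum_le q k u v w).trans (le_of_eq ?_)
  simp
  ring

theorem ExpSumBound.mono {q : ℕ} [NeZero q] {k : ℤ} {K K' : ℝ} (h : ExpSumBound q k K)
    (hK : K ≤ K') : ExpSumBound q k K' := by
  intro u v w
  obtain ⟨j, g, h1, h2, h3, h4, h5, h6⟩ := h u v w
  exact ⟨j, g, h1, h2, h3, h4, h5, h6.trans (by gcongr)⟩

end ExpSum

/-! ### Splitting the sum modulo p ^ (s + 1) into reduced and non-reduced fractions. -/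

section Recursion

variable {p s : ℕ} [hp : Fact p.Prime]

theorem prime_mul_eq_zero_iff (x : ZMod (p ^ (s + 1))) :
    (p : ZMod (p ^ (s + 1))) * x = 0 ↔
      ZMod.castHom (pow_dvd_pow p s.le_succ) (ZMod (p ^ s)) x = 0 := by
  obtain ⟨m, rfl⟩ := ZMod.intCast_surjective x
  rw [map_intCast, ← Int.cast_natCast, ← Int.cast_mul, ZMod.intCast_zmod_eq_zero_iff_dvd,
    ZMod.intCast_zmod_eq_zero_iff_dvd]
  push_cast
  rw [pow_succ', mul_dvd_mul_iff_left (by exact_mod_cast hp.out.ne_zero)]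

/-- The nonunits are pc with c modulo p ^ s, and the character at pcy is the character of level p ^
s at cy, so this is orthogonality one level down. -/
theorem sum_nonunits (y : ZMod (p ^ (s + 1))) :
    ∑ a : ZMod (p ^ (s + 1)) with ¬ IsUnit a, (ZMod.stdAddChar (a * y) : ℂ) =
      if (p : ZMod (p ^ (s + 1))) * y = 0 then (p : ℂ) ^ s else 0 := by
  obtain ⟨m, rfl⟩ := ZMod.intCast_surjective y
  have key : ∑ a : ZMod (p ^ (s + 1)) with ¬ IsUnit a,
      (ZMod.stdAddChar (a * (m : ZMod (p ^ (s + 1)))) : ℂ) =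
      ∑ c : ZMod (p ^ s), ZMod.stdAddChar (c * (m : ZMod (p ^ s))) := by
    symm
    refine sum_nbij (fun c => ((p * c.val : ℕ) : ZMod (p ^ (s + 1)))) ?_ ?_ ?_ ?_
    · intro c _
      simp only [mem_filter, mem_univ, true_and]
      rw [ZMod.isUnit_iff_coprime]
      intro h
      have h1 : p ∣ 1 := by
        rw [← Nat.coprime_iff_gcd_eq_one.mp h]
        exact Nat.dvd_gcd (dvd_mul_right _ _) (dvd_pow_self p s.succ_ne_zero)
      exact hp.out.one_lt.ne' (Nat.dvd_one.mp h1)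
    · intro c _ c' _ h
      simp only at h
      rw [ZMod.natCast_eq_natCast_iff, pow_succ'] at h
      have h2 := Nat.ModEq.mul_left_cancel' hp.out.ne_zero h
      rw [← ZMod.natCast_eq_natCast_iff] at h2
      simpa using h2
    · intro a ha
      simp only [coe_filter, mem_univ, true_and, Set.mem_ofPred_eq] at ha
      rw [← ZMod.natCast_zmod_val a, ZMod.isUnit_iff_coprime,
        Nat.coprime_pow_right_iff (Nat.succ_pos s), Nat.coprime_comm,
        Nat.Prime.coprime_iff_not_dvd hp.out, not_not] at ha
      obtain ⟨c, hc⟩ := ha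
      refine ⟨(c : ZMod (p ^ s)), by simp, ?_⟩
      simp only
      rw [← ZMod.natCast_zmod_val a, hc, ZMod.natCast_eq_natCast_iff, pow_succ']
      refine Nat.ModEq.mul_left' p ?_
      rw [← ZMod.natCast_eq_natCast_iff]
      simp
    · intro c _
      have h1 := stdAddChar_mul_of_eq (pow_succ' p s) (c.val * m)
      have h2 : ((p * (c.val * m) : ℤ) : ZMod (p ^ (s + 1))) =
          ((p * c.val : ℕ) : ZMod (p ^ (s + 1))) * (m : ZMod (p ^ (s + 1))) := by
        push_cast
        ring
      rw [h2] at h1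
      rw [h1]
      push_cast
      rw [ZMod.natCast_zmod_val]
  rw [key, AddChar.sum_mulShift _ (ZMod.isPrimitive_stdAddChar _), ZMod.card]
  have := prime_mul_eq_zero_iff (p := p) (s := s) (m : ZMod (p ^ (s + 1)))
  rw [map_intCast] at this
  simp only [this]
  push_cast
  rfl

theorem sum_units_add_nonunits {S : Type*} [CommRing S] [Fintype S] [DecidableEq S] (F : S → ℂ) :
    ∑ a, F a = ∑ a : Sˣ, F a + ∑ a with ¬ IsUnit a, F a := by
  rw [← sum_filter_add_sum_filter_not univ (fun a => IsUnit a)]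
  congr 1
  symm
  refine sum_nbij (fun a : Sˣ => (a : S)) ?_ ?_ ?_ ?_
  · intro a _
    simp
  · intro a _ b _ h
    exact Units.ext h
  · intro a ha
    simp only [coe_filter, mem_univ, true_and, Set.mem_ofPred_eq] at ha
    obtain ⟨b, rfl⟩ := ha
    exact ⟨b, by simp, rfl⟩
  · intro a _
    rfl

theorem sum_comp_castHom (F : ZMod (p ^ s) → ℂ) :
    ∑ x : ZMod (p ^ (s + 1)), F (ZMod.castHom (pow_dvd_pow p s.le_succ) (ZMod (p ^ s)) x) =
      p * ∑ y, F y := by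
  set φ := ZMod.castHom (pow_dvd_pow p s.le_succ) (ZMod (p ^ s)) with hφ
  have hsurj : Function.Surjective φ := ZMod.castHom_surjective _
  have hfib : ∀ y, #(univ.filter fun x => φ x = y) = p := by
    have hconst : ∀ y, #(univ.filter fun x => φ x = y) = #(univ.filter fun x => φ x = 0) := by
      intro y
      obtain ⟨x₀, rfl⟩ := hsurj y
      refine card_bij (fun x _ => x - x₀) ?_ ?_ ?_
      · intro x hx
        simp only [mem_filter, mem_univ, true_and] at hx ⊢
        rw [map_sub, hx, sub_self]
      · intro x _ x' _ h
        exact sub_left_injective h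
      · intro x hx
        simp only [mem_filter, mem_univ, true_and] at hx
        exact ⟨x + x₀, by simp [hx], by simp⟩
    have htot := card_eq_sum_card_fiberwise (s := (univ : Finset (ZMod (p ^ (s + 1)))))
      (t := (univ : Finset (ZMod (p ^ s)))) (f := φ) (fun x _ => mem_univ _)
    rw [sum_congr rfl fun y _ => hconst y, sum_const, card_univ, card_univ, ZMod.card, ZMod.card,
      smul_eq_mul] at htot
    intro y
    rw [hconst]
    exact (Nat.eq_of_mul_eq_mul_left (pow_pos hp.out.pos s) ((pow_succ p s).symm.trans htot)).symm
  rw [← sum_fiberwise_of_maps_to (s := univ) (t := univ) (g := φ) (fun x _ => mem_univ _), mul_sum]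
  refine sum_congr rfl fun y _ => ?_
  rw [sum_congr rfl (g := fun _ => F y), sum_const, hfib, nsmul_eq_mul]
  intro x hx
  rw [(mem_filter.mp hx).2]

/-- The part of `expSum` for a prime power modulus that comes from reduced fractions. -/
noncomputable def reducedSum (p s : ℕ) [Fact p.Prime] (k u v w : ZMod (p ^ (s + 1))) : ℂ :=
  ∑ a : (ZMod (p ^ (s + 1)))ˣ, ZMod.stdAddChar ((a : ZMod (p ^ (s + 1))) * k) *
    ((∑ x : ZMod (p ^ (s + 1)), ZMod.stdAddChar ((a : ZMod (p ^ (s + 1))) * x ^ 2 + w * x)) *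
    (∑ x : ZMod (p ^ (s + 1)), ZMod.stdAddChar ((a : ZMod (p ^ (s + 1))) * x ^ 2 + v * x)) *
    (∑ x : ZMod (p ^ (s + 1)), ZMod.stdAddChar ((a : ZMod (p ^ (s + 1))) * x ^ 2 + u * x)))

/-- The congruence is detected by summing the character over all multipliers a; units give
`reducedSum`, and the other a are evaluated by `sum_nonunits`. -/
theorem expSum_eq_reducedSum_add (k u v w : ZMod (p ^ (s + 1))) :
    (p : ℂ) ^ (s + 1) * expSum (p ^ (s + 1)) k u v w = reducedSum p s k u v w +
      ∑ x : ZMod (p ^ (s + 1)), ∑ y : ZMod (p ^ (s + 1)), ∑ z : ZMod (p ^ (s + 1)),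
        (if (p : ZMod (p ^ (s + 1))) * (x ^ 2 + y ^ 2 + z ^ 2 + k) = 0 then (p : ℂ) ^ s else 0) *
          ZMod.stdAddChar (u * x + v * y + w * z) := by
  have h1 : ∀ x y z : ZMod (p ^ (s + 1)),
      (p : ℂ) ^ (s + 1) * (if x ^ 2 + y ^ 2 + z ^ 2 + k = 0 then
        ZMod.stdAddChar (u * x + v * y + w * z) else 0) =
      (∑ a : (ZMod (p ^ (s + 1)))ˣ,
        ZMod.stdAddChar ((a : ZMod (p ^ (s + 1))) * (x ^ 2 + y ^ 2 + z ^ 2 + k))) *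
        ZMod.stdAddChar (u * x + v * y + w * z) +
      (if (p : ZMod (p ^ (s + 1))) * (x ^ 2 + y ^ 2 + z ^ 2 + k) = 0 then (p : ℂ) ^ s else 0) *
        ZMod.stdAddChar (u * x + v * y + w * z) := by
    intro x y z
    rw [← add_mul, ← sum_nonunits, ← sum_units_add_nonunits
      (fun a => ZMod.stdAddChar (a * (x ^ 2 + y ^ 2 + z ^ 2 + k))),
      AddChar.sum_mulShift _ (ZMod.isPrimitive_stdAddChar _), ZMod.card]
    split_ifs <;> simp
  unfold expSum
  simp only [mul_sum, h1, sum_add_distrib]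
  congr 1
  unfold reducedSum
  simp only [mul_sum, sum_mul]
  conv_lhs =>
    enter [2, x, 2, y]
    rw [sum_comm]
  conv_lhs =>
    enter [2, x]
    rw [sum_comm]
  rw [sum_comm]
  refine sum_congr rfl fun a _ => sum_congr rfl fun x _ => ?_
  refine sum_congr rfl fun y _ => sum_congr rfl fun z _ => ?_
  simp only [← AddChar.map_add_eq_mul]
  congr 1
  ring

end Recursion

/-! ### The bound for `expSum` modulo powers of an odd prime. -/

section PrimePowerBound

variable {p s : ℕ} [hp : Fact p.Prime]

theorem card_zmod_roots_le (hp2 : p ≠ 2) {m : ℕ} (hms : m ≤ s) (y : ℤ) :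
    ∃ l, 2 * l ≤ m ∧ (p : ℤ) ^ (2 * l) ∣ y ∧
      #(univ.filter fun x : ZMod (p ^ s) => ((p ^ (s - m) : ℕ) : ZMod (p ^ s)) * (x ^ 2 - y) = 0) ≤
        2 * p ^ (s - m + l) := by
  obtain ⟨l, h1, h2, h3⟩ := card_roots_le hp.out hp2 hms y
  refine ⟨l, h1, h2, le_trans ?_ h3⟩
  refine card_le_card_of_injOn ZMod.val ?_ (ZMod.val_injective _).injOn
  intro x hx
  simp only [coe_filter, mem_univ, true_and, Set.mem_ofPred_eq, mem_range] at hx ⊢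
  refine ⟨ZMod.val_lt x, ?_⟩
  have h4 : ((p ^ (s - m) * ((x.val : ℤ) ^ 2 - y) : ℤ) : ZMod (p ^ s)) = 0 := by
    rw [← hx]
    push_cast
    rw [ZMod.natCast_zmod_val]
  rw [ZMod.intCast_zmod_eq_zero_iff_dvd] at h4
  have h5 : ((p ^ s : ℕ) : ℤ) = (p : ℤ) ^ (s - m) * p ^ m := by
    rw [← pow_add, Nat.sub_add_cancel hms]
    push_cast
    rfl
  rw [h5] at h4
  exact (mul_dvd_mul_iff_left (pow_ne_zero _ (by exact_mod_cast hp.out.ne_zero))).mp h4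

theorem norm_sum_units_le (y : ZMod (p ^ (s + 1))) :
    ‖∑ b : (ZMod (p ^ (s + 1)))ˣ, (ZMod.stdAddChar ((b : ZMod (p ^ (s + 1))) * y) : ℂ)‖ ≤
      (if y = 0 then (p : ℝ) ^ (s + 1) else 0) +
        (if (p : ZMod (p ^ (s + 1))) * y = 0 then (p : ℝ) ^ s else 0) := by
  have h1 := sum_units_add_nonunits (fun a : ZMod (p ^ (s + 1)) => (ZMod.stdAddChar (a * y) : ℂ))
  rw [sum_nonunits, AddChar.sum_mulShift _ (ZMod.isPrimitive_stdAddChar _), ZMod.card] at h1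
  rw [eq_sub_of_add_eq h1.symm]
  refine (norm_sub_le _ _).trans (add_le_add ?_ ?_)
  · split_ifs <;> simp
  · split_ifs <;> simp

/-- After `norm_sum_quadGauss_cube` the inner sum over units is a Ramanujan sum, supported on x with
x² ≡ -νn modulo p ^ s, where n = u² + v² + w². So square roots of -νn modulo p ^ (s + 1) and p ^ s
are counted, and an excess of p ^ l roots forces p ^ (2l) ∣ n. -/
theorem norm_reducedSum_le (hp2 : p ≠ 2) {ν e : ℤ} (hν : ¬ (p : ℤ) ∣ ν) (u v w : ℤ) :
    ∃ l, 2 * l ≤ s + 1 ∧ (p : ℤ) ^ (2 * l) ∣ u ^ 2 + v ^ 2 + w ^ 2 ∧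
      ‖reducedSum p s ((ν * e ^ 2 : ℤ) : ZMod (p ^ (s + 1))) u v w‖ ≤
        4 * (p : ℝ) ^ (s + 1) * p ^ (s + 1) * p ^ l := by
  have unit_of : ∀ m : ℤ, ¬ (p : ℤ) ∣ m → IsUnit (m : ZMod (p ^ (s + 1))) := by
    intro m hm
    apply isUnit_of_castHom_ne_zero s.succ_ne_zero
    rw [map_intCast, Ne, ZMod.intCast_zmod_eq_zero_iff_dvd]
    exact hm
  obtain ⟨ν', hν'⟩ := unit_of ν hν
  obtain ⟨t, ht⟩ := unit_of 2 (by
    intro h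
    have : p ∣ 2 := by exact_mod_cast h
    exact hp2 ((Nat.prime_dvd_prime_iff_eq hp.out Nat.prime_two).mp this))
  have ht2 : (t : ZMod (p ^ (s + 1))) = 2 := by rw [ht]; push_cast; rfl
  have hred : reducedSum p s ((ν * e ^ 2 : ℤ) : ZMod (p ^ (s + 1))) u v w =
      ∑ a : (ZMod (p ^ (s + 1)))ˣ,
        ZMod.stdAddChar ((a : ZMod (p ^ (s + 1))) * ((ν' : ZMod (p ^ (s + 1))) * (e : ZMod (p ^ (s + 1))) ^ 2)) *
        ZMod.stdAddChar (-(((u ^ 2 + v ^ 2 + w ^ 2 : ℤ) : ZMod (p ^ (s + 1))) *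
          (((t ^ 2 * a)⁻¹ : (ZMod (p ^ (s + 1)))ˣ) : ZMod (p ^ (s + 1))))) *
        quadGauss ZMod.stdAddChar (a : ZMod (p ^ (s + 1))) ^ 3 := by
    unfold reducedSum
    refine sum_congr rfl fun a _ => ?_
    rw [sum_quadratic_phase a t ht2, sum_quadratic_phase a t ht2, sum_quadratic_phase a t ht2, hν']
    set A := ((t ^ 2 * a)⁻¹ : (ZMod (p ^ (s + 1)))ˣ)
    have hA : -(((u ^ 2 + v ^ 2 + w ^ 2 : ℤ) : ZMod (p ^ (s + 1))) * A) =
        -((w : ZMod (p ^ (s + 1))) ^ 2 * A) + -((v : ZMod (p ^ (s + 1))) ^ 2 * A) +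
        -((u : ZMod (p ^ (s + 1))) ^ 2 * A) := by
      push_cast
      ring
    rw [hA, AddChar.map_add_eq_mul, AddChar.map_add_eq_mul]
    push_cast
    ring
  rw [hred, norm_sum_quadGauss_cube (ZMod.isPrimitive_stdAddChar _)
    (unit_eq_sq_add_sq hp2 s.succ_ne_zero) (isSquare_trichotomy hp2 s.succ_ne_zero) t ν' ht2,
    ZMod.card]
  set n : ℤ := u ^ 2 + v ^ 2 + w ^ 2 with hn
  obtain ⟨l₁, h11, h12, h13⟩ := card_zmod_roots_le (p := p) (s := s + 1) hp2 le_rfl (-(ν * n))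
  obtain ⟨l₂, h21, h22, h23⟩ := card_zmod_roots_le (p := p) (s := s + 1) hp2 s.le_succ (-(ν * n))
  have hdvd : ∀ l, (p : ℤ) ^ l ∣ -(ν * n) → (p : ℤ) ^ l ∣ n := by
    intro l hl
    rw [dvd_neg] at hl
    exact (Nat.prime_iff_prime_int.mp hp.out).pow_dvd_of_dvd_mul_left l hν hl
  refine ⟨max l₁ l₂, ?_, ?_, ?_⟩
  · omega
  · rcases max_choice l₁ l₂ with h | h <;> rw [h]
    · exact hdvd _ h12
    · exact hdvd _ h22
  have hbound : ‖∑ x : ZMod (p ^ (s + 1)), ZMod.stdAddChar ((e : ZMod (p ^ (s + 1))) * x) *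
      ∑ b : (ZMod (p ^ (s + 1)))ˣ,
        (ZMod.stdAddChar ((b : ZMod (p ^ (s + 1))) * (x ^ 2 + (ν' : ZMod (p ^ (s + 1))) * (n : ZMod (p ^ (s + 1))))) : ℂ)‖ ≤
      ∑ x : ZMod (p ^ (s + 1)),
        ((if x ^ 2 + (ν' : ZMod (p ^ (s + 1))) * (n : ZMod (p ^ (s + 1))) = 0 then (p : ℝ) ^ (s + 1) else 0) +
        (if (p : ZMod (p ^ (s + 1))) * (x ^ 2 + (ν' : ZMod (p ^ (s + 1))) * (n : ZMod (p ^ (s + 1)))) = 0 then (p : ℝ) ^ s else 0)) := by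
    refine norm_sum_le_of_le _ fun x _ => ?_
    rw [norm_mul, AddChar.norm_apply, one_mul]
    exact norm_sum_units_le _
  have hone : (1 : ℝ) ≤ p := by exact_mod_cast hp.out.one_lt.le
  have hc1 : (#(univ.filter fun x : ZMod (p ^ (s + 1)) =>
      x ^ 2 + (ν' : ZMod (p ^ (s + 1))) * (n : ZMod (p ^ (s + 1))) = 0) : ℝ) ≤ 2 * (p : ℝ) ^ l₁ := by
    have : #(univ.filter fun x : ZMod (p ^ (s + 1)) =>
      x ^ 2 + (ν' : ZMod (p ^ (s + 1))) * (n : ZMod (p ^ (s + 1))) = 0) ≤ 2 * p ^ l₁ := by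
      rw [Nat.sub_self, zero_add] at h13
      refine le_trans (card_le_card fun x hx => ?_) h13
      simp only [mem_filter, mem_univ, true_and] at hx ⊢
      rw [pow_zero, Nat.cast_one, one_mul, ← hx, hν']
      push_cast
      ring
    exact_mod_cast this
  have hc2 : (#(univ.filter fun x : ZMod (p ^ (s + 1)) =>
      (p : ZMod (p ^ (s + 1))) * (x ^ 2 + (ν' : ZMod (p ^ (s + 1))) * (n : ZMod (p ^ (s + 1)))) = 0) : ℝ) ≤
        2 * (p : ℝ) ^ (1 + l₂) := by
    have : #(univ.filter fun x : ZMod (p ^ (s + 1)) =>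
      (p : ZMod (p ^ (s + 1))) * (x ^ 2 + (ν' : ZMod (p ^ (s + 1))) * (n : ZMod (p ^ (s + 1)))) = 0) ≤ 2 * p ^ (1 + l₂) := by
      rw [Nat.add_sub_cancel_left] at h23
      refine le_trans (card_le_card fun x hx => ?_) h23
      simp only [mem_filter, mem_univ, true_and] at hx ⊢
      rw [← hx, hν']
      push_cast
      ring
    exact_mod_cast this
  have hl₁ : (p : ℝ) ^ l₁ ≤ (p : ℝ) ^ max l₁ l₂ := pow_le_pow_right₀ hone (le_max_left _ _)
  have hl₂ : (p : ℝ) ^ l₂ ≤ (p : ℝ) ^ max l₁ l₂ := pow_le_pow_right₀ hone (le_max_right _ _)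
  rw [sum_add_distrib, ← sum_filter, ← sum_filter, sum_const, sum_const, nsmul_eq_mul,
    nsmul_eq_mul] at hbound
  have hfin : ‖∑ x : ZMod (p ^ (s + 1)), ZMod.stdAddChar ((e : ZMod (p ^ (s + 1))) * x) *
      ∑ b : (ZMod (p ^ (s + 1)))ˣ,
        (ZMod.stdAddChar ((b : ZMod (p ^ (s + 1))) * (x ^ 2 + (ν' : ZMod (p ^ (s + 1))) * (n : ZMod (p ^ (s + 1))))) : ℂ)‖ ≤
      4 * (p : ℝ) ^ (s + 1) * p ^ max l₁ l₂ := by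
    refine hbound.trans ?_
    calc _ ≤ 2 * (p : ℝ) ^ l₁ * p ^ (s + 1) + 2 * (p : ℝ) ^ (1 + l₂) * p ^ s := by gcongr
      _ = 2 * (p : ℝ) ^ (s + 1) * p ^ l₁ + 2 * (p : ℝ) ^ (s + 1) * p ^ l₂ := by ring
      _ ≤ 2 * (p : ℝ) ^ (s + 1) * p ^ max l₁ l₂ + 2 * (p : ℝ) ^ (s + 1) * p ^ max l₁ l₂ := by
        gcongr
      _ = _ := by ring
  calc _ ≤ ((p ^ (s + 1) : ℕ) : ℝ) * (4 * (p : ℝ) ^ (s + 1) * p ^ max l₁ l₂) := by gcongr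
    _ = _ := by push_cast; ring

/-- The contribution of the non-reduced fractions to `expSum`. -/
noncomputable def nonreducedSum (p s : ℕ) [Fact p.Prime] (k u v w : ZMod (p ^ (s + 1))) : ℂ :=
  ∑ x : ZMod (p ^ (s + 1)), ∑ y : ZMod (p ^ (s + 1)), ∑ z : ZMod (p ^ (s + 1)),
    (if (p : ZMod (p ^ (s + 1))) * (x ^ 2 + y ^ 2 + z ^ 2 + k) = 0 then (p : ℂ) ^ s else 0) *
      ZMod.stdAddChar (u * x + v * y + w * z)

theorem nonreducedSum_swap_left (k u v w : ZMod (p ^ (s + 1))) :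
    nonreducedSum p s k u v w = nonreducedSum p s k v u w := by
  unfold nonreducedSum
  rw [sum_comm]
  refine sum_congr rfl fun x _ => sum_congr rfl fun y _ => sum_congr rfl fun z _ => ?_
  rw [show y ^ 2 + x ^ 2 = x ^ 2 + y ^ 2 by ring, show u * y + v * x = v * x + u * y by ring]

theorem nonreducedSum_swap_right (k u v w : ZMod (p ^ (s + 1))) :
    nonreducedSum p s k u v w = nonreducedSum p s k u w v := by
  unfold nonreducedSum
  refine sum_congr rfl fun x _ => ?_
  rw [sum_comm]
  refine sum_congr rfl fun y _ => sum_congr rfl fun z _ => ?_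
  rw [show x ^ 2 + z ^ 2 + y ^ 2 = x ^ 2 + y ^ 2 + z ^ 2 by ring,
    show u * x + v * z + w * y = u * x + w * y + v * z by ring]

/-- The weight depends only on x modulo p ^ s, so the shift x ↦ x + p ^ s preserves it while the
character gains e(u/p) ≠ 1. -/
theorem nonreducedSum_eq_zero (k v w : ZMod (p ^ (s + 1))) {u : ℤ} (hu : ¬ (p : ℤ) ∣ u) :
    nonreducedSum p s k u v w = 0 := by
  have hps : (p : ZMod (p ^ (s + 1))) * (p : ZMod (p ^ (s + 1))) ^ s = 0 := by
    rw [← pow_succ', ← Nat.cast_pow, ZMod.natCast_self]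
  have hne : (ZMod.stdAddChar ((u : ZMod (p ^ (s + 1))) * (p : ZMod (p ^ (s + 1))) ^ s) : ℂ)
      ≠ 1 := by
    intro h
    rw [← AddChar.map_zero_eq_one (ZMod.stdAddChar (N := p ^ (s + 1)))] at h
    have h2 := ZMod.injective_stdAddChar h
    have h3 : ((u * (p : ℤ) ^ s : ℤ) : ZMod (p ^ (s + 1))) = 0 := by
      rw [← h2]
      push_cast
      rfl
    rw [ZMod.intCast_zmod_eq_zero_iff_dvd] at h3
    push_cast at h3
    rw [pow_succ', mul_dvd_mul_iff_right (pow_ne_zero _ (by exact_mod_cast hp.out.ne_zero))] at h3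
    exact hu h3
  have hshift : nonreducedSum p s k u v w =
      ZMod.stdAddChar ((u : ZMod (p ^ (s + 1))) * (p : ZMod (p ^ (s + 1))) ^ s) *
        nonreducedSum p s k u v w := by
    conv_lhs => unfold nonreducedSum
    rw [← Equiv.sum_comp (Equiv.addRight ((p : ZMod (p ^ (s + 1))) ^ s))]
    unfold nonreducedSum
    simp only [mul_sum]
    refine sum_congr rfl fun x _ => sum_congr rfl fun y _ => sum_congr rfl fun z _ => ?_
    simp only [Equiv.coe_addRight]
    have h1 : (p : ZMod (p ^ (s + 1))) * ((x + (p : ZMod (p ^ (s + 1))) ^ s) ^ 2 + y ^ 2 + z ^ 2 + k)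
        = (p : ZMod (p ^ (s + 1))) * (x ^ 2 + y ^ 2 + z ^ 2 + k) := by
      linear_combination (2 * x + (p : ZMod (p ^ (s + 1))) ^ s) * hps
    simp only [h1]
    rw [mul_left_comm, ← AddChar.map_add_eq_mul]
    congr 2
    ring
  have h0 : (1 - ZMod.stdAddChar ((u : ZMod (p ^ (s + 1))) * (p : ZMod (p ^ (s + 1))) ^ s)) *
      nonreducedSum p s k u v w = 0 := by
    rw [sub_mul, one_mul, ← hshift, sub_self]
  rcases mul_eq_zero.mp h0 with h | h
  · exact absurd (sub_eq_zero.mp h).symm hne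
  · exact h

/-- The whole summand factors through reduction modulo p ^ s. Three fibres of size p and the weight
p ^ s account for p ^ (s + 3). -/
theorem nonreducedSum_of_dvd (k u v w : ℤ) :
    nonreducedSum p s k ((p * u : ℤ) : ZMod _) ((p * v : ℤ) : ZMod _) ((p * w : ℤ) : ZMod _) =
      (p : ℂ) ^ (s + 3) * expSum (p ^ s) k u v w := by
  set φ := ZMod.castHom (pow_dvd_pow p s.le_succ) (ZMod (p ^ s)) with hφ
  obtain ⟨F, hF⟩ : ∃ F : ZMod (p ^ s) → ZMod (p ^ s) → ZMod (p ^ s) → ℂ, F = (fun x y z : ZMod (p ^ s) =>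
        if x ^ 2 + y ^ 2 + z ^ 2 + (k : ZMod (p ^ s)) = 0 then
      (ZMod.stdAddChar ((u : ZMod (p ^ s)) * x + (v : ZMod (p ^ s)) * y +
        (w : ZMod (p ^ s)) * z) : ℂ) else 0) := ⟨_, rfl⟩
  have hexp : expSum (p ^ s) k u v w = ∑ x, ∑ y, ∑ z, F x y z := by
    rw [hF]
    rfl
  have hterm : ∀ x y z : ZMod (p ^ (s + 1)),
      (if (p : ZMod (p ^ (s + 1))) * (x ^ 2 + y ^ 2 + z ^ 2 + (k : ZMod _)) = 0
        then (p : ℂ) ^ s else 0) *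
      ZMod.stdAddChar (((p * u : ℤ) : ZMod (p ^ (s + 1))) * x + ((p * v : ℤ) : ZMod _) * y +
        ((p * w : ℤ) : ZMod _) * z) =
      (p : ℂ) ^ s * F (φ x) (φ y) (φ z) := by
    intro x y z
    have h1 : (p : ZMod (p ^ (s + 1))) * (x ^ 2 + y ^ 2 + z ^ 2 + (k : ZMod _)) = 0 ↔
        φ x ^ 2 + φ y ^ 2 + φ z ^ 2 + (k : ZMod (p ^ s)) = 0 := by
      rw [prime_mul_eq_zero_iff, ← hφ, map_add, map_add, map_add, map_pow, map_pow, map_pow,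
        map_intCast]
    have h2 : (ZMod.stdAddChar (((p * u : ℤ) : ZMod (p ^ (s + 1))) * x +
        ((p * v : ℤ) : ZMod _) * y + ((p * w : ℤ) : ZMod _) * z) : ℂ) =
        ZMod.stdAddChar ((u : ZMod (p ^ s)) * φ x + (v : ZMod (p ^ s)) * φ y +
          (w : ZMod (p ^ s)) * φ z) := by
      obtain ⟨x, rfl⟩ := ZMod.intCast_surjective x
      obtain ⟨y, rfl⟩ := ZMod.intCast_surjective y
      obtain ⟨z, rfl⟩ := ZMod.intCast_surjective z
      rw [map_intCast, map_intCast, map_intCast]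
      have h3 := stdAddChar_mul_of_eq (pow_succ' p s) (u * x + v * y + w * z)
      convert h3 using 2
      · push_cast
        ring
      · push_cast
        ring
    rw [h2, hF]
    simp only [h1]
    split_ifs <;> simp
  rw [hexp]
  unfold nonreducedSum
  simp only [hterm]
  simp only [← mul_sum]
  have e1 : ∀ x y, ∑ z : ZMod (p ^ (s + 1)), F (φ x) (φ y) (φ z) = p * ∑ z, F (φ x) (φ y) z :=
    fun x y => sum_comp_castHom (F (φ x) (φ y))
  have e2 : ∀ x, ∑ y : ZMod (p ^ (s + 1)), p * ∑ z, F (φ x) (φ y) z =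
      p * ∑ y, (p * ∑ z, F (φ x) y z) :=
    fun x => sum_comp_castHom (fun y => p * ∑ z, F (φ x) y z)
  have e3 : ∑ x : ZMod (p ^ (s + 1)), p * ∑ y, (p * ∑ z, F (φ x) y z) =
      p * ∑ x, (p * ∑ y, (p * ∑ z, F x y z)) :=
    sum_comp_castHom (fun x => p * ∑ y, (p * ∑ z, F x y z))
  simp only [e1, e2, e3]
  simp only [← mul_sum]
  ring

/-- Induction on s. Unless p divides all frequencies the non-reduced part vanishes; if it does, that
part is the sum one level down at the frequencies divided by p, so j is replaced by pj. Each level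
adds 4 to the constant, from `norm_reducedSum_le`. -/
theorem expSumBound_prime_pow (hp2 : p ≠ 2) {ν e : ℤ} (hν : ¬ (p : ℤ) ∣ ν) (s : ℕ) :
    ExpSumBound (p ^ s) (ν * e ^ 2) (4 * s + 1) := by
  have hone : (1 : ℝ) ≤ p := by exact_mod_cast hp.out.one_lt.le
  have hp0 : (0 : ℝ) < p := by linarith
  have hsqrt : ∀ l : ℕ, √((p ^ (2 * l) : ℕ) : ℝ) = (p : ℝ) ^ l := by
    intro l
    rw [show ((p ^ (2 * l) : ℕ) : ℝ) = ((p : ℝ) ^ l) ^ 2 by push_cast; ring,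
      Real.sqrt_sq (by positivity)]
  induction s with
  | zero =>
    have := expSumBound_trivial (p ^ 0) (ν * e ^ 2)
    refine this.mono ?_
    simp
  | succ s ih =>
    intro u v w
    obtain ⟨l, hl1, hl2, hl3⟩ := norm_reducedSum_le (s := s) hp2 (e := e) hν u v w
    have hdec := expSum_eq_reducedSum_add (s := s) ((ν * e ^ 2 : ℤ) : ZMod (p ^ (s + 1))) u v w
    change _ = _ + nonreducedSum p s _ _ _ _ at hdec
    have hgdvd : p ^ (2 * l) ∣ p ^ (s + 1) := pow_dvd_pow p hl1
    by_cases hall : (p : ℤ) ∣ u ∧ (p : ℤ) ∣ v ∧ (p : ℤ) ∣ w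
    swap
    · have hzero : nonreducedSum p s ((ν * e ^ 2 : ℤ) : ZMod (p ^ (s + 1))) u v w = 0 := by
        by_cases hu : (p : ℤ) ∣ u
        · by_cases hv : (p : ℤ) ∣ v
          · have hw : ¬ (p : ℤ) ∣ w := fun hw => hall ⟨hu, hv, hw⟩
            rw [nonreducedSum_swap_right, nonreducedSum_swap_left]
            exact nonreducedSum_eq_zero _ _ _ hw
          · rw [nonreducedSum_swap_left]
            exact nonreducedSum_eq_zero _ _ _ hv
        · exact nonreducedSum_eq_zero _ _ _ hu
      rw [hzero, add_zero] at hdec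
      refine ⟨1, p ^ (2 * l), by simpa using hgdvd, by simp, by simp, by simp, ?_, ?_⟩
      · simpa using hl2
      · have hn := congrArg norm hdec
        rw [norm_mul, norm_pow, Complex.norm_natCast] at hn
        rw [← hn] at hl3
        have h1 : ‖expSum (p ^ (s + 1)) ((ν * e ^ 2 : ℤ) : ZMod (p ^ (s + 1))) u v w‖ ≤
            4 * (p : ℝ) ^ (s + 1) * p ^ l := by
          refine le_of_mul_le_mul_left (hl3.trans (le_of_eq ?_)) (pow_pos hp0 (s + 1))
          ring
        rw [hsqrt]
        refine h1.trans ?_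
        push_cast
        have : (0 : ℝ) ≤ s := Nat.cast_nonneg s
        have h4 : (4 : ℝ) ≤ 4 * (s + 1) + 1 := by linarith
        rw [mul_one]
        gcongr
    obtain ⟨⟨u, rfl⟩, ⟨v, rfl⟩, ⟨w, rfl⟩⟩ := hall
    rw [nonreducedSum_of_dvd] at hdec
    obtain ⟨j, g, h1, h2, h3, h4, h5, h6⟩ := ih u v w
    have hT : ‖expSum (p ^ (s + 1)) ((ν * e ^ 2 : ℤ) : ZMod (p ^ (s + 1)))
        ((p * u : ℤ) : ZMod _) ((p * v : ℤ) : ZMod _) ((p * w : ℤ) : ZMod _)‖ ≤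
        4 * (p : ℝ) ^ (s + 1) * p ^ l + (4 * s + 1) * (p : ℝ) ^ (s + 1) * ((p * j) * √g) := by
      refine le_of_mul_le_mul_left ?_ (pow_pos hp0 (s + 1))
      have hn := congrArg norm hdec
      rw [norm_mul, norm_pow, Complex.norm_natCast] at hn
      rw [hn]
      refine (norm_add_le _ _).trans ?_
      rw [norm_mul, norm_pow, Complex.norm_natCast, mul_add]
      refine add_le_add (hl3.trans (le_of_eq (by ring))) ?_
      calc (p : ℝ) ^ (s + 3) * ‖expSum (p ^ s) ((ν * e ^ 2 : ℤ) : ZMod (p ^ s)) u v w‖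
          ≤ (p : ℝ) ^ (s + 3) * ((4 * s + 1) * ((p ^ s : ℕ) : ℝ) * j * √g) := by gcongr
        _ = _ := by push_cast; ring
    -- The reduced part suggests the pair (1, p ^ (2l)) and the recursive part (pj, g); the pair
    -- with the larger j √g serves for both.
    rcases le_total ((p : ℝ) ^ l) ((p * j) * √g) with hle | hle
    · refine ⟨p * j, g, ?_, ?_, ?_, ?_, ?_, ?_⟩
      · rw [mul_assoc, pow_succ']
        exact mul_dvd_mul_left p h1
      · push_cast
        exact mul_dvd_mul_left _ h2
      · push_cast
        exact mul_dvd_mul_left _ h3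
      · push_cast
        exact mul_dvd_mul_left _ h4
      · rw [show (p * u) ^ 2 + (p * v) ^ 2 + (p * w) ^ 2 = (p : ℤ) ^ 2 * (u ^ 2 + v ^ 2 + w ^ 2) by
          ring]
        push_cast
        rw [mul_pow, mul_assoc]
        exact mul_dvd_mul_left _ h5
      · refine hT.trans ?_
        calc _ ≤ 4 * (p : ℝ) ^ (s + 1) * ((p * j) * √g) +
              (4 * s + 1) * (p : ℝ) ^ (s + 1) * ((p * j) * √g) := by gcongr
          _ = _ := by push_cast; ring
    · refine ⟨1, p ^ (2 * l), by simpa using hgdvd, by simp, by simp, by simp, ?_, ?_⟩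
      · simpa using hl2
      · refine hT.trans ?_
        rw [hsqrt]
        calc _ ≤ 4 * (p : ℝ) ^ (s + 1) * p ^ l + (4 * s + 1) * (p : ℝ) ^ (s + 1) * p ^ l := by
              gcongr
          _ = _ := by push_cast; ring

end PrimePowerBound

/-! ### Multiplicativity in the modulus. -/

section CRT

theorem stdAddChar_mul_eq {m n : ℕ} [NeZero m] [NeZero n] [NeZero (m * n)] {α β : ℤ}
    (h : α * m + β * n = 1) (x : ℤ) :
    (ZMod.stdAddChar (x : ZMod (m * n)) : ℂ) =
      ZMod.stdAddChar ((β * x : ℤ) : ZMod m) * ZMod.stdAddChar ((α * x : ℤ) : ZMod n) := by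
  rw [ZMod.stdAddChar_coe, ZMod.stdAddChar_coe, ZMod.stdAddChar_coe, ← Complex.exp_add]
  have hm : (m : ℂ) ≠ 0 := by exact_mod_cast NeZero.ne m
  have hn : (n : ℂ) ≠ 0 := by exact_mod_cast NeZero.ne n
  congr 1
  have h' : (α : ℂ) * m + β * n = 1 := by exact_mod_cast h
  push_cast
  field_simp
  linear_combination (-(x : ℂ)) * h'

/-- The identity 1/(mn) = β/m + α/n splits the character and is the source of the twists of the
frequencies by β and α. -/
theorem expSum_mul {m n : ℕ} [NeZero m] [NeZero n] [NeZero (m * n)] (hmn : m.Coprime n)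
    {α β : ℤ} (h : α * m + β * n = 1) (k u v w : ℤ) :
    expSum (m * n) k u v w =
      expSum m k ((β * u : ℤ) : ZMod m) ((β * v : ℤ) : ZMod m) ((β * w : ℤ) : ZMod m) *
      expSum n k ((α * u : ℤ) : ZMod n) ((α * v : ℤ) : ZMod n) ((α * w : ℤ) : ZMod n) := by
  set e := ZMod.chineseRemainder hmn with he
  obtain ⟨F, hF⟩ : ∃ F : ZMod m → ZMod m → ZMod m → ℂ, F = fun x y z =>
      if x ^ 2 + y ^ 2 + z ^ 2 + (k : ZMod m) = 0 then
        ZMod.stdAddChar (((β * u : ℤ) : ZMod m) * x + ((β * v : ℤ) : ZMod m) * y +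
          ((β * w : ℤ) : ZMod m) * z) else 0 := ⟨_, rfl⟩
  obtain ⟨G, hG⟩ : ∃ G : ZMod n → ZMod n → ZMod n → ℂ, G = fun x y z =>
      if x ^ 2 + y ^ 2 + z ^ 2 + (k : ZMod n) = 0 then
        ZMod.stdAddChar (((α * u : ℤ) : ZMod n) * x + ((α * v : ℤ) : ZMod n) * y +
          ((α * w : ℤ) : ZMod n) * z) else 0 := ⟨_, rfl⟩
  have h1 : expSum m k ((β * u : ℤ) : ZMod m) ((β * v : ℤ) : ZMod m) ((β * w : ℤ) : ZMod m) =
      ∑ x, ∑ y, ∑ z, F x y z := by rw [hF]; rfl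
  have h2 : expSum n k ((α * u : ℤ) : ZMod n) ((α * v : ℤ) : ZMod n) ((α * w : ℤ) : ZMod n) =
      ∑ x, ∑ y, ∑ z, G x y z := by rw [hG]; rfl
  have hterm : ∀ x y z : ZMod (m * n),
      (if x ^ 2 + y ^ 2 + z ^ 2 + (k : ZMod (m * n)) = 0 then
        (ZMod.stdAddChar ((u : ZMod (m * n)) * x + (v : ZMod (m * n)) * y +
          (w : ZMod (m * n)) * z) : ℂ) else 0) =
      F (e x).1 (e y).1 (e z).1 * G (e x).2 (e y).2 (e z).2 := by
    intro x y z
    obtain ⟨x, rfl⟩ := ZMod.intCast_surjective x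
    obtain ⟨y, rfl⟩ := ZMod.intCast_surjective y
    obtain ⟨z, rfl⟩ := ZMod.intCast_surjective z
    have hcond : ((x : ZMod (m * n)) ^ 2 + (y : ZMod (m * n)) ^ 2 + (z : ZMod (m * n)) ^ 2 +
        (k : ZMod (m * n)) = 0) ↔
        ((x : ZMod m) ^ 2 + (y : ZMod m) ^ 2 + (z : ZMod m) ^ 2 + (k : ZMod m) = 0 ∧
          (x : ZMod n) ^ 2 + (y : ZMod n) ^ 2 + (z : ZMod n) ^ 2 + (k : ZMod n) = 0) := by
      rw [← map_eq_zero_iff e e.injective, Prod.ext_iff]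
      simp
    have hchar : (ZMod.stdAddChar ((u : ZMod (m * n)) * (x : ZMod (m * n)) +
        (v : ZMod (m * n)) * (y : ZMod (m * n)) + (w : ZMod (m * n)) * (z : ZMod (m * n))) : ℂ) =
        ZMod.stdAddChar (((β * u : ℤ) : ZMod m) * (x : ZMod m) + ((β * v : ℤ) : ZMod m) *
          (y : ZMod m) + ((β * w : ℤ) : ZMod m) * (z : ZMod m)) *
        ZMod.stdAddChar (((α * u : ℤ) : ZMod n) * (x : ZMod n) + ((α * v : ℤ) : ZMod n) *
          (y : ZMod n) + ((α * w : ℤ) : ZMod n) * (z : ZMod n)) := by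
      have := stdAddChar_mul_eq h (u * x + v * y + w * z)
      convert this using 2
      · push_cast
        ring
      · congr 1
        push_cast
        ring
      · congr 1
        push_cast
        ring
    rw [hF, hG, hchar]
    simp only [hcond, map_intCast, Prod.fst_intCast, Prod.snd_intCast]
    rw [ite_zero_mul_ite_zero]
  rw [h1, h2]
  unfold expSum
  simp only [hterm]
  have hz : ∀ x y, ∑ z, F (e x).1 (e y).1 (e z).1 * G (e x).2 (e y).2 (e z).2 =
      (∑ z, F (e x).1 (e y).1 z) * ∑ z, G (e x).2 (e y).2 z := by
    intro x y
    rw [sum_mul_sum, ← Fintype.sum_prod_type']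
    exact Equiv.sum_comp e.toEquiv
      (fun z : ZMod m × ZMod n => F (e x).1 (e y).1 z.1 * G (e x).2 (e y).2 z.2)
  have hy : ∀ x, ∑ y, ((∑ z, F (e x).1 (e y).1 z) * ∑ z, G (e x).2 (e y).2 z) =
      (∑ y, ∑ z, F (e x).1 y z) * ∑ y, ∑ z, G (e x).2 y z := by
    intro x
    rw [sum_mul_sum, ← Fintype.sum_prod_type']
    exact Equiv.sum_comp e.toEquiv
      (fun y : ZMod m × ZMod n => (∑ z, F (e x).1 y.1 z) * ∑ z, G (e x).2 y.2 z)
  simp only [hz, hy]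
  rw [sum_mul_sum, ← Fintype.sum_prod_type']
  exact Equiv.sum_comp e.toEquiv
    (fun x : ZMod m × ZMod n => (∑ y, ∑ z, F x.1 y z) * ∑ y, ∑ z, G x.2 y z)

/-- Since β is prime to m and α to n, the twists drop out of the divisibility conditions; these then
multiply because all divisors of m are prime to those of n. -/
theorem ExpSumBound.mul {m n : ℕ} [NeZero m] [NeZero n] [NeZero (m * n)] (hmn : m.Coprime n)
    {k : ℤ} {K L : ℝ} (hK : ExpSumBound m k K) (hL : ExpSumBound n k L) (hL0 : 0 ≤ L) :
    ExpSumBound (m * n) k (K * L) := by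
  intro u v w
  obtain ⟨α, β, h⟩ : ∃ α β : ℤ, α * m + β * n = 1 := by
    obtain ⟨α, β, h⟩ := (Nat.isCoprime_iff_coprime.mpr hmn)
    exact ⟨α, β, h⟩
  have hβ : IsCoprime (m : ℤ) β := ⟨α, n, by rw [mul_comm (n : ℤ)]; exact h⟩
  have hα : IsCoprime (n : ℤ) α := ⟨β, m, by rw [mul_comm (m : ℤ), add_comm]; exact h⟩
  obtain ⟨j, g, h1, h2, h3, h4, h5, h6⟩ := hK (β * u) (β * v) (β * w)
  obtain ⟨j', g', h1', h2', h3', h4', h5', h6'⟩ := hL (α * u) (α * v) (α * w)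
  have hj : (j : ℤ) ∣ m := by exact_mod_cast (dvd_mul_right j g).trans h1
  have hg : (g : ℤ) ∣ m := by exact_mod_cast (dvd_mul_left g j).trans h1
  have hj' : (j' : ℤ) ∣ n := by exact_mod_cast (dvd_mul_right j' g').trans h1'
  have hg' : (g' : ℤ) ∣ n := by exact_mod_cast (dvd_mul_left g' j').trans h1'
  have hmnZ : IsCoprime (m : ℤ) n := Nat.isCoprime_iff_coprime.mpr hmn
  have cj : IsCoprime (j : ℤ) β := hβ.of_isCoprime_of_dvd_left hj
  have cg : IsCoprime (g : ℤ) β := hβ.of_isCoprime_of_dvd_left hg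
  have cj' : IsCoprime (j' : ℤ) α := hα.of_isCoprime_of_dvd_left hj'
  have cg' : IsCoprime (g' : ℤ) α := hα.of_isCoprime_of_dvd_left hg'
  have cjj : IsCoprime (j : ℤ) j' :=
    (hmnZ.of_isCoprime_of_dvd_left hj).of_isCoprime_of_dvd_right hj'
  have cjg : IsCoprime (j : ℤ) g' :=
    (hmnZ.of_isCoprime_of_dvd_left hj).of_isCoprime_of_dvd_right hg'
  have cgj : IsCoprime (g : ℤ) j' :=
    (hmnZ.of_isCoprime_of_dvd_left hg).of_isCoprime_of_dvd_right hj'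
  have cgg : IsCoprime (g : ℤ) g' :=
    (hmnZ.of_isCoprime_of_dvd_left hg).of_isCoprime_of_dvd_right hg'
  refine ⟨j * j', g * g', ?_, ?_, ?_, ?_, ?_, ?_⟩
  · rw [mul_mul_mul_comm]
    exact mul_dvd_mul h1 h1'
  · push_cast
    exact cjj.mul_dvd (cj.dvd_of_dvd_mul_left h2) (cj'.dvd_of_dvd_mul_left h2')
  · push_cast
    exact cjj.mul_dvd (cj.dvd_of_dvd_mul_left h3) (cj'.dvd_of_dvd_mul_left h3')
  · push_cast
    exact cjj.mul_dvd (cj.dvd_of_dvd_mul_left h4) (cj'.dvd_of_dvd_mul_left h4')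
  · have e1 : ∀ c : ℤ, (c * u) ^ 2 + (c * v) ^ 2 + (c * w) ^ 2 =
        c ^ 2 * (u ^ 2 + v ^ 2 + w ^ 2) := fun c => by ring
    rw [e1] at h5 h5'
    have d1 : (j : ℤ) ^ 2 * g ∣ u ^ 2 + v ^ 2 + w ^ 2 :=
      ((cj.pow (m := 2) (n := 2)).mul_left cg.pow_right).dvd_of_dvd_mul_left h5
    have d2 : (j' : ℤ) ^ 2 * g' ∣ u ^ 2 + v ^ 2 + w ^ 2 :=
      ((cj'.pow (m := 2) (n := 2)).mul_left cg'.pow_right).dvd_of_dvd_mul_left h5'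
    have := (((cjj.pow (m := 2) (n := 2)).mul_right cjg.pow_left).mul_left
      (cgj.pow_right.mul_right cgg)).mul_dvd d1 d2
    push_cast
    rw [mul_pow, mul_mul_mul_comm]
    exact this
  · rw [expSum_mul hmn h, norm_mul]
    have hLnn : 0 ≤ L * n * j' * √g' := by positivity
    calc _ ≤ (K * m * j * √g) * (L * n * j' * √g') :=
          mul_le_mul h6 h6' (norm_nonneg _) ((norm_nonneg _).trans h6)
      _ = _ := by
        push_cast
        rw [Real.sqrt_mul (Nat.cast_nonneg g)]
        ring

end CRT

/-! ### The bound for moduli d ^ r with d squarefree. -/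

section Squarefree

theorem expSumBound_squarefree_pow {r : ℕ} {k : ℤ} {A : ℝ} (hA : 1 ≤ A)
    (h : ∀ p : ℕ, [Fact p.Prime] → ExpSumBound (p ^ r) k A) :
    ∀ (d : ℕ) (_ : Squarefree d) [NeZero (d ^ r)],
      ExpSumBound (d ^ r) k (A ^ #d.primeFactors) := by
  intro d
  induction d using Nat.strong_induction_on with
  | _ d ih =>
    intro hd _
    rcases eq_or_ne d 1 with rfl | hd1
    · refine (expSumBound_trivial (1 ^ r) k).mono ?_
      simp
    have hp := Nat.minFac_prime hd1
    obtain ⟨m, hm⟩ := Nat.minFac_dvd d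
    set p := d.minFac
    have hd0 : d ≠ 0 := hd.ne_zero
    have hm0 : m ≠ 0 := by
      rintro rfl
      exact hd0 (by rw [hm, mul_zero])
    have : Fact p.Prime := ⟨hp⟩
    have : NeZero m := ⟨hm0⟩
    rw [hm] at hd
    have hcop : p.Coprime m := (Nat.squarefree_mul_iff.mp hd).1
    have hmsq : Squarefree m := (Nat.squarefree_mul_iff.mp hd).2.2
    have hlt : m < d := by
      rw [hm]
      exact lt_mul_of_one_lt_left (Nat.pos_of_ne_zero hm0) hp.one_lt
    have hm' := ih m hlt hmsq
    have hmul := ExpSumBound.mul (hcop.pow r r) (h p) hm' (by positivity)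
    have hcard : A ^ #d.primeFactors = A * A ^ #m.primeFactors := by
      rw [hm, hcop.primeFactors_mul, card_union_of_disjoint hcop.disjoint_primeFactors,
        hp.primeFactors, card_singleton, pow_add, pow_one]
    rw [hcard]
    have heq : d ^ r = p ^ r * m ^ r := by rw [← mul_pow, ← hm]
    convert hmul

/-- A constant A per prime suffices, since A ^ ω(d) is smaller than any power of d. The primes up to
2|k| + 2, among them 2 and, for k ≠ 0, all divisors of k, take the trivial bound. -/
theorem exists_expSumBound (r : ℕ) (k : ℤ) :
    ∃ A : ℝ, 1 ≤ A ∧ ∀ (d : ℕ) (_ : Squarefree d) [NeZero (d ^ r)],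
      ExpSumBound (d ^ r) k (A ^ #d.primeFactors) := by
  set B : ℝ := (((2 * k.natAbs + 2 : ℕ) : ℝ) ^ r) ^ 2
  set A : ℝ := max (4 * r + 1) B
  have hA : 1 ≤ A := le_max_of_le_left (by linarith [Nat.cast_nonneg (α := ℝ) r])
  have bad : ∀ p : ℕ, [Fact p.Prime] → p ≤ 2 * k.natAbs + 2 → ExpSumBound (p ^ r) k A := by
    intro p _ hp
    refine (expSumBound_trivial (p ^ r) k).mono (le_max_of_le_right ?_)
    push_cast [B]
    have : (p : ℝ) ≤ 2 * k.natAbs + 2 := by exact_mod_cast hp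
    gcongr
  refine ⟨A, hA, fun d hd _ => expSumBound_squarefree_pow hA (fun p hp => ?_) d hd⟩
  by_cases hp2 : p = 2
  · exact bad p (by omega)
  by_cases hk : k = 0
  · have := expSumBound_prime_pow (p := p) hp2 (ν := 1) (e := 0)
      (by
        intro h
        have : p ∣ 1 := by exact_mod_cast h
        exact hp.out.one_lt.ne' (Nat.dvd_one.mp this)) r
    rw [hk]
    simp only [one_mul, ne_eq, OfNat.ofNat_ne_zero, not_false_eq_true, zero_pow] at this
    exact this.mono (le_max_left _ _)
  by_cases hpk : (p : ℤ) ∣ k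
  · apply bad
    have := Nat.le_of_dvd (Int.natAbs_pos.mpr hk) (Int.natCast_dvd.mp hpk)
    omega
  · have := expSumBound_prime_pow (p := p) hp2 (ν := k) (e := 1) hpk r
    simp only [one_pow, mul_one] at this
    exact this.mono (le_max_left _ _)

end Squarefree

/-! ### The local counts λ as exponential sums at frequency zero. -/

section Lam

theorem sum_Icc_natCast_zmod (q : ℕ) [NeZero q] {M : Type*} [AddCommMonoid M] (F : ZMod q → M) :
    ∑ n ∈ Icc 1 q, F (n : ZMod q) = ∑ x : ZMod q, F x := by
  refine sum_nbij (fun n : ℕ => (n : ZMod q)) ?_ ?_ ?_ ?_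
  · intro n _
    simp
  · intro a ha b hb hab
    simp only [coe_Icc, Set.mem_Icc] at ha hb
    rw [ZMod.natCast_eq_natCast_iff] at hab
    have h1 := (Nat.modEq_iff_dvd).mp hab
    have h2 : ((b : ℤ) - a) = 0 := by
      apply Int.eq_zero_of_abs_lt_dvd h1
      rw [abs_lt]
      omega
    omega
  · intro x _
    by_cases hx : x = 0
    · refine ⟨q, ?_, by simp [hx]⟩
      simp [Nat.one_le_iff_ne_zero, NeZero.ne q]
    · refine ⟨x.val, ?_, by simp⟩
      simp only [coe_Icc, Set.mem_Icc]
      refine ⟨?_, (ZMod.val_lt x).le⟩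
      rw [Nat.one_le_iff_ne_zero, Ne, ZMod.val_eq_zero]
      exact hx
  · intro n _
    rfl

theorem lam_eq_expSum (q : ℕ) [NeZero q] (k : ℤ) : (lam q k : ℂ) = expSum q k 0 0 0 := by
  unfold lam expSum
  rw [← sum_Icc_natCast_zmod, card_filter, sum_product]
  push_cast
  refine sum_congr rfl fun x _ => ?_
  rw [← sum_Icc_natCast_zmod, sum_product]
  refine sum_congr rfl fun y _ => ?_
  rw [← sum_Icc_natCast_zmod]
  refine sum_congr rfl fun z _ => ?_
  have hiff : ((x : ℤ) ^ 2 + (y : ℤ) ^ 2 + (z : ℤ) ^ 2 + k ≡ 0 [ZMOD (q : ℤ)]) ↔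
      (x : ZMod q) ^ 2 + (y : ZMod q) ^ 2 + (z : ZMod q) ^ 2 + (k : ZMod q) = 0 := by
    rw [← ZMod.intCast_eq_intCast_iff]
    push_cast
    rfl
  simp [hiff]

theorem lam_one (k : ℤ) : lam 1 k = 1 := by
  simp [lam, Int.modEq_one]

theorem lam_mul {m n : ℕ} (hm : m ≠ 0) (hn : n ≠ 0) (hmn : m.Coprime n) (k : ℤ) :
    lam (m * n) k = lam m k * lam n k := by
  have : NeZero m := ⟨hm⟩
  have : NeZero n := ⟨hn⟩
  obtain ⟨α, β, h⟩ := Nat.isCoprime_iff_coprime.mpr hmn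
  have := expSum_mul hmn h k 0 0 0
  simp only [mul_zero, Int.cast_zero] at this
  rw [← lam_eq_expSum, ← lam_eq_expSum, ← lam_eq_expSum] at this
  exact_mod_cast this

/-- At zero frequency only jg ∣ q carries information: j √g ≤ jg ≤ q. -/
theorem lam_le_of_expSumBound {q : ℕ} [NeZero q] {k : ℤ} {K : ℝ} (hK : 0 ≤ K)
    (h : ExpSumBound q k K) : (lam q k : ℝ) ≤ K * q ^ 2 := by
  obtain ⟨j, g, h1, -, -, -, -, h2⟩ := h 0 0 0
  simp only [Int.cast_zero] at h2
  rw [← lam_eq_expSum, Complex.norm_natCast] at h2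
  have h3 : (j : ℝ) * g ≤ q := by exact_mod_cast Nat.le_of_dvd (NeZero.pos q) h1
  have hg : √(g : ℝ) ≤ g := by
    rcases Nat.eq_zero_or_pos g with rfl | hg
    · simp
    · rw [Real.sqrt_le_left (by positivity)]
      have : (1 : ℝ) ≤ g := by exact_mod_cast hg
      nlinarith
  calc (lam q k : ℝ) ≤ K * q * j * √g := h2
    _ ≤ K * q * j * g := by gcongr
    _ = K * q * (j * g) := by ring
    _ ≤ K * q * q := by gcongr
    _ = K * q ^ 2 := by ring

end Lam

/-! ### Divisor-type bounds. -/

section DivisorBound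

/-- Only primes below P can exceed their share (p ^ e)^ε; there are at most P of them, each costing
a factor c. -/
theorem prod_primeFactors_le {f : ℕ → ℕ → ℝ} {ε c : ℝ} {P : ℕ} (hc : 1 ≤ c)
    (hf : ∀ p e, 0 ≤ f p e)
    (hlarge : ∀ p e, p.Prime → P ≤ p → e ≠ 0 → f p e ≤ ((p ^ e : ℕ) : ℝ) ^ ε)
    (hall : ∀ p e, p.Prime → e ≠ 0 → f p e ≤ c * ((p ^ e : ℕ) : ℝ) ^ ε) {n : ℕ} (hn : n ≠ 0) :
    ∏ p ∈ n.primeFactors, f p (n.factorization p) ≤ c ^ P * (n : ℝ) ^ ε := by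
  have h1 : ∏ p ∈ n.primeFactors, f p (n.factorization p) ≤
      ∏ p ∈ n.primeFactors, ((if p < P then c else 1) *
        ((p ^ n.factorization p : ℕ) : ℝ) ^ ε) := by
    refine prod_le_prod (fun p _ => hf _ _) fun p hp => ?_
    have hpp := Nat.prime_of_mem_primeFactors hp
    have he : n.factorization p ≠ 0 := by
      rw [← Finsupp.mem_support_iff, Nat.support_factorization]
      exact hp
    split_ifs with h
    · exact hall p _ hpp he
    · rw [one_mul]
      exact hlarge p _ hpp (not_lt.mp h) he
  refine h1.trans ?_
  rw [prod_mul_distrib]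
  have h2 : ∏ p ∈ n.primeFactors, ((p ^ n.factorization p : ℕ) : ℝ) ^ ε = (n : ℝ) ^ ε := by
    rw [Real.finsetProd_rpow _ _ fun p _ => Nat.cast_nonneg _, ← Nat.cast_prod]
    congr 2
    exact Nat.prod_factorization_pow_eq_self hn
  rw [h2]
  gcongr
  rw [prod_ite, prod_const, prod_const_one, mul_one]
  refine pow_le_pow_right₀ hc ?_
  calc #(n.primeFactors.filter (· < P)) ≤ #(range P) := by
        refine card_le_card fun p hp => ?_
        simpa using (mem_filter.mp hp).2
    _ = P := card_range P

theorem exists_pow_card_primeFactors_le {A ε : ℝ} (hA : 1 ≤ A) (hε : 0 < ε) :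
    ∃ C : ℝ, 0 < C ∧ ∀ n : ℕ, n ≠ 0 → A ^ #n.primeFactors ≤ C * (n : ℝ) ^ ε := by
  obtain ⟨P, hP⟩ := exists_nat_ge (A ^ (1 / ε))
  refine ⟨A ^ P, by positivity, fun n hn => ?_⟩
  rw [← prod_const]
  refine prod_primeFactors_le (f := fun _ _ => A) hA (fun _ _ => by positivity) ?_ ?_ hn
  · intro p e hp hPp he
    have h1 : A ^ (1 / ε) ≤ ((p ^ e : ℕ) : ℝ) := by
      refine hP.trans ?_
      exact_mod_cast hPp.trans (Nat.le_self_pow he p)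
    calc A = (A ^ (1 / ε)) ^ ε := by
          rw [← Real.rpow_mul (by positivity), one_div, inv_mul_cancel₀ hε.ne', Real.rpow_one]
      _ ≤ _ := by gcongr
  · intro p e hp he
    have h1 : (1 : ℝ) ≤ ((p ^ e : ℕ) : ℝ) := by
      exact_mod_cast Nat.one_le_pow _ _ hp.pos
    exact le_mul_of_one_le_right (by positivity) (Real.one_le_rpow h1 hε.le)

theorem exists_card_divisors_le {ε : ℝ} (hε : 0 < ε) :
    ∃ C : ℝ, 0 < C ∧ ∀ n : ℕ, n ≠ 0 → (#n.divisors : ℝ) ≤ C * (n : ℝ) ^ ε := by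
  obtain ⟨P, hP⟩ := exists_nat_ge ((2 : ℝ) ^ (1 / ε))
  have hl : 0 < Real.log 2 := Real.log_pos one_lt_two
  -- Chosen so that e + 1 ≤ c p^(eε), using e ε log 2 ≤ exp(e ε log 2) ≤ p^(eε).
  set c : ℝ := 1 / (ε * Real.log 2) + 1 with hc
  have hc1 : 1 ≤ c := by rw [hc]; linarith [show 0 < 1 / (ε * Real.log 2) by positivity]
  refine ⟨c ^ P, by positivity, fun n hn => ?_⟩
  rw [Nat.card_divisors hn]
  push_cast
  refine prod_primeFactors_le (f := fun _ e => (e : ℝ) + 1) hc1 (fun _ _ => by positivity) ?_ ?_ hn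
  · intro p e hp hPp he
    have h1 : (2 : ℝ) ≤ (p : ℝ) ^ ε := by
      calc (2 : ℝ) = (2 ^ (1 / ε)) ^ ε := by
            rw [← Real.rpow_mul (by positivity), one_div, inv_mul_cancel₀ hε.ne', Real.rpow_one]
        _ ≤ _ := by
          gcongr
          exact hP.trans (by exact_mod_cast hPp)
    calc (e : ℝ) + 1 ≤ (2 : ℝ) ^ e := by exact_mod_cast Nat.lt_two_pow_self
      _ ≤ ((p : ℝ) ^ ε) ^ e := by gcongr
      _ = _ := by
        push_cast
        rw [← Real.rpow_natCast, ← Real.rpow_mul (by positivity), mul_comm,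
          Real.rpow_mul (by positivity), Real.rpow_natCast]
  · intro p e hp he
    have h2 : (1 : ℝ) ≤ ((p ^ e : ℕ) : ℝ) := by exact_mod_cast Nat.one_le_pow _ _ hp.pos
    have h3 : 1 ≤ ((p ^ e : ℕ) : ℝ) ^ ε := Real.one_le_rpow h2 hε.le
    have h4 : (e : ℝ) * (ε * Real.log 2) ≤ ((p ^ e : ℕ) : ℝ) ^ ε := by
      have h5 : Real.exp (e * (ε * Real.log 2)) ≤ ((p ^ e : ℕ) : ℝ) ^ ε := by
        rw [Real.rpow_def_of_pos (by linarith), Real.exp_le_exp]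
        push_cast
        rw [Real.log_pow]
        have : Real.log 2 ≤ Real.log p := Real.log_le_log two_pos (by exact_mod_cast hp.two_le)
        calc (e : ℝ) * (ε * Real.log 2) = e * Real.log 2 * ε := by ring
          _ ≤ _ := by gcongr
      linarith [Real.add_one_le_exp ((e : ℝ) * (ε * Real.log 2))]
    rw [hc, add_mul, one_mul, one_div, inv_mul_eq_div]
    refine add_le_add ?_ h3
    rw [le_div_iff₀ (by positivity)]
    exact h4

end DivisorBound

/-! ### Sums of 1/w over roots of a quadratic congruence. -/

section RootSums

/-- At most one element of the class lies below M, and g ≤ 3w² keeps its reciprocal under 2/√g. The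
elements w ≥ M have distinct quotients w / M, so they contribute at most a harmonic sum divided by M
≥ √g. -/
theorem sum_inv_residue_class_le {g M X : ℕ} (hg : 0 < g) (hgM : g ≤ M * M) (ρ : ℤ) :
    ∑ w ∈ (Icc 1 X).filter (fun w : ℕ => (M : ℤ) ∣ (w : ℤ) - ρ ∧ g ≤ 3 * w ^ 2), (1 : ℝ) / w ≤
      (3 + Real.log X) / √g := by
  have hM : 0 < M := by
    rcases Nat.eq_zero_or_pos M with rfl | h
    · omega
    · exact h
  have hsg : 0 < √(g : ℝ) := Real.sqrt_pos.mpr (by exact_mod_cast hg)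
  have hMg : √(g : ℝ) ≤ M := by
    rw [Real.sqrt_le_left (by positivity), sq]
    exact_mod_cast hgM
  have hlogX : 0 ≤ Real.log X := Real.log_natCast_nonneg X
  have inj : ∀ w w' : ℕ, (M : ℤ) ∣ (w : ℤ) - ρ → (M : ℤ) ∣ (w' : ℤ) - ρ → w / M = w' / M →
      w = w' := by
    intro w w' h h' he
    have h1 : (M : ℤ) ∣ (w' : ℤ) - w := by simpa using dvd_sub h' h
    have h2 : w ≡ w' [MOD M] := (Nat.modEq_iff_dvd).mpr h1
    rw [← Nat.div_add_mod w M, ← Nat.div_add_mod w' M, he, h2]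
  rw [← sum_filter_add_sum_filter_not _ (fun w : ℕ => w < M)]
  have hA : ∑ w ∈ ((Icc 1 X).filter
      (fun w : ℕ => (M : ℤ) ∣ (w : ℤ) - ρ ∧ g ≤ 3 * w ^ 2)).filter (fun w : ℕ => w < M),
      (1 : ℝ) / w ≤ 2 / √g := by
    have hcard : #(((Icc 1 X).filter
      (fun w : ℕ => (M : ℤ) ∣ (w : ℤ) - ρ ∧ g ≤ 3 * w ^ 2)).filter (fun w : ℕ => w < M)) ≤ 1 := by
      rw [card_le_one]
      intro w hw w' hw'
      simp only [mem_filter, mem_Icc] at hw hw'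
      refine inj w w' hw.1.2.1 hw'.1.2.1 ?_
      rw [Nat.div_eq_of_lt hw.2, Nat.div_eq_of_lt hw'.2]
    refine (sum_le_card_nsmul _ _ (2 / √(g : ℝ)) ?_).trans ?_
    · intro w hw
      simp only [mem_filter, mem_Icc] at hw
      have hw0 : (0 : ℝ) < w := by exact_mod_cast hw.1.1.1
      rw [div_le_div_iff₀ hw0 hsg, one_mul, Real.sqrt_le_left (by positivity)]
      have : (g : ℝ) ≤ 3 * w ^ 2 := by exact_mod_cast hw.1.2.2
      nlinarith
    · rw [nsmul_eq_mul]
      have : ((#(((Icc 1 X).filter (fun w : ℕ => (M : ℤ) ∣ (w : ℤ) - ρ ∧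
        g ≤ 3 * w ^ 2)).filter (fun w : ℕ => w < M)) : ℕ) : ℝ) ≤ 1 := by exact_mod_cast hcard
      exact mul_le_of_le_one_left (by positivity) this
  have hB : ∑ w ∈ ((Icc 1 X).filter
      (fun w : ℕ => (M : ℤ) ∣ (w : ℤ) - ρ ∧ g ≤ 3 * w ^ 2)).filter (fun w : ℕ => ¬ w < M),
      (1 : ℝ) / w ≤ (1 + Real.log X) / √g := by
    set T := ((Icc 1 X).filter
      (fun w : ℕ => (M : ℤ) ∣ (w : ℤ) - ρ ∧ g ≤ 3 * w ^ 2)).filter (fun w : ℕ => ¬ w < M) with hT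
    have hmemT : ∀ w ∈ T, 1 ≤ w ∧ w ≤ X ∧ (M : ℤ) ∣ (w : ℤ) - ρ ∧ M ≤ w := by
      intro w hw
      simp only [hT, mem_filter, mem_Icc, not_lt] at hw
      exact ⟨hw.1.1.1, hw.1.1.2, hw.1.2.1, hw.2⟩
    calc ∑ w ∈ T, (1 : ℝ) / w ≤ ∑ w ∈ T, (1 / (M : ℝ)) * (((w / M : ℕ) : ℝ))⁻¹ := by
          refine sum_le_sum fun w hw => ?_
          obtain ⟨h1, h2, h3, h4⟩ := hmemT w hw
          have h5 : 0 < w / M := Nat.div_pos h4 hM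
          have h5' : (0 : ℝ) < ((w / M : ℕ) : ℝ) := by exact_mod_cast h5
          have hM' : (0 : ℝ) < M := by exact_mod_cast hM
          rw [one_div, one_div, ← mul_inv]
          apply inv_anti₀ (by positivity)
          exact_mod_cast Nat.mul_div_le w M
      _ = (1 / (M : ℝ)) * ∑ i ∈ T.image (· / M), ((i : ℕ) : ℝ)⁻¹ := by
          rw [← mul_sum, sum_image]
          intro w hw w' hw' h
          exact inj w w' (hmemT w hw).2.2.1 (hmemT w' hw').2.2.1 h
      _ ≤ (1 / (M : ℝ)) * ∑ i ∈ Icc 1 X, ((i : ℕ) : ℝ)⁻¹ := by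
          gcongr
          intro i hi
          obtain ⟨w, hw, rfl⟩ := mem_image.mp hi
          obtain ⟨h1, h2, h3, h4⟩ := hmemT w hw
          exact mem_Icc.mpr ⟨Nat.div_pos h4 hM, (Nat.div_le_self _ _).trans h2⟩
      _ ≤ (1 / (M : ℝ)) * (1 + Real.log X) := by
          gcongr
          have := harmonic_le_one_add_log X
          rw [harmonic_eq_sum_Icc] at this
          push_cast at this
          exact this
      _ ≤ (1 / √g) * (1 + Real.log X) := by gcongr
      _ = _ := by ring
  calc _ ≤ 2 / √g + (1 + Real.log X) / √(g : ℝ) := add_le_add hA hB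
    _ = _ := by ring

/-- With a = gcd(A, g), the quotient g/a is prime to A/a and so divides B. -/
theorem exists_divisor_splitting {g : ℕ} (hg : 0 < g) {A B : ℤ} (h : (g : ℤ) ∣ A * B) :
    ∃ a ∈ g.divisors, (a : ℤ) ∣ A ∧ ((g / a : ℕ) : ℤ) ∣ B := by
  refine ⟨Nat.gcd A.natAbs g, ?_, ?_, ?_⟩
  · exact Nat.mem_divisors.mpr ⟨Nat.gcd_dvd_right _ _, hg.ne'⟩
  · rw [Int.natCast_dvd]
    exact Nat.gcd_dvd_left _ _
  · rw [Int.natCast_dvd]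
    have h1 : g ∣ A.natAbs * B.natAbs := by
      rw [← Int.natAbs_mul]
      exact Int.natCast_dvd.mp h
    have hpos : 0 < Nat.gcd A.natAbs g := Nat.gcd_pos_of_pos_right _ hg
    have hcop := Nat.coprime_div_gcd_div_gcd hpos
    refine (hcop.symm).dvd_of_dvd_mul_left ?_
    rw [Nat.div_mul_right_comm (Nat.gcd_dvd_left _ _)]
    exact Nat.div_dvd_div (Nat.gcd_dvd_right _ _) h1

theorem sum_le_sum_filter_of_cover {ι κ : Type*} {s : Finset ι} {t : Finset κ} {f : ι → ℝ}
    (hf : ∀ x ∈ s, 0 ≤ f x) {P : κ → ι → Prop} [∀ i, DecidablePred (P i)]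
    (h : ∀ x ∈ s, ∃ i ∈ t, P i x) : ∑ x ∈ s, f x ≤ ∑ i ∈ t, ∑ x ∈ s.filter (P i), f x := by
  simp only [sum_filter]
  rw [sum_comm]
  refine sum_le_sum fun x hx => ?_
  obtain ⟨i, hi, hP⟩ := h x hx
  have h1 := single_le_sum (f := fun i => if P i x then f x else 0) (s := t)
    (fun j _ => by
      split_ifs
      · exact hf x hx
      · exact le_rfl) hi
  simpa [hP] using h1

/-- Relative to a fixed root w₀, g divides (w - w₀)(w + w₀) and splits as a · (g/a). The larger
factor is at least √g, so each divisor a confines w to one class of modulus at least √g. -/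
theorem sum_inv_roots_le {g X : ℕ} (hg : 0 < g) (c : ℤ) :
    ∑ w ∈ (Icc 1 X).filter (fun w : ℕ => (g : ℤ) ∣ (w : ℤ) ^ 2 + c ∧ g ≤ 3 * w ^ 2),
      (1 : ℝ) / w ≤ #g.divisors * ((3 + Real.log X) / √g) := by
  have hlogX : 0 ≤ Real.log X := Real.log_natCast_nonneg X
  set T := (Icc 1 X).filter (fun w : ℕ => (g : ℤ) ∣ (w : ℤ) ^ 2 + c ∧ g ≤ 3 * w ^ 2) with hT
  rcases T.eq_empty_or_nonempty with h0 | ⟨w₀, hw₀⟩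
  · rw [h0, sum_empty]
    positivity
  have hw₀' := (mem_filter.mp hw₀).2.1
  have hcover : ∀ w ∈ T, ∃ a ∈ g.divisors,
      (a : ℤ) ∣ (w : ℤ) - w₀ ∧ ((g / a : ℕ) : ℤ) ∣ (w : ℤ) - (-w₀) := by
    intro w hw
    have hw' := (mem_filter.mp hw).2.1
    apply exists_divisor_splitting hg
    rw [show ((w : ℤ) - w₀) * ((w : ℤ) - (-w₀)) = (w ^ 2 + c) - (w₀ ^ 2 + c) by ring]
    exact dvd_sub hw' hw₀'
  calc ∑ w ∈ T, (1 : ℝ) / w ≤ ∑ a ∈ g.divisors, ∑ w ∈ T.filter fun w : ℕ =>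
        (a : ℤ) ∣ (w : ℤ) - w₀ ∧ ((g / a : ℕ) : ℤ) ∣ (w : ℤ) - (-w₀), (1 : ℝ) / w :=
        sum_le_sum_filter_of_cover (fun _ _ => by positivity) hcover
    _ ≤ ∑ a ∈ g.divisors, ((3 + Real.log X) / √g) := by
        refine sum_le_sum fun a ha => ?_
        have hag := Nat.div_mul_cancel (Nat.dvd_of_mem_divisors ha)
        have key : ∃ M : ℕ, ∃ ρ : ℤ, g ≤ M * M ∧ ∀ w : ℕ,
            (a : ℤ) ∣ (w : ℤ) - w₀ ∧ ((g / a : ℕ) : ℤ) ∣ (w : ℤ) - (-w₀) →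
              (M : ℤ) ∣ (w : ℤ) - ρ := by
          rcases le_total a (g / a) with h | h
          · refine ⟨g / a, -w₀, ?_, fun w hw => hw.2⟩
            conv_lhs => rw [← hag]
            exact Nat.mul_le_mul_left _ h
          · refine ⟨a, w₀, ?_, fun w hw => hw.1⟩
            conv_lhs => rw [← hag]
            exact Nat.mul_le_mul_right _ h
        obtain ⟨M, ρ, hM, hw⟩ := key
        refine le_trans (sum_le_sum_of_subset_of_nonneg ?_ fun _ _ _ => by positivity)
          (sum_inv_residue_class_le hg hM ρ)
        intro w hw'
        simp only [hT, mem_filter] at hw' ⊢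
        exact ⟨hw'.1.1, hw w hw'.2, hw'.1.2.2⟩
    _ = _ := by rw [sum_const, nsmul_eq_mul]

end RootSums

/-! ### The number of representations as a sum of two squares. -/

section SumsOfTwoSquares

/-- With c = yz' - zy', the identity c² + (yy' + zz')² = n² gives |c| < n, so n ∣ 2c leaves c = 0 or
2|c| = n. The latter would make √3 rational; the former makes two primitive vectors proportional,
hence equal. -/
theorem eq_of_sq_add_sq_of_dvd_cross {n y z y' z' : ℕ} (hy : 0 < y) (hz : 0 < z) (hy' : 0 < y')
    (hz' : 0 < z') (h : y ^ 2 + z ^ 2 = n) (h' : y' ^ 2 + z' ^ 2 = n) (hc : y.Coprime z)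
    (hc' : y'.Coprime z') (hd : (n : ℤ) ∣ 2 * ((y : ℤ) * z' - z * y')) : y = y' ∧ z = z' := by
  have hn : 0 < n := by rw [← h]; positivity
  set c : ℤ := (y : ℤ) * z' - z * y' with hcdef
  have hid : c ^ 2 + ((y : ℤ) * y' + z * z') ^ 2 = (n : ℤ) ^ 2 := by
    have e1 : (y : ℤ) ^ 2 + z ^ 2 = n := by exact_mod_cast h
    have e2 : (y' : ℤ) ^ 2 + z' ^ 2 = n := by exact_mod_cast h'
    calc _ = ((y : ℤ) ^ 2 + z ^ 2) * ((y' : ℤ) ^ 2 + z' ^ 2) := by rw [hcdef]; ring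
      _ = _ := by rw [e1, e2]; ring
  have hpos : (0 : ℤ) < (y : ℤ) * y' + z * z' := by positivity
  have hlt : |c| < n := by
    rw [← sq_lt_sq₀ (abs_nonneg _) (by positivity), sq_abs]
    nlinarith
  have hc0 : c = 0 := by
    by_contra hne
    obtain ⟨m, hm⟩ := hd
    have hm' : |m| < 2 := by
      have h1 : (n : ℤ) * |m| < n * 2 := by
        calc (n : ℤ) * |m| = |(n : ℤ) * m| := by rw [abs_mul, Nat.abs_cast]
          _ = 2 * |c| := by rw [← hm, abs_mul]; rfl
          _ < n * 2 := by linarith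
      exact lt_of_mul_lt_mul_left h1 (by positivity)
    have hm0 : m ≠ 0 := by
      rintro rfl
      exact hne (by linarith [hm])
    have hm2 : m ^ 2 = 1 := by
      rw [← sq_abs]
      have : 0 < |m| := abs_pos.mpr hm0
      have : |m| = 1 := by omega
      rw [this]; rfl
    have h3 : 4 * ((y : ℤ) * y' + z * z') ^ 2 = 3 * n ^ 2 := by
      have : 4 * c ^ 2 = (n : ℤ) ^ 2 := by
        calc 4 * c ^ 2 = (2 * c) ^ 2 := by ring
          _ = (n : ℤ) ^ 2 * m ^ 2 := by rw [hm]; ring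
          _ = _ := by rw [hm2, mul_one]
      linarith
    have hirr : Irrational (√(3 : ℕ)) := Nat.Prime.irrational_sqrt Nat.prime_three
    apply hirr
    refine ⟨(2 * ((y : ℚ) * y' + z * z')) / n, ?_⟩
    symm
    rw [Real.sqrt_eq_iff_mul_self_eq (by positivity) (by positivity)]
    have h4 : 4 * ((y : ℝ) * y' + z * z') ^ 2 = 3 * n ^ 2 := by exact_mod_cast h3
    have hn' : (n : ℝ) ≠ 0 := by exact_mod_cast hn.ne'
    push_cast
    field_simp
    linarith
  have h5 : y * z' = z * y' := by
    have : (y : ℤ) * z' = z * y' := by linarith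
    exact_mod_cast this
  have hyy : y ∣ y' := hc.dvd_of_dvd_mul_left (Dvd.intro _ h5)
  have hyy' : y' ∣ y := hc'.dvd_of_dvd_mul_right (Dvd.intro_left _ h5.symm)
  have e : y = y' := Nat.dvd_antisymm hyy hyy'
  refine ⟨e, ?_⟩
  subst e
  rw [mul_comm] at h5
  exact (Nat.eq_of_mul_eq_mul_right hy h5).symm

/-- For a fixed representation (y₀, z₀), n divides (yz₀ - zy₀)(yz₀ + zy₀), which attaches to (y, z)
a divisor a of n. If two representations share a, then a and n/a both divide yz' - zy' while gcd(a,
n/a) ∣ 2, so n ∣ 2(yz' - zy'). -/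
theorem card_primitive_sq_add_sq_le (N : ℕ) {n : ℕ} (hn : 0 < n) :
    #((Icc 1 N ×ˢ Icc 1 N).filter fun t : ℕ × ℕ => t.1 ^ 2 + t.2 ^ 2 = n ∧ t.1.Coprime t.2) ≤
      #n.divisors := by
  set T := (Icc 1 N ×ˢ Icc 1 N).filter fun t : ℕ × ℕ => t.1 ^ 2 + t.2 ^ 2 = n ∧ t.1.Coprime t.2
    with hT
  have hmem : ∀ t ∈ T, 0 < t.1 ∧ 0 < t.2 ∧ t.1 ^ 2 + t.2 ^ 2 = n ∧ t.1.Coprime t.2 := by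
    intro t ht
    simp only [hT, mem_filter, mem_product, mem_Icc] at ht
    exact ⟨ht.1.1.1, ht.1.2.1, ht.2⟩
  rcases T.eq_empty_or_nonempty with h0 | ⟨⟨y₀, z₀⟩, ht₀⟩
  · rw [h0]
    simp
  obtain ⟨hy₀, hz₀, hn₀, hc₀⟩ := hmem _ ht₀
  simp only at hy₀ hz₀ hn₀ hc₀
  have hsplit : ∀ t ∈ T, ∃ a ∈ n.divisors, (a : ℤ) ∣ (t.1 : ℤ) * z₀ - t.2 * y₀ ∧
      ((n / a : ℕ) : ℤ) ∣ (t.1 : ℤ) * z₀ + t.2 * y₀ := by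
    rintro ⟨y, z⟩ ht
    obtain ⟨hy, hz, hyz, hc⟩ := hmem _ ht
    simp only at hy hz hyz hc ⊢
    apply exists_divisor_splitting hn
    have e1 : (y : ℤ) ^ 2 + z ^ 2 = n := by exact_mod_cast hyz
    have e2 : (y₀ : ℤ) ^ 2 + z₀ ^ 2 = n := by exact_mod_cast hn₀
    refine ⟨(y : ℤ) ^ 2 - y₀ ^ 2, ?_⟩
    linear_combination (-(y₀ : ℤ) ^ 2) * e1 + (y : ℤ) ^ 2 * e2
  choose! a ha hadvd using hsplit
  refine card_le_card_of_injOn a ha ?_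
  rintro ⟨y, z⟩ ht ⟨y', z'⟩ ht' heq
  have h1 := hadvd _ ht
  have h2 := hadvd _ ht'
  rw [← heq] at h2
  set b := a (y, z)
  have hb : b ∣ n := Nat.dvd_of_mem_divisors (ha _ ht)
  obtain ⟨b', hb'⟩ := hb
  have hb0 : 0 < b := Nat.pos_of_mem_divisors (ha _ ht)
  have hnb : n / b = b' := by rw [hb', Nat.mul_div_cancel_left _ hb0]
  rw [hnb] at h1 h2
  simp only at h1 h2
  obtain ⟨hy, hz, hyz, hc⟩ := hmem _ ht
  obtain ⟨hy', hz', hyz', hc'⟩ := hmem _ ht'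
  simp only at hy hz hyz hc hy' hz' hyz' hc'
  have copn : ∀ y z : ℕ, y ^ 2 + z ^ 2 = n → y.Coprime z → n.Coprime y ∧ n.Coprime z := by
    intro y z h hc
    subst h
    constructor
    · rw [sq y, Nat.coprime_mul_right_add_left]
      exact (hc.pow_right 2).symm
    · rw [sq z, Nat.coprime_add_mul_right_left]
      exact hc.pow_left 2
  have hz₀n := (copn y₀ z₀ hn₀ hc₀).2
  have hyn := (copn y z hyz hc).1
  have cop : ∀ e x : ℕ, e ∣ n → n.Coprime x → IsCoprime (e : ℤ) x := fun e x he hx =>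
    Nat.isCoprime_iff_coprime.mpr (hx.coprime_dvd_left he)
  have hbn : b ∣ n := ⟨b', hb'⟩
  have hb'n : b' ∣ n := ⟨b, by rw [hb', mul_comm]⟩
  have d1 : (b : ℤ) ∣ (y : ℤ) * z' - z * y' := by
    refine (cop b z₀ hbn hz₀n).dvd_of_dvd_mul_left ?_
    rw [show (z₀ : ℤ) * ((y : ℤ) * z' - z * y') =
      z' * ((y : ℤ) * z₀ - z * y₀) - z * ((y' : ℤ) * z₀ - z' * y₀) by ring]
    exact dvd_sub (Dvd.dvd.mul_left h1.1 _) (Dvd.dvd.mul_left h2.1 _)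
  have d2 : (b' : ℤ) ∣ (y : ℤ) * z' - z * y' := by
    refine (cop b' z₀ hb'n hz₀n).dvd_of_dvd_mul_left ?_
    rw [show (z₀ : ℤ) * ((y : ℤ) * z' - z * y') =
      z' * ((y : ℤ) * z₀ + z * y₀) - z * ((y' : ℤ) * z₀ + z' * y₀) by ring]
    exact dvd_sub (Dvd.dvd.mul_left h1.2 _) (Dvd.dvd.mul_left h2.2 _)
  have hgcd : (Int.gcd b b' : ℤ) ∣ 2 := by
    set e := Int.gcd b b'
    have he1 : (e : ℤ) ∣ b := Int.gcd_dvd_left _ _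
    have he2 : (e : ℤ) ∣ b' := Int.gcd_dvd_right _ _
    have hen : e ∣ n := (by exact_mod_cast he1 : e ∣ b).trans hbn
    have h3 : (e : ℤ) ∣ 2 * ((y : ℤ) * z₀) := by
      have := dvd_add (he1.trans h1.1) (he2.trans h1.2)
      rw [show (y : ℤ) * z₀ - z * y₀ + (y * z₀ + z * y₀) = 2 * ((y : ℤ) * z₀) by ring] at this
      exact this
    exact ((cop e y hen hyn).mul_right (cop e z₀ hen hz₀n)).dvd_of_dvd_mul_right h3
  have hfin : (n : ℤ) ∣ 2 * ((y : ℤ) * z' - z * y') := by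
    have hl : (Int.lcm b b' : ℤ) ∣ (y : ℤ) * z' - z * y' := Int.coe_lcm_dvd d1 d2
    have hnl : (n : ℤ) = Int.gcd b b' * Int.lcm b b' := by
      have := Int.gcd_mul_lcm (b : ℤ) b'
      rw [Int.natAbs_natCast, Int.natAbs_natCast, ← hb'] at this
      exact_mod_cast this.symm
    rw [hnl]
    exact mul_dvd_mul hgcd hl
  have := eq_of_sq_add_sq_of_dvd_cross hy hz hy' hz' hyz hyz' hc hc' hfin
  exact Prod.ext this.1 this.2

/-- Sorted by e = gcd(y, z), a divisor of n, the representations become primitive ones of n / e². -/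
theorem card_sq_add_sq_le (N : ℕ) {n : ℕ} (hn : 0 < n) :
    #((Icc 1 N ×ˢ Icc 1 N).filter fun t : ℕ × ℕ => t.1 ^ 2 + t.2 ^ 2 = n) ≤ #n.divisors ^ 2 := by
  set T := (Icc 1 N ×ˢ Icc 1 N).filter fun t : ℕ × ℕ => t.1 ^ 2 + t.2 ^ 2 = n with hT
  have hmem : ∀ t ∈ T, (1 ≤ t.1 ∧ t.1 ≤ N) ∧ (1 ≤ t.2 ∧ t.2 ≤ N) ∧ t.1 ^ 2 + t.2 ^ 2 = n := by
    intro t ht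
    simp only [hT, mem_filter, mem_product, mem_Icc] at ht
    exact ⟨ht.1.1, ht.1.2, ht.2⟩
  have hgcd : ∀ t ∈ T, t.1.gcd t.2 ^ 2 ∣ n := by
    intro t ht
    rw [← (hmem t ht).2.2]
    exact dvd_add (pow_dvd_pow_of_dvd (Nat.gcd_dvd_left _ _) 2)
      (pow_dvd_pow_of_dvd (Nat.gcd_dvd_right _ _) 2)
  have hmaps : ∀ t ∈ T, t.1.gcd t.2 ∈ n.divisors := fun t ht =>
    Nat.mem_divisors.mpr ⟨(dvd_pow_self _ two_ne_zero).trans (hgcd t ht), hn.ne'⟩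
  rw [card_eq_sum_card_fiberwise hmaps, sq, ← smul_eq_mul]
  refine sum_le_card_nsmul _ _ _ fun e he => ?_
  have he0 : 0 < e := Nat.pos_of_mem_divisors he
  rcases (T.filter fun t => t.1.gcd t.2 = e).eq_empty_or_nonempty with h0 | ⟨t₀, ht₀⟩
  · rw [h0]
    simp
  have hen : e ^ 2 ∣ n := by
    have := hgcd t₀ (mem_filter.mp ht₀).1
    rwa [(mem_filter.mp ht₀).2] at this
  have hq : 0 < n / e ^ 2 := Nat.div_pos (Nat.le_of_dvd hn hen) (by positivity)
  refine le_trans ?_ ((card_primitive_sq_add_sq_le N hq).trans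
    (card_le_card (Nat.divisors_subset_of_dvd hn.ne' (Nat.div_dvd_of_dvd hen))))
  refine card_le_card_of_injOn (fun t => (t.1 / e, t.2 / e)) ?_ ?_
  · intro t ht
    obtain ⟨ht1, ht2⟩ := mem_filter.mp ht
    obtain ⟨⟨h1, h2⟩, ⟨h3, h4⟩, h5⟩ := hmem t ht1
    have hd1 : e ∣ t.1 := ht2 ▸ Nat.gcd_dvd_left _ _
    have hd2 : e ∣ t.2 := ht2 ▸ Nat.gcd_dvd_right _ _
    simp only [coe_filter, mem_product, mem_Icc, Set.mem_ofPred_eq]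
    refine ⟨⟨⟨Nat.div_pos (Nat.le_of_dvd h1 hd1) he0, (Nat.div_le_self _ _).trans h2⟩,
      ⟨Nat.div_pos (Nat.le_of_dvd h3 hd2) he0, (Nat.div_le_self _ _).trans h4⟩⟩, ?_, ?_⟩
    · rw [← h5]
      obtain ⟨a, ha⟩ := hd1
      obtain ⟨b, hb⟩ := hd2
      rw [ha, hb, Nat.mul_div_cancel_left _ he0, Nat.mul_div_cancel_left _ he0, mul_pow, mul_pow,
        ← mul_add, Nat.mul_div_cancel_left _ (by positivity)]
    · have := Nat.coprime_div_gcd_div_gcd (m := t.1) (n := t.2) (by rw [ht2]; exact he0)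
      rwa [ht2] at this
  · intro t ht t' ht' h
    have ht2 := (mem_filter.mp ht).2
    have ht2' := (mem_filter.mp ht').2
    have hd1 : e ∣ t.1 := ht2 ▸ Nat.gcd_dvd_left _ _
    have hd2 : e ∣ t.2 := ht2 ▸ Nat.gcd_dvd_right _ _
    have hd1' : e ∣ t'.1 := ht2' ▸ Nat.gcd_dvd_left _ _
    have hd2' : e ∣ t'.2 := ht2' ▸ Nat.gcd_dvd_right _ _
    simp only [Prod.mk.injEq] at h
    refine Prod.ext ?_ ?_
    · rw [← Nat.div_mul_cancel hd1, h.1, Nat.div_mul_cancel hd1']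
    · rw [← Nat.div_mul_cancel hd2, h.2, Nat.div_mul_cancel hd2']

end SumsOfTwoSquares

/-- The number of triples in `[1, N] ^ 3` with `q ∣ x ^ 2 + y ^ 2 + z ^ 2 + k`. -/
def divCount (N q : ℕ) (k : ℤ) : ℕ :=
  #((Icc 1 N ×ˢ Icc 1 N ×ˢ Icc 1 N).filter fun t : ℕ × ℕ × ℕ =>
    (q : ℤ) ∣ (t.1 : ℤ) ^ 2 + (t.2.1 : ℤ) ^ 2 + (t.2.2 : ℤ) ^ 2 + k)

/-! ### Finite Fourier expansion of the count in a box. -/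

section Fourier

variable {q : ℕ} [NeZero q]

/-- The Fourier transform of an interval. -/
noncomputable def intervalSum (q N : ℕ) [NeZero q] (u : ZMod q) : ℂ :=
  ∑ n ∈ Icc 1 N, ZMod.stdAddChar (-(u * (n : ZMod q)))

theorem sum_intervalSum_mul (N : ℕ) (F : ZMod q → ℂ) :
    ∑ u, intervalSum q N u * ∑ x, F x * ZMod.stdAddChar (u * x) =
      q * ∑ n ∈ Icc 1 N, F (n : ZMod q) := by
  unfold intervalSum
  simp only [sum_mul_sum]
  rw [sum_comm, mul_sum]
  refine sum_congr rfl fun n _ => ?_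
  rw [sum_comm]
  have h1 : ∀ x : ZMod q, ∑ u : ZMod q, ZMod.stdAddChar (-(u * (n : ZMod q))) *
      (F x * ZMod.stdAddChar (u * x)) = if x = n then q * F x else 0 := by
    intro x
    have h2 : ∀ u : ZMod q, ZMod.stdAddChar (-(u * (n : ZMod q))) *
        (F x * ZMod.stdAddChar (u * x)) = F x * ZMod.stdAddChar (u * (x - (n : ZMod q))) := by
      intro u
      rw [mul_left_comm, ← AddChar.map_add_eq_mul]
      congr 2
      ring
    rw [sum_congr rfl fun u _ => h2 u, ← mul_sum,
      AddChar.sum_mulShift _ (ZMod.isPrimitive_stdAddChar _), ZMod.card]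
    simp only [sub_eq_zero]
    split_ifs <;> push_cast <;> ring
  rw [sum_congr rfl fun x _ => h1 x]
  simp

/-- The inversion `sum_intervalSum_mul` is applied to one variable at a time, innermost first. -/
theorem divCount_eq_sum (N : ℕ) (k : ℤ) :
    (q : ℂ) ^ 3 * divCount N q k = ∑ t : ZMod q × ZMod q × ZMod q,
      expSum q k t.1 t.2.1 t.2.2 *
        (intervalSum q N t.1 * intervalSum q N t.2.1 * intervalSum q N t.2.2) := by
  obtain ⟨F, hF⟩ : ∃ F : ZMod q → ZMod q → ZMod q → ℂ, F = fun x y z =>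
    if x ^ 2 + y ^ 2 + z ^ 2 + (k : ZMod q) = 0 then 1 else 0 := ⟨_, rfl⟩
  have hexp : ∀ u v w : ZMod q, expSum q k u v w =
      ∑ x, (∑ y, (∑ z, F x y z * ZMod.stdAddChar (w * z)) * ZMod.stdAddChar (v * y)) *
        ZMod.stdAddChar (u * x) := by
    intro u v w
    unfold expSum
    refine sum_congr rfl fun x _ => ?_
    rw [sum_mul]
    refine sum_congr rfl fun y _ => ?_
    rw [sum_mul, sum_mul]
    refine sum_congr rfl fun z _ => ?_
    rw [hF]
    simp only
    split_ifs
    · rw [AddChar.map_add_eq_mul, AddChar.map_add_eq_mul]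
      ring
    · simp
  have hcount : (divCount N q k : ℂ) =
      ∑ x ∈ Icc 1 N, ∑ y ∈ Icc 1 N, ∑ z ∈ Icc 1 N, F x y z := by
    unfold divCount
    rw [card_filter, sum_product]
    push_cast
    refine sum_congr rfl fun x _ => ?_
    rw [sum_product]
    refine sum_congr rfl fun y _ => sum_congr rfl fun z _ => ?_
    rw [hF]
    have hiff : ((q : ℤ) ∣ (x : ℤ) ^ 2 + (y : ℤ) ^ 2 + (z : ℤ) ^ 2 + k) ↔
        (x : ZMod q) ^ 2 + (y : ZMod q) ^ 2 + (z : ZMod q) ^ 2 + (k : ZMod q) = 0 := by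
      rw [← ZMod.intCast_zmod_eq_zero_iff_dvd]
      push_cast
      rfl
    simp [hiff]
  set W := intervalSum q N with hW
  have hz : ∀ x y, ∑ w, W w * ∑ z, F x y z * ZMod.stdAddChar (w * z) =
      q * ∑ z ∈ Icc 1 N, F x y z := fun x y => sum_intervalSum_mul N (F x y)
  have hy : ∀ x, ∑ v, W v * ∑ y, (q * ∑ z ∈ Icc 1 N, F x y (z : ZMod q)) *
      ZMod.stdAddChar (v * y) = q * ∑ y ∈ Icc 1 N, (q * ∑ z ∈ Icc 1 N, F x y z) :=
    fun x => sum_intervalSum_mul N (fun y => q * ∑ z ∈ Icc 1 N, F x y z)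
  have hx : ∑ u, W u * ∑ x, (q * ∑ y ∈ Icc 1 N, (q * ∑ z ∈ Icc 1 N, F x (y : ZMod q)
      (z : ZMod q))) * ZMod.stdAddChar (u * x) =
      q * ∑ x ∈ Icc 1 N, (q * ∑ y ∈ Icc 1 N, (q * ∑ z ∈ Icc 1 N, F x y z)) :=
    sum_intervalSum_mul N (fun x => q * ∑ y ∈ Icc 1 N, (q * ∑ z ∈ Icc 1 N, F x y z))
  have hlhs : (q : ℂ) ^ 3 * divCount N q k =
      q * ∑ x ∈ Icc 1 N, (q * ∑ y ∈ Icc 1 N, (q * ∑ z ∈ Icc 1 N, F x y z)) := by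
    rw [hcount]
    simp only [← mul_sum]
    ring
  rw [hlhs, ← hx, Fintype.sum_prod_type]
  refine sum_congr rfl fun u _ => ?_
  rw [Fintype.sum_prod_type]
  simp only [hexp, ← hy]
  rw [mul_sum]
  simp only [sum_mul, mul_sum, ← hz]
  rw [sum_comm]
  refine sum_congr rfl fun v _ => ?_
  conv_rhs => rw [sum_comm]
  refine sum_congr rfl fun x _ => ?_
  conv_rhs => rw [sum_comm]
  refine sum_congr rfl fun y _ => ?_
  refine sum_congr rfl fun w _ => ?_
  refine sum_congr rfl fun z _ => ?_
  ring

theorem norm_intervalSum_le (N : ℕ) (u : ZMod q) : ‖intervalSum q N u‖ ≤ N := by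
  unfold intervalSum
  refine (norm_sum_le _ _).trans ?_
  simp

/-- A geometric series whose ratio z has |z - 1| = 2|sin(πm/q)| ≥ 4|m|/q, since |m| ≤ q/2. -/
theorem norm_intervalSum_le_div (N : ℕ) {u : ZMod q} (hu : u ≠ 0) :
    ‖intervalSum q N u‖ ≤ q / |(u.valMinAbs : ℝ)| := by
  set m := u.valMinAbs with hm
  have hm0 : m ≠ 0 := by rwa [hm, Ne, ZMod.valMinAbs_eq_zero]
  have hmR : 0 < |(m : ℝ)| := abs_pos.mpr (by exact_mod_cast hm0)
  have hq : (0 : ℝ) < q := by exact_mod_cast NeZero.pos q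
  set z : ℂ := ZMod.stdAddChar (-u) with hz
  have hzn : ‖z‖ = 1 := AddChar.norm_apply _ _
  have hz1 : ‖z - 1‖ ≥ 4 * |(m : ℝ)| / q := by
    have h1 : z = Complex.exp (Complex.I * ((-(2 * Real.pi * m / q) : ℝ) : ℂ)) := by
      rw [hz, ← ZMod.coe_valMinAbs u, ← hm, ← Int.cast_neg, ZMod.stdAddChar_coe]
      congr 1
      push_cast
      ring
    rw [h1, Complex.norm_exp_I_mul_ofReal_sub_one, norm_mul, Real.norm_eq_abs, Real.norm_eq_abs]
    have hmq : 2 * |(m : ℝ)| ≤ q := by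
      have := ZMod.valMinAbs_mem_Ioc u
      rw [← hm] at this
      have h2 : 2 * |m| ≤ q := by
        rw [← abs_two, ← abs_mul, mul_comm, abs_le]
        exact ⟨this.1.le, this.2⟩
      exact_mod_cast h2
    have hab : |(-(2 * Real.pi * m / q) / 2 : ℝ)| = Real.pi * |(m : ℝ)| / q := by
      rw [show (-(2 * Real.pi * m / q) / 2 : ℝ) = -(Real.pi * m / q) by ring, abs_neg, abs_div,
        abs_mul, abs_of_pos Real.pi_pos, Nat.abs_cast]
    have h3 := Real.mul_abs_le_abs_sin (x := -(2 * Real.pi * m / q) / 2) (by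
      rw [hab, div_le_iff₀ hq]
      nlinarith [Real.pi_pos])
    rw [hab] at h3
    have h4 : 2 / Real.pi * (Real.pi * |(m : ℝ)| / q) = 2 * |(m : ℝ)| / q := by
      field_simp
    rw [h4] at h3
    rw [abs_two]
    calc 4 * |(m : ℝ)| / q = 2 * (2 * |(m : ℝ)| / q) := by ring
      _ ≤ _ := by gcongr
  have hpos : 0 < 4 * |(m : ℝ)| / q := by positivity
  have hne : z ≠ 1 := by
    intro h
    rw [h, sub_self, norm_zero] at hz1
    linarith
  have hsum : intervalSum q N u = (z ^ (N + 1) - z ^ 1) / (z - 1) := by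
    rw [← geom_sum_Ico hne (by omega)]
    unfold intervalSum
    have : Icc 1 N = Ico 1 (N + 1) := by
      ext
      simp
    rw [this]
    refine sum_congr rfl fun n _ => ?_
    rw [hz, ← AddChar.map_nsmul_eq_pow]
    congr 1
    rw [nsmul_eq_mul]
    ring
  rw [hsum, norm_div]
  have hnum : ‖z ^ (N + 1) - z ^ 1‖ ≤ 2 := by
    refine (norm_sub_le _ _).trans ?_
    rw [norm_pow, norm_pow, hzn]
    norm_num
  calc ‖z ^ (N + 1) - z ^ 1‖ / ‖z - 1‖ ≤ 2 / (4 * |(m : ℝ)| / q) := by gcongr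
    _ = (q / |(m : ℝ)|) / 2 := by field_simp; norm_num
    _ ≤ _ := half_le_self (by positivity)

end Fourier

/-! ### Averaging over the frequencies attached to a pair (j, g). -/

section WeightedSums

/-- An upper bound for the Fourier transform of an interval of length `N` modulo `q`. -/
noncomputable def freqWeight (N q : ℕ) (m : ℤ) : ℝ := if m = 0 then N else q / m.natAbs

theorem freqWeight_nonneg (N q : ℕ) (m : ℤ) : 0 ≤ freqWeight N q m := by
  unfold freqWeight
  split_ifs <;> positivity

theorem norm_intervalSum_le_freqWeight {q : ℕ} [NeZero q] (N : ℕ) (u : ZMod q) :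
    ‖intervalSum q N u‖ ≤ freqWeight N q u.valMinAbs := by
  by_cases h : u = 0
  · simpa [freqWeight, h] using norm_intervalSum_le N u
  · rw [freqWeight, if_neg (by rwa [ZMod.valMinAbs_eq_zero]), Nat.cast_natAbs, Int.cast_abs]
    exact norm_intervalSum_le_div N h

theorem sum_natAbs_le (q : ℕ) {G : ℕ → ℝ} (hG : ∀ n, 0 ≤ G n) :
    ∑ w ∈ (Icc (-(q : ℤ)) q).filter (· ≠ 0), G w.natAbs ≤ 2 * ∑ n ∈ Icc 1 q, G n := by
  have hmaps : ∀ w ∈ (Icc (-(q : ℤ)) q).filter (· ≠ 0), w.natAbs ∈ Icc 1 q := by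
    intro w hw
    simp only [mem_filter, mem_Icc] at hw ⊢
    omega
  rw [← sum_fiberwise_of_maps_to hmaps, mul_sum]
  refine sum_le_sum fun n _ => ?_
  rw [sum_congr rfl (g := fun _ => G n) (fun w hw => by rw [(mem_filter.mp hw).2]), sum_const,
    nsmul_eq_mul]
  refine mul_le_mul_of_nonneg_right ?_ (hG n)
  have : #(((Icc (-(q : ℤ)) q).filter (· ≠ 0)).filter fun w => w.natAbs = n) ≤ 2 := by
    refine (card_le_card (t := {(n : ℤ), -(n : ℤ)}) fun w hw => ?_).trans card_le_two
    have := (mem_filter.mp hw).2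
    simp only [mem_insert, mem_singleton]
    omega
  exact_mod_cast this

theorem sum_freqWeight_le (N q : ℕ) :
    ∑ u ∈ Icc (-(q : ℤ)) q, freqWeight N q u ≤ N + 2 * q * (1 + Real.log q) := by
  rw [← sum_filter_add_sum_filter_not _ (fun u : ℤ => u ≠ 0), add_comm]
  refine add_le_add ?_ ?_
  · have : (Icc (-(q : ℤ)) q).filter (fun u => ¬ u ≠ 0) = {0} := by
      ext u
      simp only [mem_filter, mem_Icc, mem_singleton, not_not]
      constructor
      · exact fun h => h.2
      · rintro rfl
        exact ⟨⟨by omega, by omega⟩, rfl⟩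
    rw [this, sum_singleton]
    simp [freqWeight]
  · calc _ = ∑ u ∈ (Icc (-(q : ℤ)) q).filter (· ≠ 0), (fun n : ℕ => (q : ℝ) * (n : ℝ)⁻¹) u.natAbs := by
          refine sum_congr rfl fun u hu => ?_
          rw [freqWeight, if_neg (mem_filter.mp hu).2, div_eq_mul_inv]
      _ ≤ 2 * ∑ n ∈ Icc 1 q, (q : ℝ) * (n : ℝ)⁻¹ :=
          sum_natAbs_le q (G := fun n : ℕ => (q : ℝ) * (n : ℝ)⁻¹) fun n => by positivity
      _ = 2 * q * ∑ n ∈ Icc 1 q, (n : ℝ)⁻¹ := by rw [← mul_sum]; ring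
      _ ≤ _ := by
        gcongr
        have := harmonic_le_one_add_log q
        rw [harmonic_eq_sum_Icc] at this
        push_cast at this
        exact this

/-- The condition on the largest coordinate of a frequency vector. -/
def LargeCoord (j g : ℕ) (c w : ℤ) : Prop :=
  w ≠ 0 ∧ (j : ℤ) ∣ w ∧ (j : ℤ) ^ 2 * g ∣ w ^ 2 + c ∧ (j : ℤ) ^ 2 * g ≤ 3 * w ^ 2

open Classical in
-- Writing w = jw' reduces to the roots w' of w'² + c modulo g with g ≤ 3w'². The gain 1/(j √g) is
-- exactly what offsets the factor j √g in `ExpSumBound`.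
theorem sum_freqWeight_largeCoord_le (N q : ℕ) {j g : ℕ} (hj : 0 < j) (hg : 0 < g) (c : ℤ) :
    ∑ w ∈ (Icc (-(q : ℤ)) q).filter (LargeCoord j g ((j : ℤ) ^ 2 * c)), freqWeight N q w ≤
      2 * (q / j) * (#g.divisors * ((3 + Real.log q) / √g)) := by
  set P : ℕ → Prop := fun n => j ∣ n ∧ (g : ℤ) ∣ ((n / j : ℕ) : ℤ) ^ 2 + c ∧ g ≤ 3 * (n / j) ^ 2
    with hP
  have hj2 : (j : ℤ) ^ 2 ≠ 0 := pow_ne_zero _ (by exact_mod_cast hj.ne')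
  have hPi : ∀ w : ℤ, LargeCoord j g ((j : ℤ) ^ 2 * c) w → P w.natAbs := by
    rintro w ⟨-, ⟨w', rfl⟩, h2, h3⟩
    rw [mul_pow, ← mul_add, mul_dvd_mul_iff_left hj2] at h2
    rw [mul_pow, mul_left_comm 3] at h3
    have h3' : (g : ℤ) ≤ 3 * w' ^ 2 := le_of_mul_le_mul_left h3 (by positivity)
    rw [hP]
    simp only [Int.natAbs_mul, Int.natAbs_natCast, Nat.mul_div_cancel_left _ hj]
    refine ⟨dvd_mul_right _ _, ?_, ?_⟩
    · rw [Int.natCast_natAbs, sq_abs]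
      exact h2
    · have : (g : ℤ) ≤ 3 * (w'.natAbs : ℤ) ^ 2 := by
        rw [Int.natCast_natAbs, sq_abs]
        exact h3'
      exact_mod_cast this
  calc _ ≤ ∑ w ∈ (Icc (-(q : ℤ)) q).filter (· ≠ 0),
        (fun n : ℕ => if P n then (q : ℝ) / n else 0) w.natAbs := by
        rw [sum_filter, sum_filter]
        refine sum_le_sum fun w _ => ?_
        by_cases h : LargeCoord j g ((j : ℤ) ^ 2 * c) w
        · rw [if_pos h, if_pos h.1]
          simp only
          rw [if_pos (hPi w h), freqWeight, if_neg h.1]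
        · rw [if_neg h]
          positivity
    _ ≤ 2 * ∑ n ∈ Icc 1 q, (if P n then (q : ℝ) / n else 0) :=
        sum_natAbs_le q (G := fun n : ℕ => if P n then (q : ℝ) / n else 0) fun n => by positivity
    _ = 2 * ∑ n ∈ (Icc 1 q).filter P, (q : ℝ) / n := by rw [sum_filter]
    _ ≤ 2 * ∑ n ∈ ((Icc 1 q).filter P).image (· / j), (q / j : ℝ) * (1 / n) := by
        rw [sum_image]
        · gcongr with n hn
          obtain ⟨h1, ⟨n', rfl⟩, -⟩ := mem_filter.mp hn
          rw [Nat.mul_div_cancel_left _ hj]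
          push_cast
          rw [div_mul_div_comm, mul_one]
        · intro n hn n' hn' h
          have h1 := (mem_filter.mp hn).2.1
          have h2 := (mem_filter.mp hn').2.1
          simp only at h
          rw [← Nat.div_mul_cancel h1, h, Nat.div_mul_cancel h2]
    _ ≤ 2 * ∑ n ∈ (Icc 1 q).filter (fun w : ℕ => (g : ℤ) ∣ (w : ℤ) ^ 2 + c ∧ g ≤ 3 * w ^ 2),
          (q / j : ℝ) * (1 / n) := by
        gcongr
        intro m hm
        obtain ⟨n, hn, rfl⟩ := mem_image.mp hm
        obtain ⟨h1, h2, h3, h4⟩ := mem_filter.mp hn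
        have h5 := mem_Icc.mp h1
        refine mem_filter.mpr ⟨mem_Icc.mpr ⟨?_, (Nat.div_le_self _ _).trans h5.2⟩, h3, h4⟩
        exact Nat.div_pos (Nat.le_of_dvd h5.1 h2) hj
    _ ≤ _ := by
        rw [← mul_sum, mul_assoc]
        gcongr
        exact sum_inv_roots_le hg c

/-- The frequencies to which a pair `j`, `g` of divisors is attached. -/
def FreqCond (j g : ℕ) (u v w : ℤ) : Prop :=
  (j : ℤ) ∣ u ∧ (j : ℤ) ∣ v ∧ (j : ℤ) ∣ w ∧ (j : ℤ) ^ 2 * g ∣ u ^ 2 + v ^ 2 + w ^ 2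

open Classical in
-- For a nonzero vector the largest coordinate w satisfies j² g ≤ u² + v² + w² ≤ 3w². It is summed
-- first, for the gain 1/(j √g), and the other two trivially; the factor 3 is for its position.
theorem sum_freqWeight_triple_le (N q : ℕ) {j g : ℕ} (hj : 0 < j) (hg : 0 < g) :
    ∑ t ∈ ((Icc (-(q : ℤ)) q ×ˢ Icc (-(q : ℤ)) q ×ˢ Icc (-(q : ℤ)) q).erase 0).filter
        (fun t => FreqCond j g t.1 t.2.1 t.2.2),
      freqWeight N q t.1 * freqWeight N q t.2.1 * freqWeight N q t.2.2 ≤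
      3 * ((N + 2 * q * (1 + Real.log q)) ^ 2 *
        (2 * (q / j) * (#g.divisors * ((3 + Real.log q) / √g)))) := by
  set B := Icc (-(q : ℤ)) q with hB
  set ω := freqWeight N q with hω
  have hω0 : ∀ m, 0 ≤ ω m := freqWeight_nonneg N q
  set I := 2 * ((q : ℝ) / j) * (#g.divisors * ((3 + Real.log q) / √g)) with hI
  set L := (N : ℝ) + 2 * q * (1 + Real.log q) with hL
  have hlog : 0 ≤ Real.log q := Real.log_natCast_nonneg q
  have hI0 : 0 ≤ I := by positivity
  set φ : ℤ → ℤ → ℤ → ℝ := fun u v w => if (j : ℤ) ∣ u ∧ (j : ℤ) ∣ v ∧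
    LargeCoord j g (u ^ 2 + v ^ 2) w then ω u * ω v * ω w else 0 with hφ
  have hφ0 : ∀ u v w, 0 ≤ φ u v w := by
    intro u v w
    simp only [hφ]
    split_ifs
    · exact mul_nonneg (mul_nonneg (hω0 _) (hω0 _)) (hω0 _)
    · exact le_rfl
  have hsum : ∑ u ∈ B, ∑ v ∈ B, ∑ w ∈ B, φ u v w ≤ L ^ 2 * I := by
    have hinner : ∀ u v, ∑ w ∈ B, φ u v w ≤ ω u * ω v * I := by
      intro u v
      by_cases huv : (j : ℤ) ∣ u ∧ (j : ℤ) ∣ v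
      · obtain ⟨⟨u', rfl⟩, ⟨v', rfl⟩⟩ := huv
        have := sum_freqWeight_largeCoord_le N q hj hg (u' ^ 2 + v' ^ 2)
        rw [show (j : ℤ) ^ 2 * (u' ^ 2 + v' ^ 2) = (j * u') ^ 2 + (j * v') ^ 2 by ring,
          sum_filter] at this
        refine le_trans (le_of_eq ?_)
          (mul_le_mul_of_nonneg_left this (mul_nonneg (hω0 (j * u')) (hω0 (j * v'))))
        rw [mul_sum]
        refine sum_congr rfl fun w _ => ?_
        simp only [hφ, dvd_mul_right, true_and]
        split_ifs <;> simp [hω]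
      · rw [sum_eq_zero]
        · exact mul_nonneg (mul_nonneg (hω0 _) (hω0 _)) hI0
        · intro w _
          simp only [hφ]
          rw [if_neg]
          exact fun h => huv ⟨h.1, h.2.1⟩
    have hω1 : ∑ u ∈ B, ω u ≤ L := sum_freqWeight_le N q
    have hωs : 0 ≤ ∑ u ∈ B, ω u := sum_nonneg fun _ _ => hω0 _
    calc _ ≤ ∑ u ∈ B, ∑ v ∈ B, ω u * ω v * I :=
          sum_le_sum fun u _ => sum_le_sum fun v _ => hinner u v
      _ = (∑ u ∈ B, ω u) ^ 2 * I := by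
          rw [sq, sum_mul_sum, sum_mul]
          simp only [sum_mul]
      _ ≤ L ^ 2 * I := by gcongr
  have hpoint : ∀ u v w : ℤ, ¬ (u = 0 ∧ v = 0 ∧ w = 0) → FreqCond j g u v w →
      ω u * ω v * ω w ≤ φ u v w + φ u w v + φ v w u := by
    rintro u v w hne ⟨h1, h2, h3, h4⟩
    have hpos : 0 < u ^ 2 + v ^ 2 + w ^ 2 := by
      by_contra hcon
      apply hne
      have hu := sq_nonneg u
      have hv := sq_nonneg v
      have hw := sq_nonneg w
      refine ⟨?_, ?_, ?_⟩ <;> rw [← sq_eq_zero_iff (M₀ := ℤ)] <;> omega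
    have hle := Int.le_of_dvd hpos h4
    have large : ∀ a b c : ℤ, (j : ℤ) ∣ c → a ^ 2 + b ^ 2 + c ^ 2 = u ^ 2 + v ^ 2 + w ^ 2 →
        a ^ 2 ≤ c ^ 2 → b ^ 2 ≤ c ^ 2 → LargeCoord j g (a ^ 2 + b ^ 2) c := by
      intro a b c hc he ha hb
      refine ⟨?_, hc, ?_, ?_⟩
      · rintro rfl
        nlinarith [sq_nonneg a, sq_nonneg b]
      · rw [show c ^ 2 + (a ^ 2 + b ^ 2) = a ^ 2 + b ^ 2 + c ^ 2 by ring, he]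
        exact h4
      · linarith
    have e1 := hφ0 u v w
    have e2 := hφ0 u w v
    have e3 := hφ0 v w u
    by_cases hA : u ^ 2 ≤ w ^ 2 ∧ v ^ 2 ≤ w ^ 2
    · have : φ u v w = ω u * ω v * ω w := by
        simp only [hφ]
        rw [if_pos ⟨h1, h2, large u v w h3 rfl hA.1 hA.2⟩]
      linarith
    by_cases hB : u ^ 2 ≤ v ^ 2 ∧ w ^ 2 ≤ v ^ 2
    · have : φ u w v = ω u * ω v * ω w := by
        simp only [hφ]
        rw [if_pos ⟨h1, h3, large u w v h2 (by ring) hB.1 hB.2⟩]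
        ring
      linarith
    · have hvw : v ^ 2 ≤ u ^ 2 ∧ w ^ 2 ≤ u ^ 2 := by
        by_contra hcon
        rcases le_total (w ^ 2) (v ^ 2) with h | h
        · exact hB ⟨by by_contra; exact hcon ⟨by linarith, by linarith⟩, h⟩
        · exact hA ⟨by by_contra; exact hcon ⟨by linarith, by linarith⟩, h⟩
      have : φ v w u = ω u * ω v * ω w := by
        simp only [hφ]
        rw [if_pos ⟨h2, h3, large v w u h1 (by ring) hvw.1 hvw.2⟩]
        ring
      linarith
  calc _ ≤ ∑ t ∈ ((B ×ˢ B ×ˢ B).erase 0).filter (fun t => FreqCond j g t.1 t.2.1 t.2.2),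
        (φ t.1 t.2.1 t.2.2 + φ t.1 t.2.2 t.2.1 + φ t.2.1 t.2.2 t.1) := by
        refine sum_le_sum ?_
        rintro ⟨u, v, w⟩ ht
        obtain ⟨h1, h2⟩ := mem_filter.mp ht
        refine hpoint u v w ?_ h2
        rintro ⟨rfl, rfl, rfl⟩
        exact (mem_erase.mp h1).1 rfl
    _ ≤ ∑ t ∈ B ×ˢ B ×ˢ B,
        (φ t.1 t.2.1 t.2.2 + φ t.1 t.2.2 t.2.1 + φ t.2.1 t.2.2 t.1) := by
        refine sum_le_sum_of_subset_of_nonneg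
          ((filter_subset _ _).trans (erase_subset _ _)) fun t _ _ => ?_
        exact add_nonneg (add_nonneg (hφ0 _ _ _) (hφ0 _ _ _)) (hφ0 _ _ _)
    _ = ∑ u ∈ B, ∑ v ∈ B, ∑ w ∈ B, φ u v w + ∑ u ∈ B, ∑ v ∈ B, ∑ w ∈ B, φ u w v +
        ∑ u ∈ B, ∑ v ∈ B, ∑ w ∈ B, φ v w u := by
        rw [sum_product]
        simp only [sum_product, sum_add_distrib]
    _ = ∑ u ∈ B, ∑ v ∈ B, ∑ w ∈ B, φ u v w + ∑ u ∈ B, ∑ v ∈ B, ∑ w ∈ B, φ u v w +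
        ∑ u ∈ B, ∑ v ∈ B, ∑ w ∈ B, φ u v w := by
        congr 1
        · congr 1
          exact sum_congr rfl fun u _ => sum_comm
        · rw [sum_comm]
          exact sum_congr rfl fun u _ => sum_comm
    _ ≤ _ := by linarith

end WeightedSums

/-! ### The error in the count for a single modulus. -/

section CountError

open Classical in
-- The zero frequency is the main term. The others are sorted by the pair (j, g) that `ExpSumBound`
-- attaches to them; there are at most τ(q)² pairs, and in each the factor j √g cancels.
theorem abs_divCount_sub_le {q : ℕ} [NeZero q] (N : ℕ) {k : ℤ} {K : ℝ} (hK : 0 ≤ K)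
    (h : ExpSumBound q k K) :
    |(divCount N q k : ℝ) - (N : ℝ) ^ 3 * (lam q k / (q : ℝ) ^ 3)| ≤
      24 * K * #q.divisors ^ 3 * (3 + Real.log q) ^ 3 * ((N + q) ^ 2 / q) := by
  have hq : (0 : ℝ) < q := by exact_mod_cast NeZero.pos q
  have hlog : 0 ≤ Real.log q := Real.log_natCast_nonneg q
  set ω := freqWeight N q with hω
  have hω0 : ∀ m, 0 ≤ ω m := freqWeight_nonneg N q
  set B := Icc (-(q : ℤ)) q with hB
  set L := (N : ℝ) + 2 * q * (1 + Real.log q) with hL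
  choose J G hJG hu hv hw hG hbound using h
  obtain ⟨F, hF⟩ : ∃ F : ℤ × ℤ × ℤ → ℝ, ∀ t, F t = K * q * J t.1 t.2.1 t.2.2 *
      √(G t.1 t.2.1 t.2.2) * (ω t.1 * ω t.2.1 * ω t.2.2) := ⟨_, fun _ => rfl⟩
  have hF0 : ∀ t, 0 ≤ F t := by
    intro t
    rw [hF]
    exact mul_nonneg (by positivity) (mul_nonneg (mul_nonneg (hω0 _) (hω0 _)) (hω0 _))
  have hident : (q : ℂ) ^ 3 * (divCount N q k - (N : ℂ) ^ 3 * (lam q k / (q : ℂ) ^ 3)) =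
      ∑ t ∈ (univ : Finset (ZMod q × ZMod q × ZMod q)).erase 0, expSum q k t.1 t.2.1 t.2.2 *
        (intervalSum q N t.1 * intervalSum q N t.2.1 * intervalSum q N t.2.2) := by
    rw [sum_erase_eq_sub (mem_univ _), ← divCount_eq_sum, mul_sub]
    congr 1
    have : intervalSum q N 0 = N := by simp [intervalSum]
    simp only [Prod.fst_zero, Prod.snd_zero]
    rw [this, ← lam_eq_expSum]
    have hq' : (q : ℂ) ≠ 0 := by exact_mod_cast NeZero.ne q
    field_simp
  have hnorm : (q : ℝ) ^ 3 * |(divCount N q k : ℝ) - (N : ℝ) ^ 3 * (lam q k / (q : ℝ) ^ 3)| ≤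
      ∑ t ∈ ((B ×ˢ B ×ˢ B).erase 0), F t := by
    have h1 := congrArg norm hident
    rw [norm_mul, norm_pow, Complex.norm_natCast] at h1
    have h2 : ‖(divCount N q k - (N : ℂ) ^ 3 * (lam q k / (q : ℂ) ^ 3) : ℂ)‖ =
        |(divCount N q k : ℝ) - (N : ℝ) ^ 3 * (lam q k / (q : ℝ) ^ 3)| := by
      rw [← Real.norm_eq_abs, ← Complex.norm_real]
      push_cast
      rfl
    rw [h2] at h1
    rw [h1]
    set ι : ZMod q × ZMod q × ZMod q → ℤ × ℤ × ℤ := fun t =>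
      (t.1.valMinAbs, t.2.1.valMinAbs, t.2.2.valMinAbs) with hι
    have hinj : Function.Injective ι := by
      intro t t' htt
      simp only [hι, Prod.mk.injEq, ZMod.valMinAbs_inj] at htt
      exact Prod.ext htt.1 (Prod.ext htt.2.1 htt.2.2)
    have hmemB : ∀ x : ZMod q, x.valMinAbs ∈ B := by
      intro x
      have := ZMod.valMinAbs_mem_Ioc x
      rw [hB, mem_Icc]
      have h3 := this.1
      have h4 := this.2
      constructor <;> omega
    calc _ ≤ ∑ t ∈ (univ : Finset (ZMod q × ZMod q × ZMod q)).erase 0,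
          F (ι t) := by
          refine norm_sum_le_of_le _ fun t _ => ?_
          rw [norm_mul, norm_mul, norm_mul, hF]
          have hb := hbound t.1.valMinAbs t.2.1.valMinAbs t.2.2.valMinAbs
          rw [ZMod.coe_valMinAbs, ZMod.coe_valMinAbs, ZMod.coe_valMinAbs] at hb
          refine mul_le_mul hb ?_ (by positivity) ((norm_nonneg _).trans hb)
          exact mul_le_mul (mul_le_mul (norm_intervalSum_le_freqWeight _ _)
            (norm_intervalSum_le_freqWeight _ _) (norm_nonneg _) (hω0 _))
            (norm_intervalSum_le_freqWeight _ _) (norm_nonneg _) (mul_nonneg (hω0 _) (hω0 _))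
      _ = ∑ t ∈ ((univ : Finset (ZMod q × ZMod q × ZMod q)).erase 0).image ι, F t := by
          rw [sum_image hinj.injOn]
      _ ≤ _ := by
          refine sum_le_sum_of_subset_of_nonneg ?_ fun t _ _ => ?_
          · intro t ht
            obtain ⟨x, hx, rfl⟩ := mem_image.mp ht
            refine mem_erase.mpr ⟨?_, ?_⟩
            · intro h0
              apply (mem_erase.mp hx).1
              apply hinj
              rw [h0]
              simp only [hι, Prod.fst_zero, Prod.snd_zero, ZMod.valMinAbs_zero]
              rfl
            · simp only [hι, mem_product]
              exact ⟨hmemB _, hmemB _, hmemB _⟩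
          · exact hF0 t
  have hcover : ∑ t ∈ ((B ×ˢ B ×ˢ B).erase 0), F t ≤
      ∑ i ∈ q.divisors ×ˢ q.divisors, ∑ t ∈ ((B ×ˢ B ×ˢ B).erase 0).filter
        (fun t => i = (J t.1 t.2.1 t.2.2, G t.1 t.2.1 t.2.2)), F t := by
    refine sum_le_sum_filter_of_cover (fun t _ => hF0 t) ?_
    intro t _
    refine ⟨(J t.1 t.2.1 t.2.2, G t.1 t.2.1 t.2.2), ?_, rfl⟩
    have := hJG t.1 t.2.1 t.2.2
    exact mem_product.mpr ⟨Nat.mem_divisors.mpr ⟨(dvd_mul_right _ _).trans this, NeZero.ne q⟩,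
        Nat.mem_divisors.mpr ⟨(dvd_mul_left _ _).trans this, NeZero.ne q⟩⟩
  have heach : ∀ i ∈ q.divisors ×ˢ q.divisors, ∑ t ∈ ((B ×ˢ B ×ˢ B).erase 0).filter
        (fun t => i = (J t.1 t.2.1 t.2.2, G t.1 t.2.1 t.2.2)), F t ≤
      6 * K * #q.divisors * (3 + Real.log q) * q ^ 2 * L ^ 2 := by
    rintro ⟨j, g⟩ hi
    obtain ⟨hj, hg⟩ := mem_product.mp hi
    have hj0 : 0 < j := Nat.pos_of_mem_divisors hj
    have hg0 : 0 < g := Nat.pos_of_mem_divisors hg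
    have hgs : 0 < √(g : ℝ) := Real.sqrt_pos.mpr (by exact_mod_cast hg0)
    have hjR : (0 : ℝ) < j := by exact_mod_cast hj0
    have hcard : (#g.divisors : ℝ) ≤ #q.divisors := by
      exact_mod_cast card_le_card
        (Nat.divisors_subset_of_dvd (NeZero.ne q) (Nat.dvd_of_mem_divisors hg))
    calc _ ≤ ∑ t ∈ ((B ×ˢ B ×ˢ B).erase 0).filter (fun t => FreqCond j g t.1 t.2.1 t.2.2),
          K * q * j * √g * (ω t.1 * ω t.2.1 * ω t.2.2) := by
          rw [sum_filter, sum_filter]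
          refine sum_le_sum fun t _ => ?_
          split_ifs with h1 h2 h2
          · simp only [Prod.mk.injEq] at h1
            rw [hF, ← h1.1, ← h1.2]
          · exfalso
            apply h2
            simp only [Prod.mk.injEq] at h1
            rw [h1.1, h1.2]
            exact ⟨hu _ _ _, hv _ _ _, hw _ _ _, hG _ _ _⟩
          · exact mul_nonneg (by positivity) (mul_nonneg (mul_nonneg (hω0 _) (hω0 _)) (hω0 _))
          · exact le_rfl
      _ ≤ K * q * j * √g * (3 * (L ^ 2 * (2 * (q / j) * (#g.divisors *
            ((3 + Real.log q) / √g))))) := by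
          rw [← mul_sum]
          exact mul_le_mul_of_nonneg_left (sum_freqWeight_triple_le N q hj0 hg0) (by positivity)
      _ = 6 * K * #g.divisors * (3 + Real.log q) * q ^ 2 * L ^ 2 := by
          field_simp
          ring
      _ ≤ _ := by gcongr
  have htot : (q : ℝ) ^ 3 * |(divCount N q k : ℝ) - (N : ℝ) ^ 3 * (lam q k / (q : ℝ) ^ 3)| ≤
      #q.divisors ^ 2 * (6 * K * #q.divisors * (3 + Real.log q) * q ^ 2 * L ^ 2) := by
    refine hnorm.trans (hcover.trans ((sum_le_card_nsmul _ _ _ heach).trans (le_of_eq ?_)))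
    rw [nsmul_eq_mul, card_product]
    push_cast
    ring
  have hLle : L ≤ 2 * (3 + Real.log q) * (N + q) := by
    rw [hL]
    have : (0 : ℝ) ≤ N := Nat.cast_nonneg N
    nlinarith [mul_nonneg hlog this, mul_nonneg hlog hq.le]
  have hL0 : 0 ≤ L := by positivity
  refine le_of_mul_le_mul_left (htot.trans ?_) (pow_pos hq 3)
  calc _ ≤ #q.divisors ^ 2 * (6 * K * #q.divisors * (3 + Real.log q) * q ^ 2 *
        (2 * (3 + Real.log q) * (N + q)) ^ 2) := by gcongr
    _ = _ := by
      field_simp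
      ring

end CountError

/-! ### Bounds uniform in d: small moduli, local densities, large moduli. -/

section UniformBounds

theorem three_add_log_le {δ : ℝ} (hδ : 0 < δ) {q : ℕ} (hq : q ≠ 0) :
    3 + Real.log q ≤ (3 + 1 / δ) * (q : ℝ) ^ δ := by
  have h1 : (1 : ℝ) ≤ q := by exact_mod_cast Nat.one_le_iff_ne_zero.mpr hq
  have h2 := Real.log_le_rpow_div (x := q) (by positivity) hδ
  have h3 : 1 ≤ (q : ℝ) ^ δ := Real.one_le_rpow h1 hδ.le
  rw [add_mul, one_div, inv_mul_eq_div]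
  linarith

theorem exists_divCount_error_le {r : ℕ} (hr : r ≠ 0) (k : ℤ) {η : ℝ} (hη : 0 < η) :
    ∃ C : ℝ, 0 ≤ C ∧ ∀ d : ℕ, Squarefree d → ∀ N : ℕ,
      |(divCount N (d ^ r) k : ℝ) - (N : ℝ) ^ 3 * (lam (d ^ r) k / ((d ^ r : ℕ) : ℝ) ^ 3)| ≤
        C * (d : ℝ) ^ η * ((N + (d : ℝ) ^ r) ^ 2 / (d : ℝ) ^ r) := by
  obtain ⟨A, hA, hbound⟩ := exists_expSumBound r k
  have hr0 : (0 : ℝ) < r := by exact_mod_cast Nat.pos_of_ne_zero hr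
  -- As q = d ^ r, the cubes of the divisor function and of the logarithm then cost d^(η/3) each,
  -- leaving d^(η/3) for A ^ ω(d).
  set δ : ℝ := η / (9 * r) with hδ
  have hδ0 : 0 < δ := by positivity
  obtain ⟨C₁, hC₁, h1⟩ := exists_pow_card_primeFactors_le hA (show 0 < η / 3 by positivity)
  obtain ⟨C₂, hC₂, h2⟩ := exists_card_divisors_le hδ0
  refine ⟨24 * C₁ * C₂ ^ 3 * (3 + 1 / δ) ^ 3, by positivity, fun d hd N => ?_⟩
  have hd0 : d ≠ 0 := hd.ne_zero
  have hq0 : d ^ r ≠ 0 := pow_ne_zero r hd0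
  have : NeZero (d ^ r) := ⟨hq0⟩
  have hdR : (0 : ℝ) < d := by exact_mod_cast Nat.pos_of_ne_zero hd0
  refine (abs_divCount_sub_le N (by positivity) (hbound d hd)).trans ?_
  have e1 : ((d ^ r : ℕ) : ℝ) ^ δ = (d : ℝ) ^ (η / 9) := by
    push_cast
    rw [← Real.rpow_natCast, ← Real.rpow_mul hdR.le]
    congr 1
    rw [hδ]
    field_simp
  have e2 : ((d : ℝ) ^ (η / 9)) ^ 3 = (d : ℝ) ^ (η / 3) := by
    rw [← Real.rpow_natCast, ← Real.rpow_mul hdR.le]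
    congr 1
    push_cast
    ring
  have e3 : (d : ℝ) ^ (η / 3) * (d : ℝ) ^ (η / 3) * (d : ℝ) ^ (η / 3) = (d : ℝ) ^ η := by
    rw [← Real.rpow_add hdR, ← Real.rpow_add hdR]
    congr 1
    ring
  have b1 := h1 d hd0
  have b2 := h2 (d ^ r) hq0
  have b3 := three_add_log_le hδ0 hq0
  have hlog : 0 ≤ Real.log ((d ^ r : ℕ) : ℝ) := Real.log_natCast_nonneg _
  rw [e1] at b2 b3
  calc _ ≤ 24 * (C₁ * (d : ℝ) ^ (η / 3)) * (C₂ * (d : ℝ) ^ (η / 9)) ^ 3 *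
        ((3 + 1 / δ) * (d : ℝ) ^ (η / 9)) ^ 3 *
        ((N + ((d ^ r : ℕ) : ℝ)) ^ 2 / ((d ^ r : ℕ) : ℝ)) := by gcongr
    _ = 24 * C₁ * C₂ ^ 3 * (3 + 1 / δ) ^ 3 * ((d : ℝ) ^ (η / 3) * ((d : ℝ) ^ (η / 9)) ^ 3 *
        ((d : ℝ) ^ (η / 9)) ^ 3) * ((N + (d : ℝ) ^ r) ^ 2 / (d : ℝ) ^ r) := by
        push_cast
        ring
    _ = _ := by rw [e2, e3]

theorem exists_lam_le (r : ℕ) (k : ℤ) {η : ℝ} (hη : 0 < η) :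
    ∃ C : ℝ, 0 ≤ C ∧ ∀ d : ℕ, Squarefree d →
      (lam (d ^ r) k : ℝ) / ((d ^ r : ℕ) : ℝ) ^ 3 ≤ C * (d : ℝ) ^ (η - r) := by
  obtain ⟨A, hA, hbound⟩ := exists_expSumBound r k
  obtain ⟨C, hC, h1⟩ := exists_pow_card_primeFactors_le hA hη
  refine ⟨C, hC.le, fun d hd => ?_⟩
  have hd0 : d ≠ 0 := hd.ne_zero
  have : NeZero (d ^ r) := ⟨pow_ne_zero r hd0⟩
  have hdR : (0 : ℝ) < d := by exact_mod_cast Nat.pos_of_ne_zero hd0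
  have h2 := lam_le_of_expSumBound (by positivity) (hbound d hd)
  have hq : (0 : ℝ) < ((d ^ r : ℕ) : ℝ) := by exact_mod_cast NeZero.pos (d ^ r)
  rw [div_le_iff₀ (by positivity), Real.rpow_sub hdR, Real.rpow_natCast]
  push_cast at *
  calc _ ≤ A ^ #d.primeFactors * ((d : ℝ) ^ r) ^ 2 := h2
    _ ≤ C * (d : ℝ) ^ η * ((d : ℝ) ^ r) ^ 2 := by gcongr; exact h1 d hd0
    _ = _ := by field_simp

/-- The number of triples in `[1, N] ^ 3` for which `x ^ 2 + y ^ 2 + z ^ 2 + k` is a nonzero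
multiple of `q`. -/
def nonzeroCount (N q : ℕ) (k : ℤ) : ℕ :=
  #((Icc 1 N ×ˢ Icc 1 N ×ˢ Icc 1 N).filter fun t : ℕ × ℕ × ℕ =>
    (t.1 : ℤ) ^ 2 + (t.2.1 : ℤ) ^ 2 + (t.2.2 : ℤ) ^ 2 + k ≠ 0 ∧
    (q : ℤ) ∣ (t.1 : ℤ) ^ 2 + (t.2.1 : ℤ) ^ 2 + (t.2.2 : ℤ) ^ 2 + k)

/-- A value qm ≠ 0 has |m| ≪ N²/q, so there are O(N³/q) pairs (x, m), and each fixes y² + z², with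
N^η solutions up to a constant. The value 0 has to be left out, being a multiple of every q. -/
theorem exists_nonzeroCount_le (k : ℤ) {η : ℝ} (hη : 0 < η) :
    ∃ C : ℝ, 0 ≤ C ∧ ∀ N q : ℕ, 1 ≤ N → 1 ≤ q →
      (nonzeroCount N q k : ℝ) ≤ C * (N : ℝ) ^ (3 + η) / q := by
  obtain ⟨C₀, hC₀, hdiv⟩ := exists_card_divisors_le (show 0 < η / 4 by positivity)
  refine ⟨2 * (3 + k.natAbs) * (C₀ * 2 ^ (η / 4)) ^ 2, by positivity, fun N q hN hq => ?_⟩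
  have hNR : (1 : ℝ) ≤ N := by exact_mod_cast hN
  have hqR : (0 : ℝ) < q := by exact_mod_cast hq
  set T := (Icc 1 N ×ˢ Icc 1 N ×ˢ Icc 1 N).filter fun t : ℕ × ℕ × ℕ =>
    (t.1 : ℤ) ^ 2 + (t.2.1 : ℤ) ^ 2 + (t.2.2 : ℤ) ^ 2 + k ≠ 0 ∧
    (q : ℤ) ∣ (t.1 : ℤ) ^ 2 + (t.2.1 : ℤ) ^ 2 + (t.2.2 : ℤ) ^ 2 + k with hT
  set M : ℕ := (3 * N ^ 2 + k.natAbs) / q with hM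
  set Φ : ℕ × ℕ × ℕ → ℕ × ℤ := fun t =>
    (t.1, ((t.1 : ℤ) ^ 2 + (t.2.1 : ℤ) ^ 2 + (t.2.2 : ℤ) ^ 2 + k) / q) with hΦ
  have hmem : ∀ t ∈ T, (1 ≤ t.1 ∧ t.1 ≤ N) ∧ (1 ≤ t.2.1 ∧ t.2.1 ≤ N) ∧ (1 ≤ t.2.2 ∧ t.2.2 ≤ N) ∧
      (t.1 : ℤ) ^ 2 + (t.2.1 : ℤ) ^ 2 + (t.2.2 : ℤ) ^ 2 + k ≠ 0 ∧
      (q : ℤ) ∣ (t.1 : ℤ) ^ 2 + (t.2.1 : ℤ) ^ 2 + (t.2.2 : ℤ) ^ 2 + k := by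
    intro t ht
    simp only [hT, mem_filter, mem_product, mem_Icc] at ht
    tauto
  have hmaps : ∀ t ∈ T, Φ t ∈ Icc 1 N ×ˢ ((Icc (-(M : ℤ)) M).filter (· ≠ 0)) := by
    intro t ht
    obtain ⟨hx, hy, hz, hne, m, hm⟩ := hmem t ht
    have hqZ : (q : ℤ) ≠ 0 := by exact_mod_cast (by omega : q ≠ 0)
    simp only [hΦ, mem_product, mem_filter]
    rw [hm, Int.mul_ediv_cancel_left _ hqZ]
    refine ⟨mem_Icc.mpr hx, ?_, ?_⟩
    · have habs : q * m.natAbs ≤ 3 * N ^ 2 + k.natAbs := by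
        have h1 : ((q : ℤ) * m).natAbs ≤ 3 * N ^ 2 + k.natAbs := by
          rw [← hm]
          refine (Int.natAbs_add_le _ _).trans ?_
          gcongr
          have : (t.1 : ℤ) ^ 2 + (t.2.1 : ℤ) ^ 2 + (t.2.2 : ℤ) ^ 2 =
            ((t.1 ^ 2 + t.2.1 ^ 2 + t.2.2 ^ 2 : ℕ) : ℤ) := by push_cast; rfl
          rw [this, Int.natAbs_natCast]
          have e1 := Nat.pow_le_pow_left hx.2 2
          have e2 := Nat.pow_le_pow_left hy.2 2
          have e3 := Nat.pow_le_pow_left hz.2 2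
          omega
        rwa [Int.natAbs_mul, Int.natAbs_natCast] at h1
      have hmM : m.natAbs ≤ M := by
        rw [hM, Nat.le_div_iff_mul_le (by omega), mul_comm]
        exact habs
      rw [mem_Icc]
      omega
    · rintro rfl
      exact hne (by rw [hm, mul_zero])
  have hfib : ∀ i ∈ Icc 1 N ×ˢ ((Icc (-(M : ℤ)) M).filter (· ≠ 0)),
      (#(T.filter fun t => Φ t = i) : ℝ) ≤ (C₀ * 2 ^ (η / 4)) ^ 2 * (N : ℝ) ^ η := by
    rintro ⟨x, m⟩ -
    rcases (T.filter fun t => Φ t = (x, m)).eq_empty_or_nonempty with h0 | ⟨t₀, ht₀⟩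
    · rw [h0]
      simp only [card_empty, Nat.cast_zero]
      positivity
    have heq : ∀ t ∈ T.filter fun t => Φ t = (x, m), t.1 = x ∧
        ((t.2.1 ^ 2 + t.2.2 ^ 2 : ℕ) : ℤ) = q * m - x ^ 2 - k := by
      intro t ht
      obtain ⟨ht1, ht2⟩ := mem_filter.mp ht
      simp only [hΦ, Prod.mk.injEq] at ht2
      obtain ⟨-, -, -, -, hd⟩ := hmem t ht1
      refine ⟨ht2.1, ?_⟩
      have := Int.mul_ediv_cancel' hd
      rw [ht2.2, ht2.1] at this
      push_cast
      linarith
    set n := t₀.2.1 ^ 2 + t₀.2.2 ^ 2 with hn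
    obtain ⟨hx, hy, hz, -, -⟩ := hmem t₀ (mem_filter.mp ht₀).1
    have hn0 : 0 < n := by
      have : 0 < t₀.2.1 := hy.1
      positivity
    have hnN : n ≤ 2 * N ^ 2 := by
      have e2 := Nat.pow_le_pow_left hy.2 2
      have e3 := Nat.pow_le_pow_left hz.2 2
      omega
    have hcard : #(T.filter fun t => Φ t = (x, m)) ≤ #n.divisors ^ 2 := by
      refine le_trans ?_ (card_sq_add_sq_le N hn0)
      refine card_le_card_of_injOn (fun t => t.2) ?_ ?_
      · intro t ht
        obtain ⟨-, hy', hz', -, -⟩ := hmem t (mem_filter.mp ht).1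
        simp only [coe_filter, mem_product, mem_Icc, Set.mem_ofPred_eq]
        refine ⟨⟨hy', hz'⟩, ?_⟩
        have h1 := (heq t ht).2
        have h2 := (heq t₀ ht₀).2
        exact_mod_cast h1.trans h2.symm
      · intro t ht t' ht' h
        exact Prod.ext ((heq t ht).1.trans (heq t' ht').1.symm) h
    calc (#(T.filter fun t => Φ t = (x, m)) : ℝ) ≤ (#n.divisors : ℝ) ^ 2 := by exact_mod_cast hcard
      _ ≤ (C₀ * (n : ℝ) ^ (η / 4)) ^ 2 := by
          gcongr
          exact hdiv n hn0.ne'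
      _ ≤ (C₀ * (2 * (N : ℝ) ^ 2) ^ (η / 4)) ^ 2 := by
          gcongr
          exact_mod_cast hnN
      _ = _ := by
          rw [Real.mul_rpow (by positivity) (by positivity), ← mul_assoc, mul_pow _ (_ ^ (η / 4))]
          congr 1
          rw [← Real.rpow_natCast (N : ℝ) 2, ← Real.rpow_mul (by positivity),
            ← Real.rpow_natCast, ← Real.rpow_mul (by positivity)]
          congr 1
          push_cast
          ring
  have hcardI : (#(Icc 1 N ×ˢ ((Icc (-(M : ℤ)) M).filter (· ≠ 0))) : ℝ) ≤
      N * (2 * ((3 + k.natAbs) * (N : ℝ) ^ 2 / q)) := by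
    rw [card_product, Nat.card_Icc, Nat.add_sub_cancel]
    push_cast
    gcongr
    have h1 := sum_natAbs_le M (G := fun _ => 1) fun _ => zero_le_one
    simp only [sum_const, nsmul_eq_mul, mul_one, Nat.card_Icc, Nat.add_sub_cancel] at h1
    refine h1.trans ?_
    gcongr
    calc (M : ℝ) ≤ ((3 * N ^ 2 + k.natAbs : ℕ) : ℝ) / q := Nat.cast_div_le
      _ ≤ _ := by
        gcongr
        push_cast
        nlinarith [Nat.cast_nonneg (α := ℝ) k.natAbs, one_le_pow₀ (n := 2) hNR]
  have htot : (nonzeroCount N q k : ℝ) ≤ #(Icc 1 N ×ˢ ((Icc (-(M : ℤ)) M).filter (· ≠ 0))) *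
      ((C₀ * 2 ^ (η / 4)) ^ 2 * (N : ℝ) ^ η) := by
    have : nonzeroCount N q k = #T := rfl
    rw [this, card_eq_sum_card_fiberwise hmaps]
    push_cast
    rw [← nsmul_eq_mul]
    exact sum_le_card_nsmul _ _ _ hfib
  calc _ ≤ N * (2 * ((3 + k.natAbs) * (N : ℝ) ^ 2 / q)) *
        ((C₀ * 2 ^ (η / 4)) ^ 2 * (N : ℝ) ^ η) := htot.trans (by gcongr)
    _ = 2 * (3 + k.natAbs) * (C₀ * 2 ^ (η / 4)) ^ 2 * ((N : ℝ) ^ 3 * (N : ℝ) ^ η) / q := by ring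
    _ = _ := by
      rw [Real.rpow_add (by linarith)]
      norm_cast

theorem divCount_eq_nonzeroCount_add (N q : ℕ) (k : ℤ) :
    divCount N q k = nonzeroCount N q k +
      #((Icc 1 N ×ˢ Icc 1 N ×ˢ Icc 1 N).filter fun t : ℕ × ℕ × ℕ =>
        (t.1 : ℤ) ^ 2 + (t.2.1 : ℤ) ^ 2 + (t.2.2 : ℤ) ^ 2 + k = 0) := by
  unfold divCount nonzeroCount
  rw [← card_filter_add_card_filter_not (s := (Icc 1 N ×ˢ Icc 1 N ×ˢ Icc 1 N).filter fun t =>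
    (q : ℤ) ∣ (t.1 : ℤ) ^ 2 + (t.2.1 : ℤ) ^ 2 + (t.2.2 : ℤ) ^ 2 + k)
    (fun t => (t.1 : ℤ) ^ 2 + (t.2.1 : ℤ) ^ 2 + (t.2.2 : ℤ) ^ 2 + k ≠ 0), filter_filter,
    filter_filter]
  congr 2
  · ext t
    simp only [mem_filter]
    tauto
  · ext t
    simp only [mem_filter, not_not]
    constructor
    · rintro ⟨h1, -, h2⟩
      exact ⟨h1, h2⟩
    · rintro ⟨h1, h2⟩
      exact ⟨h1, by rw [h2]; exact dvd_zero _, h2⟩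

/-- A zero forces x² + y² + z² = |k|, so the bound is independent of N. -/
theorem card_zeros_le (N : ℕ) (k : ℤ) :
    #((Icc 1 N ×ˢ Icc 1 N ×ˢ Icc 1 N).filter fun t : ℕ × ℕ × ℕ =>
        (t.1 : ℤ) ^ 2 + (t.2.1 : ℤ) ^ 2 + (t.2.2 : ℤ) ^ 2 + k = 0) ≤ (k.natAbs + 1) ^ 3 := by
  refine (card_le_card (t := range (k.natAbs + 1) ×ˢ range (k.natAbs + 1) ×ˢ
    range (k.natAbs + 1)) ?_).trans (le_of_eq ?_)
  · rintro ⟨x, y, z⟩ h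
    simp only [mem_filter] at h
    have h1 : x ^ 2 + y ^ 2 + z ^ 2 = k.natAbs := by
      have : ((x ^ 2 + y ^ 2 + z ^ 2 : ℕ) : ℤ) = -k := by push_cast; linarith [h.2]
      omega
    simp only [mem_product, mem_range]
    refine ⟨?_, ?_, ?_⟩ <;> nlinarith [Nat.zero_le (x ^ 2), Nat.zero_le (y ^ 2),
      Nat.zero_le (z ^ 2), Nat.le_self_pow two_ne_zero x, Nat.le_self_pow two_ne_zero y,
      Nat.le_self_pow two_ne_zero z]
  · simp only [card_product, card_range]
    ring

end UniformBounds

open ArithmeticFunction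

/-! ### Möbius inversion for r-free values. -/

section Moebius

/-- `Nat.floorRoot r m` is the largest s with s ^ r ∣ m, and d ^ r ∣ m exactly when d ∣ s. The sum
is therefore that of μ over the divisors of s, and r-freeness means s = 1. -/
theorem sum_moebius_pow_dvd {r : ℕ} (hr : r ≠ 0) {n : ℤ} (hn : n ≠ 0) {B : ℕ}
    (hB : n.natAbs ≤ B) [Decidable (IsRFree r n)] :
    ∑ d ∈ (Icc 1 B).filter (fun d : ℕ => ((d ^ r : ℕ) : ℤ) ∣ n), (moebius d : ℤ) =
      if IsRFree r n then 1 else 0 := by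
  set m := n.natAbs with hm
  have hm0 : m ≠ 0 := Int.natAbs_ne_zero.mpr hn
  have hdvd : ∀ d : ℕ, ((d ^ r : ℕ) : ℤ) ∣ n ↔ d ∣ Nat.floorRoot r m := by
    intro d
    rw [Int.natCast_dvd, ← Nat.pow_dvd_iff_dvd_floorRoot]
  have hs0 : Nat.floorRoot r m ≠ 0 := Nat.floorRoot_ne_zero.mpr ⟨hr, hm0⟩
  have hset : (Icc 1 B).filter (fun d : ℕ => ((d ^ r : ℕ) : ℤ) ∣ n) =
      (Nat.floorRoot r m).divisors := by
    ext d
    simp only [mem_filter, mem_Icc, Nat.mem_divisors, hdvd]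
    constructor
    · exact fun h => ⟨h.2, hs0⟩
    · rintro ⟨h, -⟩
      refine ⟨⟨Nat.pos_of_dvd_of_pos h (Nat.pos_of_ne_zero hs0), ?_⟩, h⟩
      have h1 : d ^ r ∣ m := Nat.pow_dvd_iff_dvd_floorRoot.mpr h
      exact (Nat.le_self_pow hr d).trans ((Nat.le_of_dvd (Nat.pos_of_ne_zero hm0) h1).trans hB)
  have hfree : IsRFree r n ↔ Nat.floorRoot r m = 1 := by
    unfold IsRFree
    constructor
    · intro h
      by_contra hne
      have hp := Nat.minFac_prime hne
      apply h _ hp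
      have := (hdvd (Nat.floorRoot r m).minFac).mpr (Nat.minFac_dvd _)
      exact_mod_cast this
    · intro h p hp hd
      have : p ∣ Nat.floorRoot r m := by
        rw [← hdvd]
        exact_mod_cast hd
      rw [h] at this
      exact hp.one_lt.ne' (Nat.dvd_one.mp this)
  rw [hset, ← coe_mul_zeta_apply, moebius_mul_coe_zeta, one_apply]
  simp only [hfree]

theorem R_eq_sum_moebius {r : ℕ} (hr : r ≠ 0) (H : ℝ) (k : ℤ) {B : ℕ}
    (hB : 3 * ⌊H⌋₊ ^ 2 + k.natAbs ≤ B) :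
    (R H r k : ℤ) = ∑ d ∈ Icc 1 B, moebius d * (nonzeroCount ⌊H⌋₊ (d ^ r) k : ℤ) := by
  classical
  set N := ⌊H⌋₊
  set f : ℕ × ℕ × ℕ → ℤ := fun t => (t.1 : ℤ) ^ 2 + (t.2.1 : ℤ) ^ 2 + (t.2.2 : ℤ) ^ 2 + k with hf
  set X := Icc 1 N ×ˢ Icc 1 N ×ˢ Icc 1 N with hX
  have h1 : (R H r k : ℤ) = ∑ t ∈ X.filter (fun t => f t ≠ 0), if IsRFree r (f t) then 1 else 0 := by
    have : R H r k = #(X.filter fun t => IsRFree r (f t)) := by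
      unfold R
      congr
    rw [this, card_filter, sum_filter]
    push_cast
    refine sum_congr rfl fun t _ => ?_
    by_cases h0 : f t = 0
    · have : ¬ IsRFree r (f t) := fun h => h 2 Nat.prime_two (by rw [h0]; exact dvd_zero _)
      simp [h0]
      exact fun h => this (by rw [h0]; exact h)
    · simp [h0]
  have h2 : ∀ t ∈ X.filter (fun t => f t ≠ 0), (if IsRFree r (f t) then (1 : ℤ) else 0) =
      ∑ d ∈ Icc 1 B, if ((d ^ r : ℕ) : ℤ) ∣ f t then moebius d else 0 := by
    intro t ht
    obtain ⟨htX, ht0⟩ := mem_filter.mp ht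
    rw [← sum_filter]
    refine (sum_moebius_pow_dvd hr ht0 (le_trans ?_ hB)).symm
    simp only [hX, mem_product, mem_Icc] at htX
    simp only [hf]
    refine (Int.natAbs_add_le _ _).trans ?_
    gcongr
    have : (t.1 : ℤ) ^ 2 + (t.2.1 : ℤ) ^ 2 + (t.2.2 : ℤ) ^ 2 =
      ((t.1 ^ 2 + t.2.1 ^ 2 + t.2.2 ^ 2 : ℕ) : ℤ) := by push_cast; rfl
    rw [this, Int.natAbs_natCast]
    have e1 := Nat.pow_le_pow_left htX.1.2 2
    have e2 := Nat.pow_le_pow_left htX.2.1.2 2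
    have e3 := Nat.pow_le_pow_left htX.2.2.2 2
    omega
  rw [h1, sum_congr rfl h2, sum_comm]
  refine sum_congr rfl fun d _ => ?_
  rw [← sum_filter, sum_const, filter_filter, nsmul_eq_mul, mul_comm]
  rfl

end Moebius

/-! ### The singular series and its Euler product. -/

section EulerProduct

/-- The coefficients `μ(d) λ(d ^ r; k) / d ^ (3 r)` of the singular series. -/
noncomputable def singularCoeff (r : ℕ) (k : ℤ) (d : ℕ) : ℝ :=
  moebius d * ((lam (d ^ r) k : ℝ) / ((d ^ r : ℕ) : ℝ) ^ 3)

theorem exists_singularCoeff_le (r : ℕ) (k : ℤ) {η : ℝ} (hη : 0 < η) :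
    ∃ C : ℝ, 0 ≤ C ∧ ∀ d : ℕ, |singularCoeff r k d| ≤ C * (d : ℝ) ^ (η - r) := by
  obtain ⟨C, hC, h⟩ := exists_lam_le r k hη
  refine ⟨C, hC, fun d => ?_⟩
  unfold singularCoeff
  by_cases hd : Squarefree d
  · rw [abs_mul, abs_of_nonneg (a := (lam (d ^ r) k : ℝ) / _) (by positivity)]
    refine (mul_le_of_le_one_left (by positivity) ?_).trans (h d hd)
    exact_mod_cast abs_moebius_le_one (n := d)
  · rw [moebius_eq_zero_of_not_squarefree hd]
    simp only [Int.cast_zero, zero_mul, abs_zero]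
    positivity

theorem summable_singularCoeff {r : ℕ} (hr : 2 ≤ r) (k : ℤ) :
    Summable fun d => ‖singularCoeff r k d‖ := by
  obtain ⟨C, hC, h⟩ := exists_singularCoeff_le r k (show (0 : ℝ) < 1 / 4 by norm_num)
  have hr' : (2 : ℝ) ≤ r := by exact_mod_cast hr
  refine Summable.of_nonneg_of_le (fun _ => norm_nonneg _) h ?_
  exact (Real.summable_nat_rpow.mpr (by linarith)).mul_left C

/-- The coefficients are multiplicative by `lam_mul` and absolutely summable, being O(d^(η - r))
with r ≥ 2. In the factor at p, μ leaves only the exponents 0 and 1. -/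
theorem hasProd_eulerFactor {r : ℕ} (hr : 2 ≤ r) (k : ℤ) :
    HasProd (eulerFactor r k) (∑' d, singularCoeff r k d) := by
  have h0 : singularCoeff r k 0 = 0 := by simp [singularCoeff]
  have h1 : singularCoeff r k 1 = 1 := by simp [singularCoeff, lam_one]
  have hmul : ∀ {m n : ℕ}, m.Coprime n →
      singularCoeff r k (m * n) = singularCoeff r k m * singularCoeff r k n := by
    intro m n hmn
    rcases eq_or_ne m 0 with rfl | hm
    · rw [zero_mul, h0, zero_mul]
    rcases eq_or_ne n 0 with rfl | hn
    · rw [mul_zero, h0, mul_zero]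
    unfold singularCoeff
    rw [isMultiplicative_moebius.map_mul_of_coprime hmn, mul_pow,
      lam_mul (pow_ne_zero r hm) (pow_ne_zero r hn) (hmn.pow r r)]
    push_cast
    have hm' : (m : ℝ) ≠ 0 := by exact_mod_cast hm
    have hn' : (n : ℝ) ≠ 0 := by exact_mod_cast hn
    field_simp
  have := EulerProduct.eulerProduct_hasProd h1 hmul (summable_singularCoeff hr k) h0
  have hfun : eulerFactor r k = fun p : Nat.Primes => ∑' e, singularCoeff r k ((p : ℕ) ^ e) := by
    ext p
    rw [tsum_eq_sum (s := range 2)]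
    · rw [sum_range_succ, sum_range_one, pow_zero, pow_one, h1]
      unfold eulerFactor singularCoeff
      rw [moebius_apply_prime p.2]
      push_cast
      rw [← pow_mul, mul_comm 3 r]
      ring
    · intro e he
      have he2 : 2 ≤ e := by simpa [Nat.succ_le_iff] using he
      unfold singularCoeff
      rw [moebius_eq_zero_of_not_squarefree]
      · simp
      · intro hsq
        have := (Nat.squarefree_pow_iff p.2.ne_one (by omega)).mp hsq
        omega
  rw [hfun]
  exact this

end EulerProduct

/-! ### Assembling the asymptotic formula. -/

section Assembly

theorem sum_rpow_tail_le {D η s : ℝ} (hD : 1 ≤ D) (hs : s ≤ -1 - η) (hη : 0 < η) {T : Finset ℕ}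
    (hT : ∀ d ∈ T, D ≤ d) :
    ∑ d ∈ T, (d : ℝ) ^ s ≤ D ^ (s + 1 + η) * ∑' d : ℕ, (d : ℝ) ^ (-1 - η) := by
  have hsum : Summable fun d : ℕ => (d : ℝ) ^ (-1 - η) :=
    Real.summable_nat_rpow.mpr (by linarith)
  calc ∑ d ∈ T, (d : ℝ) ^ s ≤ ∑ d ∈ T, D ^ (s + 1 + η) * (d : ℝ) ^ (-1 - η) := by
        refine sum_le_sum fun d hd => ?_
        have hDd := hT d hd
        have hd0 : (0 : ℝ) < d := by linarith
        calc (d : ℝ) ^ s = (d : ℝ) ^ (s + 1 + η) * (d : ℝ) ^ (-1 - η) := by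
              rw [← Real.rpow_add hd0]
              congr 1
              ring
          _ ≤ _ := by
            exact mul_le_mul_of_nonneg_right
              (Real.rpow_le_rpow_of_nonpos (by linarith) hDd (by linarith)) (by positivity)
    _ = D ^ (s + 1 + η) * ∑ d ∈ T, (d : ℝ) ^ (-1 - η) := by rw [mul_sum]
    _ ≤ _ := by
      gcongr
      exact hsum.sum_le_tsum _ fun d _ => by positivity

theorem abs_sum_sub_tsum_le {a : ℕ → ℝ} {C D η s : ℝ} (hC : 0 ≤ C) (hD : 1 ≤ D)
    (hs : s ≤ -1 - η) (hη : 0 < η) (ha : ∀ d, |a d| ≤ C * (d : ℝ) ^ s) {T : Finset ℕ}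
    (hT : ∀ d ∉ T, a d = 0 ∨ D ≤ d) :
    |∑ d ∈ T, a d - ∑' d, a d| ≤ C * (D ^ (s + 1 + η) * ∑' d : ℕ, (d : ℝ) ^ (-1 - η)) := by
  have hsum : Summable a := Summable.of_norm_bounded
    ((Real.summable_nat_rpow.mpr (by linarith : s < -1)).mul_left C) ha
  have hlim : Filter.Tendsto (fun U : Finset ℕ => |∑ d ∈ T, a d - ∑ d ∈ U, a d|) Filter.atTop
      (nhds |∑ d ∈ T, a d - ∑' d, a d|) := (tendsto_const_nhds.sub hsum.hasSum).abs
  refine le_of_tendsto hlim ?_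
  filter_upwards [Filter.eventually_ge_atTop T] with U hU
  rw [← sum_sdiff hU, sub_add_cancel_right, abs_neg]
  calc |∑ d ∈ U \ T, a d| ≤ ∑ d ∈ U \ T, |a d| := abs_sum_le_sum_abs _ _
    _ = ∑ d ∈ (U \ T).filter (fun d : ℕ => D ≤ d), |a d| := by
        rw [sum_filter]
        refine sum_congr rfl fun d hd => ?_
        split_ifs with h
        · rfl
        · rcases hT d (mem_sdiff.mp hd).2 with h1 | h1
          · rw [h1, abs_zero]
          · exact absurd h1 h
    _ ≤ ∑ d ∈ (U \ T).filter (fun d : ℕ => D ≤ d), C * (d : ℝ) ^ s :=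
        sum_le_sum fun d _ => ha d
    _ ≤ _ := by
      rw [← mul_sum]
      gcongr
      exact sum_rpow_tail_le hD hs hη fun d hd => (mem_filter.mp hd).2

/-- Expanding the square gives N² d^(η - r), 2N d^η and d^(η + r). The first is summable; the others
are at most their value at D, times the number of terms, which is at most D. -/
theorem sum_small_divisors_le {r : ℕ} (hr : 2 ≤ r) {η : ℝ} (hη : 0 < η) (hη' : η ≤ 1 / 4)
    {D N : ℝ} (hD : 1 ≤ D) (hN : 0 ≤ N) {T : Finset ℕ} (hT : ∀ d ∈ T, 1 ≤ d ∧ (d : ℝ) ≤ D) :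
    ∑ d ∈ T, (d : ℝ) ^ η * ((N + (d : ℝ) ^ r) ^ 2 / (d : ℝ) ^ r) ≤
      (∑' d : ℕ, (d : ℝ) ^ (η - r)) * N ^ 2 + 2 * N * D ^ (1 + η) + D ^ (1 + η + r) := by
  have hr' : (2 : ℝ) ≤ r := by exact_mod_cast hr
  have hD0 : 0 < D := by linarith
  have hsum : Summable fun d : ℕ => (d : ℝ) ^ (η - r) :=
    Real.summable_nat_rpow.mpr (by linarith)
  have hcard : (#T : ℝ) ≤ D := by
    have h1 : #T ≤ ⌊D⌋₊ := by
      refine (card_le_card (t := Icc 1 ⌊D⌋₊) fun d hd => ?_).trans (by simp)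
      exact mem_Icc.mpr ⟨(hT d hd).1, Nat.le_floor (hT d hd).2⟩
    exact (Nat.cast_le.mpr h1).trans (Nat.floor_le hD0.le)
  have hconst : ∀ s : ℝ, 0 ≤ s → ∑ d ∈ T, (d : ℝ) ^ s ≤ D ^ (1 + s) := by
    intro s hs
    calc ∑ d ∈ T, (d : ℝ) ^ s ≤ #T • D ^ s := sum_le_card_nsmul _ _ _ fun d hd => by
            have := (hT d hd).2
            gcongr
      _ ≤ D * D ^ s := by
        rw [nsmul_eq_mul]
        gcongr
      _ = D ^ (1 + s) := by rw [Real.rpow_add hD0, Real.rpow_one]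
  calc _ = ∑ d ∈ T, ((d : ℝ) ^ (η - r) * N ^ 2 + 2 * N * (d : ℝ) ^ η + (d : ℝ) ^ (η + r)) := by
        refine sum_congr rfl fun d hd => ?_
        have hd0 : (0 : ℝ) < d := by exact_mod_cast (hT d hd).1
        rw [Real.rpow_sub hd0, Real.rpow_add hd0, Real.rpow_natCast]
        field_simp
        ring
    _ = (∑ d ∈ T, (d : ℝ) ^ (η - r)) * N ^ 2 + 2 * N * ∑ d ∈ T, (d : ℝ) ^ η +
        ∑ d ∈ T, (d : ℝ) ^ (η + r) := by
        rw [sum_add_distrib, sum_add_distrib, ← sum_mul, ← mul_sum]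
    _ ≤ _ := by
        gcongr
        · exact hsum.sum_le_tsum _ fun d _ => by positivity
        · exact hconst η hη.le
        · rw [add_assoc]
          exact hconst _ (by positivity)

theorem abs_cube_sub_cube_le {x y : ℝ} (hx : 0 ≤ x) (hxy : x ≤ y) (hyx : y - 1 ≤ x) :
    |x ^ 3 - y ^ 3| ≤ 3 * y ^ 2 := by
  have hy : 0 ≤ y := hx.trans hxy
  have h1 : x ^ 3 ≤ y ^ 3 := by gcongr
  rw [abs_sub_comm, abs_of_nonneg (by linarith)]
  calc y ^ 3 - x ^ 3 = (y - x) * (y * y + y * x + x * x) := by ring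
    _ ≤ 1 * (y * y + y * y + y * y) := by
      gcongr
      linarith
    _ = 3 * y ^ 2 := by ring

theorem R_asymptotic {r : ℕ} (hr : 2 ≤ r) (k : ℤ) {ε : ℝ} (hε : 0 < ε) :
    ∃ C : ℝ, 0 ≤ C ∧ ∀ H : ℝ, 1 ≤ H →
      |(R H r k : ℝ) - (∑' d, singularCoeff r k d) * H ^ 3| ≤
        C * (H ^ 2 + H ^ ((3 : ℝ) / 2 + 3 / (2 * (r : ℝ)) + ε)) := by
  have hr0 : r ≠ 0 := by omega
  have hr' : (2 : ℝ) ≤ r := by exact_mod_cast hr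
  have hrpos : (0 : ℝ) < r := by linarith
  -- The bound 1/4 gives 2η ≤ r - 1, so the tails converge; ε/4 leaves room for the accumulated
  -- powers H^η and D^η.
  set η : ℝ := min (ε / 4) (1 / 4) with hη
  have hη0 : 0 < η := lt_min (by positivity) (by norm_num)
  have hη1 : η ≤ ε / 4 := min_le_left _ _
  have hη2 : η ≤ 1 / 4 := min_le_right _ _
  obtain ⟨C₁, hC₁, hE⟩ := exists_divCount_error_le hr0 k hη0
  obtain ⟨C₂, hC₂, hL⟩ := exists_nonzeroCount_le k hη0
  obtain ⟨C₃, hC₃, hS⟩ := exists_singularCoeff_le r k hη0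
  set P := ∑' d, singularCoeff r k d with hP
  set Z₁ : ℝ := ∑' d : ℕ, (d : ℝ) ^ (η - r) with hZ₁
  set Z₂ : ℝ := ∑' d : ℕ, (d : ℝ) ^ (-1 - η) with hZ₂
  have hZ₁0 : 0 ≤ Z₁ := tsum_nonneg fun d => by positivity
  have hZ₂0 : 0 ≤ Z₂ := tsum_nonneg fun d => by positivity
  set Q : ℝ := ((k.natAbs + 1 : ℕ) : ℝ) ^ 3 with hQ
  have hQ0 : 0 ≤ Q := by positivity
  refine ⟨C₁ * (Z₁ + 3) + Q + C₂ * Z₂ + C₃ * Z₂ + 3 * |P|, by positivity, fun H hH => ?_⟩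
  have hH0 : 0 < H := by linarith
  set N := ⌊H⌋₊ with hN
  have hN1 : 1 ≤ N := Nat.one_le_iff_ne_zero.mpr (Nat.floor_pos.mpr hH).ne'
  have hNH : (N : ℝ) ≤ H := Nat.floor_le hH0.le
  have hHN : H - 1 ≤ N := by linarith [Nat.lt_floor_add_one H]
  -- The cutoff at which D^(r+1) and H³ D^(1-r) coincide.
  set D : ℝ := H ^ (3 / (2 * (r : ℝ))) with hD
  have hD1 : 1 ≤ D := Real.one_le_rpow hH (by positivity)
  set E : ℝ := H ^ ((3 : ℝ) / 2 + 3 / (2 * (r : ℝ)) + ε) with hEdef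
  have hE0 : 0 ≤ E := by positivity
  have hDpow : ∀ s t : ℝ, t + 3 / (2 * (r : ℝ)) * s ≤ (3 : ℝ) / 2 + 3 / (2 * (r : ℝ)) + ε →
      H ^ t * D ^ s ≤ E := by
    intro s t h
    rw [hD, ← Real.rpow_mul hH0.le, ← Real.rpow_add hH0]
    exact Real.rpow_le_rpow_of_exponent_le hH h
  have hκ : 3 / (2 * (r : ℝ)) ≤ 3 / 4 := by
    rw [div_le_div_iff₀ (by positivity) (by norm_num)]
    linarith
  have hκ0 : 0 < 3 / (2 * (r : ℝ)) := by positivity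
  have hκr : 3 / (2 * (r : ℝ)) * r = 3 / 2 := by field_simp
  set κ := 3 / (2 * (r : ℝ)) with hκdef
  have hκη : κ * η ≤ 3 / 4 * η := by gcongr
  -- The summand ⌊D⌋ makes `small` contain every d with 1 ≤ d ≤ D, so that it truncates the full
  -- singular series at D.
  set B := 3 * N ^ 2 + k.natAbs + ⌊D⌋₊ with hB
  set small := (Icc 1 B).filter (fun d : ℕ => (d : ℝ) ≤ D) with hsmall
  set large := (Icc 1 B).filter (fun d : ℕ => ¬ (d : ℝ) ≤ D) with hlarge
  have hmemsmall : ∀ d ∈ small, 1 ≤ d ∧ (d : ℝ) ≤ D := by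
    intro d hd
    simp only [hsmall, mem_filter, mem_Icc] at hd
    exact ⟨hd.1.1, hd.2⟩
  have hmemlarge : ∀ d ∈ large, 1 ≤ d ∧ D ≤ (d : ℝ) := by
    intro d hd
    simp only [hlarge, mem_filter, mem_Icc, not_le] at hd
    exact ⟨hd.1.1, hd.2.le⟩
  set z : ℕ := #((Icc 1 N ×ˢ Icc 1 N ×ˢ Icc 1 N).filter fun t : ℕ × ℕ × ℕ =>
        (t.1 : ℤ) ^ 2 + (t.2.1 : ℤ) ^ 2 + (t.2.2 : ℤ) ^ 2 + k = 0) with hz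
  have hzQ : (z : ℝ) ≤ Q := by
    rw [hQ]
    exact_mod_cast card_zeros_le N k
  have hμ : ∀ d : ℕ, |((moebius d : ℤ) : ℝ)| ≤ 1 := fun d => by
    exact_mod_cast abs_moebius_le_one (n := d)
  have hR : (R H r k : ℝ) = ∑ d ∈ Icc 1 B, ((moebius d : ℤ) : ℝ) * nonzeroCount N (d ^ r) k := by
    exact_mod_cast R_eq_sum_moebius hr0 H k (B := B) (Nat.le_add_right _ _)
  -- Five errors: equidistribution for d ≤ D, the zeros that `divCount` includes, the large d, the
  -- truncated series, and N³ in place of H³.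
  have hdecomp : (R H r k : ℝ) - P * H ^ 3 =
      ∑ d ∈ small, ((moebius d : ℤ) : ℝ) * ((divCount N (d ^ r) k : ℝ) -
        (N : ℝ) ^ 3 * (lam (d ^ r) k / ((d ^ r : ℕ) : ℝ) ^ 3)) -
      ∑ d ∈ small, ((moebius d : ℤ) : ℝ) * z +
      ∑ d ∈ large, ((moebius d : ℤ) : ℝ) * nonzeroCount N (d ^ r) k +
      (N : ℝ) ^ 3 * (∑ d ∈ small, singularCoeff r k d - P) + P * ((N : ℝ) ^ 3 - H ^ 3) := by
    rw [hR, ← sum_filter_add_sum_filter_not (Icc 1 B) (fun d : ℕ => (d : ℝ) ≤ D), mul_sub,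
      mul_sum]
    have h1 : ∑ d ∈ small, ((moebius d : ℤ) : ℝ) * (nonzeroCount N (d ^ r) k : ℝ) =
        ∑ d ∈ small, ((moebius d : ℤ) : ℝ) * ((divCount N (d ^ r) k : ℝ) -
        (N : ℝ) ^ 3 * (lam (d ^ r) k / ((d ^ r : ℕ) : ℝ) ^ 3)) -
      ∑ d ∈ small, ((moebius d : ℤ) : ℝ) * z + ∑ d ∈ small, (N : ℝ) ^ 3 * singularCoeff r k d := by
      rw [← sum_sub_distrib, ← sum_add_distrib]
      refine sum_congr rfl fun d _ => ?_
      rw [divCount_eq_nonzeroCount_add, singularCoeff]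
      push_cast
      ring
    rw [h1]
    ring
  have hNcast : (0 : ℝ) ≤ N := Nat.cast_nonneg N
  have b1 : |∑ d ∈ small, ((moebius d : ℤ) : ℝ) * ((divCount N (d ^ r) k : ℝ) -
        (N : ℝ) ^ 3 * (lam (d ^ r) k / ((d ^ r : ℕ) : ℝ) ^ 3))| ≤
        C₁ * (Z₁ * H ^ 2 + 3 * E) := by
    calc _ ≤ ∑ d ∈ small, C₁ * ((d : ℝ) ^ η * ((N + (d : ℝ) ^ r) ^ 2 / (d : ℝ) ^ r)) := by
          refine (abs_sum_le_sum_abs _ _).trans (sum_le_sum fun d _ => ?_)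
          rw [abs_mul]
          by_cases hd : Squarefree d
          · rw [← mul_assoc]
            exact (mul_le_of_le_one_left (abs_nonneg _) (hμ d)).trans (hE d hd N)
          · rw [moebius_eq_zero_of_not_squarefree hd]
            simp only [Int.cast_zero, abs_zero, zero_mul]
            positivity
      _ ≤ C₁ * (Z₁ * (N : ℝ) ^ 2 + 2 * N * D ^ (1 + η) + D ^ (1 + η + r)) := by
          rw [← mul_sum]
          gcongr
          exact sum_small_divisors_le hr hη0 hη2 hD1 hNcast hmemsmall
      _ ≤ C₁ * (Z₁ * H ^ 2 + 2 * E + E) := by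
          have e1 : (N : ℝ) * D ^ (1 + η) ≤ E := by
            refine le_trans ?_ (hDpow (1 + η) 1 ?_)
            · rw [Real.rpow_one]
              gcongr
            · linarith [mul_add κ 1 η]
          have e2 : D ^ (1 + η + r) ≤ E := by
            refine le_trans (le_of_eq ?_) (hDpow (1 + η + r) 0 ?_)
            · rw [Real.rpow_zero, one_mul]
            · linarith [mul_add κ (1 + η) r, mul_add κ 1 η]
          rw [mul_assoc 2]
          gcongr
      _ = _ := by ring
  have b2 : |∑ d ∈ small, ((moebius d : ℤ) : ℝ) * z| ≤ Q * H ^ 2 := by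
    calc _ ≤ ∑ d ∈ small, Q := by
          refine (abs_sum_le_sum_abs _ _).trans (sum_le_sum fun d _ => ?_)
          rw [abs_mul, Nat.abs_cast]
          exact (mul_le_of_le_one_left (Nat.cast_nonneg z) (hμ d)).trans hzQ
      _ = #small * Q := by rw [sum_const, nsmul_eq_mul]
      _ ≤ H ^ 2 * Q := by
          gcongr
          have h1 : #small ≤ ⌊D⌋₊ := by
            refine (card_le_card (t := Icc 1 ⌊D⌋₊) fun d hd => ?_).trans (by simp)
            exact mem_Icc.mpr ⟨(hmemsmall d hd).1, Nat.le_floor (hmemsmall d hd).2⟩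
          calc (#small : ℝ) ≤ ⌊D⌋₊ := Nat.cast_le.mpr h1
            _ ≤ D := Nat.floor_le (by linarith)
            _ ≤ H ^ (2 : ℝ) := Real.rpow_le_rpow_of_exponent_le hH (by linarith)
            _ = H ^ 2 := Real.rpow_two H
      _ = _ := by ring
  have b3 : |∑ d ∈ large, ((moebius d : ℤ) : ℝ) * nonzeroCount N (d ^ r) k| ≤ C₂ * Z₂ * E := by
    calc _ ≤ ∑ d ∈ large, C₂ * H ^ (3 + η) * (d : ℝ) ^ (-(r : ℝ)) := by
          refine (abs_sum_le_sum_abs _ _).trans (sum_le_sum fun d hd => ?_)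
          have hd1 := (hmemlarge d hd).1
          rw [abs_mul, Nat.abs_cast]
          refine (mul_le_of_le_one_left (Nat.cast_nonneg _) (hμ d)).trans ?_
          refine (hL N (d ^ r) hN1 (Nat.one_le_pow _ _ hd1)).trans ?_
          rw [Real.rpow_neg (Nat.cast_nonneg d), Real.rpow_natCast, ← div_eq_mul_inv]
          push_cast
          gcongr
      _ ≤ C₂ * H ^ (3 + η) * (D ^ (-(r : ℝ) + 1 + η) * Z₂) := by
          rw [← mul_sum]
          gcongr
          exact sum_rpow_tail_le hD1 (by linarith) hη0 fun d hd => (hmemlarge d hd).2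
      _ = C₂ * Z₂ * (H ^ (3 + η) * D ^ (-(r : ℝ) + 1 + η)) := by ring
      _ ≤ _ := by
          gcongr
          refine hDpow _ _ ?_
          have : κ * (-(r : ℝ) + 1 + η) = -(κ * r) + κ + κ * η := by ring
          linarith
  have b4 : |(N : ℝ) ^ 3 * (∑ d ∈ small, singularCoeff r k d - P)| ≤ C₃ * Z₂ * E := by
    rw [abs_mul, abs_of_nonneg (a := (N : ℝ) ^ 3) (by positivity)]
    have h1 : |∑ d ∈ small, singularCoeff r k d - P| ≤ C₃ * (D ^ ((η - r) + 1 + η) * Z₂) := by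
      refine abs_sum_sub_tsum_le hC₃ hD1 (by linarith) hη0 hS fun d hd => ?_
      by_cases hd0 : d = 0
      · left
        simp [hd0, singularCoeff]
      · right
        by_contra hcon
        apply hd
        have hdD : (d : ℝ) ≤ D := by linarith
        have h2 : d ≤ ⌊D⌋₊ := Nat.le_floor hdD
        simp only [hsmall, mem_filter, mem_Icc]
        refine ⟨⟨by omega, by omega⟩, hdD⟩
    calc _ ≤ H ^ 3 * (C₃ * (D ^ ((η - r) + 1 + η) * Z₂)) := by gcongr
      _ = C₃ * Z₂ * (H ^ (3 : ℝ) * D ^ ((η - r) + 1 + η)) := by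
          rw [show H ^ (3 : ℝ) = H ^ 3 by norm_cast]
          ring
      _ ≤ _ := by
          gcongr
          refine hDpow _ _ ?_
          have : κ * ((η - r) + 1 + η) = -(κ * r) + κ + 2 * (κ * η) := by ring
          linarith
  have b5 : |P * ((N : ℝ) ^ 3 - H ^ 3)| ≤ 3 * |P| * H ^ 2 := by
    rw [abs_mul, mul_comm 3, mul_assoc]
    exact mul_le_mul_of_nonneg_left (abs_cube_sub_cube_le hNcast hNH hHN) (abs_nonneg P)
  rw [hdecomp]
  have hH2 : 0 ≤ H ^ 2 := by positivity
  have hfin : C₁ * (Z₁ * H ^ 2 + 3 * E) + Q * H ^ 2 + C₂ * Z₂ * E + C₃ * Z₂ * E +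
      3 * |P| * H ^ 2 ≤ (C₁ * (Z₁ + 3) + Q + C₂ * Z₂ + C₃ * Z₂ + 3 * |P|) * (H ^ 2 + E) := by
    have p1 : 0 ≤ C₁ * Z₁ * E := by positivity
    have p2 : 0 ≤ C₁ * 3 * H ^ 2 := by positivity
    have p3 : 0 ≤ Q * E := by positivity
    have p4 : 0 ≤ C₂ * Z₂ * H ^ 2 := by positivity
    have p5 : 0 ≤ C₃ * Z₂ * H ^ 2 := by positivity
    have p6 : 0 ≤ 3 * |P| * E := by positivity
    linarith
  refine le_trans ?_ hfin
  refine (abs_add_le _ _).trans (add_le_add ?_ b5)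
  refine (abs_add_le _ _).trans (add_le_add ?_ b4)
  refine (abs_add_le _ _).trans (add_le_add ?_ b3)
  exact (abs_sub _ _).trans (add_le_add b1 b2)

end Assembly

end RFreeValues

theorem theorem1 (r : ℕ) (hr : 2 ≤ r) (k : ℤ) :
    Multipliable (RFreeValues.eulerFactor r k) ∧
    (k ≠ 0 → ∀ ε : ℝ, 0 < ε → ∃ C : ℝ, ∀ H : ℝ, 1 ≤ H →
      |(RFreeValues.R H r k : ℝ) - (∏' p : Nat.Primes, RFreeValues.eulerFactor r k p) * H ^ 3|
        ≤ C * (H ^ 2 + H ^ ((3 : ℝ) / 2 + 3 / (2 * (r : ℝ)) + ε))) ∧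
    (k = 0 → ∀ ε : ℝ, 0 < ε → ∃ C : ℝ, ∀ H : ℝ, 1 ≤ H →
      |(RFreeValues.R H r k : ℝ) - (∏' p : Nat.Primes, RFreeValues.eulerFactor r k p) * H ^ 3|
        ≤ C * (H ^ ((2 : ℝ) + ε) + H ^ (9 * (r : ℝ) / (5 * (r : ℝ) - 2) + ε))) := by
  have hprod := RFreeValues.hasProd_eulerFactor hr k
  rw [hprod.tprod_eq]
  refine ⟨hprod.multipliable, fun _ ε hε => ?_, fun _ ε hε => ?_⟩
  · obtain ⟨C, -, h⟩ := RFreeValues.R_asymptotic hr k hε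
    exact ⟨C, h⟩
  · obtain ⟨C, hC, h⟩ := RFreeValues.R_asymptotic hr k hε
    refine ⟨C, fun H hH => (h H hH).trans ?_⟩
    have hr' : (2 : ℝ) ≤ r := by exact_mod_cast hr
    gcongr
    · rw [← Real.rpow_two]
      exact Real.rpow_le_rpow_of_exponent_le hH (by linarith)
    -- Cleared of denominators, 3/2 + 3/(2r) ≤ 9r/(5r - 2) amounts to (r - 1)(r - 2) ≥ 0.
    · rw [div_add_div _ _ (by norm_num) (by positivity),
        div_le_div_iff₀ (by positivity) (by linarith)]
      nlinarith [mul_nonneg (sub_nonneg.mpr hr') (show (0 : ℝ) ≤ (r : ℝ) - 1 by linarith)]
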